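/- Let $k$ be an algebraically closed field of characteristic different from $2$ and $3$, and let $S=k[x_0,\dots,x_4]$. Let $\mathcal{H}ilb_6^{aG,0}(\mathbb P^4)$ be the set of closed subschemes $X\subseteq\mathbb P^4_k$ of dimension $0$ and degree $6$ that are not contained in a hyperplane and are arithmetically Gorenstein, i.e. $S/I_X$ is a Gorenstein ring, where $I_X\subseteq S$ is the saturated homogeneous ideal of $X$. For a $k$-algebra $A$ let $O(A)\subseteq\mathcal{H}ilb_6^{aG,0}(\mathbb P^4)$ be the $\operatorname{PGL}_5(k)$-orbit of the schemes $Y\in\mathcal{H}ilb_6^{aG,0}(\mathbb P^4)$ that are abstractly isomorphic to $\operatorname{Spec}A$. Put $$A_{1,6}=k[x]/(x^6),\qquad A_1^{sp}=k[x_1,x_2]/(x_2^2,\,x_1^3),\qquad A_2^{sp}=k[x_1,x_2]/(x_2^2-x_1^2,\,x_1^3).$$ A scheme $X\subseteq\mathbb P^4$ can be obtained via the Italian construction if, for some choice of the homogeneous coordinates $x_0,\dots,x_4$, $$I_X=I_{\widetilde X|h}+(x_1x_4,\;x_2x_4,\;x_3x_4,\;f+x_4g),$$ where: - $\widetilde X\subseteq\mathbb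 P^4$ is an arithmetically Gorenstein subscheme of dimension $0$ and degree $5$ contained in the hyperplane $h=\{x_4=0\}$ and containing the point $P=[1,0,0,0,0]$, and $I_{\widetilde X|h}=I_{\widetilde X}\cap k[x_0,\dots,x_3]$; - the (minimal) graded free resolutions of $I_{\widetilde X}$ and $I_P=(x_1,x_2,x_3,x_4)$ have the form of the rows of a commutative diagram of graded $S$-modules with exact rows $$\begin{array}{ccccccccccc} 0&\to& S(-6)&\to& S(-5)\oplus S(-4)^{5}&\to& S(-3)^{5}\oplus S(-3)^{5}&\to& S(-2)^{5}\oplus S(-1)&\to& I_{\widetilde X}\to 0\\ &&\downarrow{\scriptstyle\varphi}&&\downarrow&&\downarrow&&\downarrow&&\downarrow\\ 0&\to& S(-4)&\to& S(-3)^{4}&\to& S(-2)^{6}&\to& S(-1)^{4}&\to& I_{P}\to 0 \end{array}$$ whose right-hand vertical map is the inclusion $I_{\widetilde X}\subseteq I_P$, and $\varphi$ is multiplication by the quadratic form $f\in k[x_0,\dots,x_3]$; - $g\in k[x_0,\dots,x_4]\setminus k[x_0,\dots,x_3]$ is a linear form. **Proposition.** Let $X\in\mathcal{H}ilb_6^{aG,0}(\mathbb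 P^4)$. Then $X$ can be obtained via the Italian construction if and only if $$X\notin O(A_{1,6})\cup O(A_1^{sp})\cup O(A_2^{sp}).$$ -/

import Mathlib

/-! ## Gorenstein rings -/

/-- A ring is Gorenstein if it is Noetherian and each of its localizations at a maximal ideal has
finite injective dimension as a module over itself (such a local ring is Cohen-Macaulay). -/
def IsGorensteinRing (R : Type*) [CommRing R] : Prop :=
  IsNoetherianRing R ∧
    ∀ (m : Ideal R) [m.IsMaximal], ∃ n : ℕ,
      CategoryTheory.HasInjectiveDimensionLE
        (ModuleCat.of (Localization.AtPrime m) (Localization.AtPrime m)) n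

/-! ## Closed subschemes of projective space

The homogeneous coordinate ring of `ℙⁿ` is `k[x₀, …, xₙ] = MvPolynomial (Fin (n + 1)) k`, and a
closed subscheme of `ℙⁿ` is represented by its saturated homogeneous ideal. Over an algebraically
closed field these are the closed points of the Hilbert schemes. -/

/-- `I` is the (saturated) homogeneous ideal of a closed subscheme of `ℙⁿ`. -/
def IsProjectiveSubscheme {k : Type*} [Field k] {n : ℕ}
    (I : Ideal (MvPolynomial (Fin (n + 1)) k)) : Prop :=
  (∀ F ∈ I, ∀ t : ℕ, MvPolynomial.homogeneousComponent t F ∈ I) ∧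
    ∀ F, (∀ i, MvPolynomial.X i * F ∈ I) → F ∈ I

/-- The Hilbert function `t ↦ dim_k (S / I)_t` of `S / I`, where `S = k[x₀, …, xₙ]`. -/
noncomputable def hilbertFunction {k : Type*} [Field k] {n : ℕ}
    (I : Ideal (MvPolynomial (Fin (n + 1)) k)) (t : ℕ) : ℕ :=
  Module.finrank k
    (MvPolynomial.homogeneousSubmodule (Fin (n + 1)) k t ⧸
      (I.restrictScalars k).comap (MvPolynomial.homogeneousSubmodule (Fin (n + 1)) k t).subtype)

/-- The closed subschemes of `ℙⁿ` of dimension `0` and degree `d`, i.e. those with constant Hilbert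
polynomial `d`, which are arithmetically Gorenstein, i.e. such that `S / I` is a Gorenstein ring. -/
def hilbAG (k : Type*) [Field k] (n d : ℕ) : Set (Ideal (MvPolynomial (Fin (n + 1)) k)) :=
  {I | IsProjectiveSubscheme I ∧ (∀ᶠ t in Filter.atTop, hilbertFunction I t = d) ∧
    IsGorensteinRing (MvPolynomial (Fin (n + 1)) k ⧸ I)}

/-- The members of `hilbAG k n d` that span a linear subspace of codimension `r` in `ℙⁿ`. -/
def hilbAGCodim (k : Type*) [Field k] (n d r : ℕ) :
    Set (Ideal (MvPolynomial (Fin (n + 1)) k)) :=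
  {I | I ∈ hilbAG k n d ∧
    Module.finrank k
      ↥(MvPolynomial.homogeneousSubmodule (Fin (n + 1)) k 1 ⊓ I.restrictScalars k) = r}

/-- The linear change of coordinates `xᵢ ↦ ∑ⱼ Mᵢⱼ xⱼ` on `k[x₀, …, xₙ]`. -/
noncomputable def linSubst {k : Type*} [Field k] {n : ℕ} (M : GL (Fin (n + 1)) k) :
    MvPolynomial (Fin (n + 1)) k →ₐ[k] MvPolynomial (Fin (n + 1)) k :=
  MvPolynomial.aeval fun i =>
    ∑ j, MvPolynomial.C ((M : Matrix (Fin (n + 1)) (Fin (n + 1)) k) i j) * MvPolynomial.X j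

/-- Two closed subschemes of `ℙⁿ` are projectively equivalent: some element of `GL_{n+1}(k)`
(equivalently, of `PGL_{n+1}(k)`) carries one to the other. -/
def ProjectivelyEquivalent {k : Type*} [Field k] {n : ℕ}
    (I J : Ideal (MvPolynomial (Fin (n + 1)) k)) : Prop :=
  ∃ M : GL (Fin (n + 1)) k, J = I.comap (linSubst M)

/-- The zero-dimensional closed subscheme `X` of `ℙⁿ` with saturated ideal `I` is abstractly
isomorphic to `Spec A`: for some linear form `ℓ` which vanishes at no point of `X` (i.e. is a
nonzerodivisor modulo `I`), so that `X` lies in the affine chart `ℓ ≠ 0`, the coordinate ring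
`S / (I + (ℓ - 1))` of `X` in this chart is isomorphic to `A` as a `k`-algebra. -/
def IsAbstractlySpec {k : Type*} [Field k] {n : ℕ} (I : Ideal (MvPolynomial (Fin (n + 1)) k))
    (A : Type*) [CommRing A] [Algebra k A] : Prop :=
  ∃ l : MvPolynomial (Fin (n + 1)) k, l.IsHomogeneous 1 ∧ (∀ F, l * F ∈ I → F ∈ I) ∧
    Nonempty ((MvPolynomial (Fin (n + 1)) k ⧸ (I ⊔ Ideal.span {l - 1})) ≃ₐ[k] A)

/-- `O(A)`: the union of the `PGL`-orbits of the nondegenerate arithmetically Gorenstein embeddings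
`Spec A ⊆ ℙ⁴` as subschemes of degree `6`. -/
def orbitO (k : Type*) [Field k] (A : Type*) [CommRing A] [Algebra k A] :
    Set (Ideal (MvPolynomial (Fin 5) k)) :=
  {J | ∃ I ∈ hilbAGCodim k 4 6 0, IsAbstractlySpec I A ∧ ProjectivelyEquivalent I J}

/-! ## The three algebras -/

/-- `A_{1,6} = k[x] / (x⁶)`. -/
abbrev A16 (k : Type*) [Field k] : Type _ :=
  Polynomial k ⧸ Ideal.span {(Polynomial.X : Polynomial k) ^ 6}

/-- `A₁ˢᵖ = k[x₁, x₂] / (x₂², x₁³)`. -/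
abbrev A1sp (k : Type*) [Field k] : Type _ :=
  MvPolynomial (Fin 2) k ⧸
    Ideal.span {(MvPolynomial.X 1 : MvPolynomial (Fin 2) k) ^ 2,
      (MvPolynomial.X 0 : MvPolynomial (Fin 2) k) ^ 3}

/-- `A₂ˢᵖ = k[x₁, x₂] / (x₂² - x₁², x₁³)`. -/
abbrev A2sp (k : Type*) [Field k] : Type _ :=
  MvPolynomial (Fin 2) k ⧸
    Ideal.span {(MvPolynomial.X 1 : MvPolynomial (Fin 2) k) ^ 2 -
        (MvPolynomial.X 0 : MvPolynomial (Fin 2) k) ^ 2,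
      (MvPolynomial.X 0 : MvPolynomial (Fin 2) k) ^ 3}

/-! ## Graded free resolutions over `S = k[x₀, …, x₄]` -/

/-- `M` is the matrix of a homogeneous map of degree `0` of graded free modules
`⨁ⱼ S(-bⱼ) → ⨁ᵢ S(-aᵢ)`, acting on column vectors: the entry `Mᵢⱼ` is a form of degree
`bⱼ - aᵢ`, and is zero if this is negative. -/
def IsGradedMatrix {k : Type*} [Field k] {p q : ℕ} (a : Fin p → ℕ) (b : Fin q → ℕ)
    (M : Matrix (Fin p) (Fin q) (MvPolynomial (Fin 5) k)) : Prop :=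
  ∀ i j, (M i j).IsHomogeneous (b j - a i) ∧ (b j < a i → M i j = 0)

/-- A graded free resolution `0 → F₄ → F₃ → F₂ → F₁ → I → 0` with `Fᵢ = ⨁ⱼ S(-bᵢⱼ)`; the map
`d₁ : F₁ → S` has image `I`. -/
structure GradedResolution {k : Type*} [Field k] (I : Ideal (MvPolynomial (Fin 5) k))
    (b₁ b₂ b₃ b₄ : List ℕ) where
  d₁ : Matrix (Fin 1) (Fin b₁.length) (MvPolynomial (Fin 5) k)
  d₂ : Matrix (Fin b₁.length) (Fin b₂.length) (MvPolynomial (Fin 5) k)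
  d₃ : Matrix (Fin b₂.length) (Fin b₃.length) (MvPolynomial (Fin 5) k)
  d₄ : Matrix (Fin b₃.length) (Fin b₄.length) (MvPolynomial (Fin 5) k)
  graded₁ : IsGradedMatrix (fun _ => 0) b₁.get d₁
  graded₂ : IsGradedMatrix b₁.get b₂.get d₂
  graded₃ : IsGradedMatrix b₂.get b₃.get d₃
  graded₄ : IsGradedMatrix b₃.get b₄.get d₄
  span_d₁ : Ideal.span (Set.range (d₁ 0)) = I
  exact₁ : Function.Exact d₂.mulVecLin d₁.mulVecLin
  exact₂ : Function.Exact d₃.mulVecLin d₂.mulVecLin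
  exact₃ : Function.Exact d₄.mulVecLin d₃.mulVecLin
  injective₄ : Function.Injective d₄.mulVecLin

/-- The form `f` represents the last vertical map `φ : S(-6) → S(-4)` of a commutative diagram
with exact rows (the rows are then minimal free resolutions)
`0 → S(-6) → S(-4)⁵ ⊕ S(-5) → S(-3)⁵ ⊕ S(-3)⁵ → S(-2)⁵ ⊕ S(-1) → Ĩ → 0` and
`0 → S(-4) → S(-3)⁴ → S(-2)⁶ → S(-1)⁴ → I_P → 0`,
whose vertical map `Ĩ → I_P` is the inclusion. -/
def IsLastComparison {k : Type*} [Field k] (Itilde IP : Ideal (MvPolynomial (Fin 5) k))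
    (f : MvPolynomial (Fin 5) k) : Prop :=
  ∃ (F : GradedResolution Itilde [2, 2, 2, 2, 2, 1] [3, 3, 3, 3, 3, 3, 3, 3, 3, 3]
      [4, 4, 4, 4, 4, 5] [6])
    (K : GradedResolution IP [1, 1, 1, 1] [2, 2, 2, 2, 2, 2] [3, 3, 3, 3] [4])
    (α₁ : Matrix (Fin 4) (Fin 6) (MvPolynomial (Fin 5) k))
    (α₂ : Matrix (Fin 6) (Fin 10) (MvPolynomial (Fin 5) k))
    (α₃ : Matrix (Fin 4) (Fin 6) (MvPolynomial (Fin 5) k))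
    (α₄ : Matrix (Fin 1) (Fin 1) (MvPolynomial (Fin 5) k)),
    IsGradedMatrix [1, 1, 1, 1].get [2, 2, 2, 2, 2, 1].get α₁ ∧
    IsGradedMatrix [2, 2, 2, 2, 2, 2].get [3, 3, 3, 3, 3, 3, 3, 3, 3, 3].get α₂ ∧
    IsGradedMatrix [3, 3, 3, 3].get [4, 4, 4, 4, 4, 5].get α₃ ∧
    IsGradedMatrix [4].get [6].get α₄ ∧
    K.d₁ * α₁ = F.d₁ ∧ K.d₂ * α₂ = α₁ * F.d₂ ∧ K.d₃ * α₃ = α₂ * F.d₃ ∧ K.d₄ * α₄ = α₃ * F.d₄ ∧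
    α₄ 0 0 = f

/-! ## The Italian construction -/

/-- The inclusion `k[x₀, …, x₃] ⊆ k[x₀, …, x₄]`. -/
noncomputable def inclHyperplane (k : Type*) [Field k] :
    MvPolynomial (Fin 4) k →ₐ[k] MvPolynomial (Fin 5) k :=
  MvPolynomial.rename Fin.castSucc

/-- The homogeneous ideal `(x₁, x₂, x₃, x₄)` of the point `P = [1, 0, 0, 0, 0]`. -/
noncomputable def idealP (k : Type*) [Field k] : Ideal (MvPolynomial (Fin 5) k) :=
  Ideal.span {MvPolynomial.X 1, MvPolynomial.X 2, MvPolynomial.X 3, MvPolynomial.X 4}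

/-- The ideal `I_{X̃|h} + (x₁x₄, x₂x₄, x₃x₄, f + x₄ g)` of `k[x₀, …, x₄]`, where
`I_{X̃|h} = Ĩ ∩ k[x₀, …, x₃]` is the ideal of `X̃` in the hyperplane `h = {x₄ = 0}`. -/
noncomputable def italianIdeal {k : Type*} [Field k] (Itilde : Ideal (MvPolynomial (Fin 5) k))
    (f : MvPolynomial (Fin 4) k) (g : MvPolynomial (Fin 5) k) : Ideal (MvPolynomial (Fin 5) k) :=
  (Itilde.comap (inclHyperplane k)).map (inclHyperplane k) ⊔
    Ideal.span {MvPolynomial.X 1 * MvPolynomial.X 4, MvPolynomial.X 2 * MvPolynomial.X 4,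
      MvPolynomial.X 3 * MvPolynomial.X 4, inclHyperplane k f + MvPolynomial.X 4 * g}

/-- The subscheme of `ℙ⁴` with homogeneous ideal `I` can be obtained via the Italian construction:
in suitable homogeneous coordinates its ideal is
`I_{X̃|h} + (x₁x₄, x₂x₄, x₃x₄, f + x₄ g)`, where `X̃` is an arithmetically Gorenstein subscheme of
degree `5` of `ℙ⁴` contained in the hyperplane `h = {x₄ = 0}` and containing the point
`P = [1, 0, 0, 0, 0]`, the quadratic form `f ∈ k[x₀, …, x₃]` represents the last map between the
minimal free resolutions of the ideals of `X̃` and `P`, and `g` is a linear form in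
`k[x₀, …, x₄]` but not in `k[x₀, …, x₃]`. -/
def IsItalian {k : Type*} [Field k] (I : Ideal (MvPolynomial (Fin 5) k)) : Prop :=
  ∃ (Itilde : Ideal (MvPolynomial (Fin 5) k)) (f : MvPolynomial (Fin 4) k)
    (g : MvPolynomial (Fin 5) k),
    Itilde ∈ hilbAG k 4 5 ∧ MvPolynomial.X 4 ∈ Itilde ∧ Itilde ≤ idealP k ∧
    IsLastComparison Itilde (idealP k) (inclHyperplane k f) ∧
    g.IsHomogeneous 1 ∧ g ∉ (inclHyperplane k).range ∧
    ProjectivelyEquivalent (italianIdeal Itilde f g) I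

/-! In a chart containing it, X amounts to a six-dimensional algebra A together with the span V of
its five coordinate functions `a`, a hyperplane of A containing 1; the ideal is recovered as
`vanishingForms a`. Since the cone over X is Gorenstein, a functional φ with kernel V is
nondegenerate: φ(xA) = 0 forces x = 0 (`exists_nondegenerate_functional`). This comes from the fact
that a local ring of finite injective dimension has at most a one-dimensional socle modulo a regular
element with finite-length quotient (`socle_proportional`).

What decides the question is an element y of A with y² not in ky and yA = ⟨y, y²⟩
(`HasBranchElement`). In an Italian ideal the coordinate y = x₄ kills x₁, x₂, x₃, and the relation f
+ x₄g = 0 multiplied by y is a cubic equation for y. If A is one of the three exceptional algebras,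
all of them local, this forces y³ = 0 and y² ≠ 0, so that y kills the square of the maximal ideal.
But in these algebras every element killed by that square has square zero (`false_of_italianIdeal`).

Conversely, let y be a branch element. Multiplying φ by a suitable unit gives a nondegenerate ψ with
ψ(1) = ψ(y) = 0 and ψ(y²) ≠ 0. On the three-dimensional space of elements killed by y and by ψ, the
form ψ(uv) is nondegenerate, so there is an orthonormal basis n₀, n₁, n₂. Its multiplication table
says that the point (1, n₀, n₁, n₂) satisfies five quadrics which, at x₀ = 0, are the quadrics
apolar to a sum of three squares. These define the degree 5 scheme X̃. The skew 5×5 syzygy matrix of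
the apolar quadrics deforms with them, which yields the resolution, the comparison with the Koszul
complex and the quadric f = -x₃² + x₀g₀. Adjoining y as the coordinate x₄ recovers X
(`isItalian_of_element`).

It remains to find the nondegenerate algebras of dimension 6 without a branch element
(`hasBranchElement_or_nonempty_algEquiv`). A nontrivial idempotent has a factor of dimension at most
3, which produces a branch element; so A is local, with maximal ideal m. Any y with y m² = 0 and y²
≠ 0 is a branch element, so otherwise the annihilator W of m² has W² = 0. By duality W ⊆ m² and dim
W + dim m² ≥ 6, whence dim m² ≥ 3. If dim m² ≥ 4, one element generates A, giving k[x]/(x⁶). If dim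
m² = 3, the Hilbert function is (1, 2, 2, 1), and the quadratic relation modulo the socle has either
a double factor or two distinct factors; these cases are `A1sp` and `A2sp`. -/

section

open CategoryTheory Abelian

universe u

/-! ### Socles modulo a regular element, by vanishing of Ext. -/

section Socle

variable {L : Type u} [CommRing L]

/-- The short exact sequence of modules attached to an injection and its surjective cokernel. -/
lemma shortExact_of_linear {M₁ M₂ M₃ : Type u} [AddCommGroup M₁] [Module L M₁] [AddCommGroup M₂]
    [Module L M₂] [AddCommGroup M₃] [Module L M₃] (f : M₁ →ₗ[L] M₂) (g : M₂ →ₗ[L] M₃)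
    (hf : Function.Injective f) (hg : Function.Surjective g) (h : Function.Exact f g) :
    (ShortComplex.mk (ModuleCat.ofHom f) (ModuleCat.ofHom g)
      (by ext x; exact h.apply_apply_eq_zero x)).ShortExact := by
  refine @ShortComplex.ShortExact.mk _ _ _ _ ?_ ((ModuleCat.mono_iff_injective _).2 hf)
    ((ModuleCat.epi_iff_surjective _).2 hg)
  rw [ShortComplex.moduleCat_exact_iff]
  intro x hx
  exact (h x).1 hx

/-- Modules of finite length over a local ring, as finite modules killed by a power of the maximal
ideal, whose `Ext` into the ring vanishes in degree `n`. -/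
def ExtVanishes (L : Type u) [CommRing L] [IsLocalRing L] (n : ℕ) : Prop :=
  ∀ (M : Type u) [AddCommGroup M] [Module L M] [Module.Finite L M],
    (∃ N : ℕ, ∀ m ∈ IsLocalRing.maximalIdeal L ^ N, ∀ x : M, m • x = 0) →
      Subsingleton (Ext (ModuleCat.of L M) (ModuleCat.of L L) n)

variable {l : L}

lemma shortExact_mul (hl : l ∈ nonZeroDivisors L) :
    (ShortComplex.mk (ModuleCat.ofHom (LinearMap.mulLeft L l))
      (ModuleCat.ofHom (Ideal.span {l}).mkQ)
      (by ext; simp)).ShortExact := by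
  apply shortExact_of_linear
  · intro x y hxy
    have : l * (x - y) = 0 := by
      have : l * x = l * y := hxy
      rw [mul_sub, this, sub_self]
    exact sub_eq_zero.1 ((mem_nonZeroDivisors_iff.1 hl).1 _ this)
  · exact Submodule.mkQ_surjective _
  · intro x
    rw [Submodule.mkQ_apply, Submodule.Quotient.mk_eq_zero, Ideal.mem_span_singleton]
    constructor
    · rintro ⟨y, rfl⟩; exact ⟨y, rfl⟩
    · rintro ⟨y, rfl⟩; exact ⟨y, rfl⟩

/-- Multiplication by l is a free resolution of length one of L/l, so Ext of L/l vanishes from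
degree 2 on. -/
lemma ext_quotient_subsingleton (hl : l ∈ nonZeroDivisors L) (n : ℕ) :
    Subsingleton (Ext (ModuleCat.of L (L ⧸ Ideal.span {l})) (ModuleCat.of L L) (n + 2)) := by
  refine subsingleton_of_forall_eq 0 fun e => ?_
  have h1 : ∀ x : Ext (ModuleCat.of L L) (ModuleCat.of L L) (n + 2), x = 0 :=
    fun x => x.eq_zero_of_projective
  obtain ⟨x, hx⟩ := Ext.contravariant_sequence_exact₃ (shortExact_mul hl) (ModuleCat.of L L) e
    (h1 _) (show 1 + (n + 1) = n + 2 by omega)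
  have h2 : ∀ x : Ext (ModuleCat.of L L) (ModuleCat.of L L) (n + 1), x = 0 :=
    fun x => x.eq_zero_of_projective
  rw [← hx]
  erw [h2 x]
  rw [Ext.comp_zero]

/-- Every nonzero class in the socle modulo `l` generates a copy of the residue field. -/
lemma socle_ker_eq [IsLocalRing L] {w : L}
    (hw : ∀ m ∈ IsLocalRing.maximalIdeal L, m * w ∈ Ideal.span {l}) (hw0 : w ∉ Ideal.span {l}) :
    LinearMap.ker (LinearMap.toSpanSingleton L (L ⧸ Ideal.span {l}) (Ideal.Quotient.mk _ w)) =
      IsLocalRing.maximalIdeal L := by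
  have key : ∀ x : L, x • (Ideal.Quotient.mk (Ideal.span {l}) w) = 0 ↔ x * w ∈ Ideal.span {l} := by
    intro x
    rw [← Ideal.Quotient.eq_zero_iff_mem, map_mul]; rfl
  ext x
  rw [LinearMap.mem_ker, LinearMap.toSpanSingleton_apply, key]
  refine ⟨fun h => ?_, hw x⟩
  by_contra hx
  rw [IsLocalRing.mem_maximalIdeal, mem_nonunits_iff, not_not] at hx
  exact hw0 ((Ideal.unit_mul_mem_iff_mem _ hx).1 h)

variable [IsLocalRing L] [IsNoetherianRing L]

/-- By dévissage only the residue field K matters. A socle element embeds K in L/l, and Ext^n(K, L)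
is squeezed between Ext^n(L/l, L) = 0 and Ext^(n+1) of the cokernel, which is again of finite
length. -/
lemma extVanishes_descend (hl : l ∈ nonZeroDivisors L) {N : ℕ}
    (hN : IsLocalRing.maximalIdeal L ^ N ≤ Ideal.span {l}) {w : L}
    (hw : ∀ m ∈ IsLocalRing.maximalIdeal L, m * w ∈ Ideal.span {l}) (hw0 : w ∉ Ideal.span {l})
    {n : ℕ} (hn : 2 ≤ n) (h : ExtVanishes L (n + 1)) : ExtVanishes L n := by
  intro M _ _ hM
  induction hM using IsNoetherianRing.induction_on_isQuotientEquivQuotientPrime L with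
  | subsingleton M =>
    rintro -
    refine subsingleton_of_forall_eq 0 fun e => ?_
    have hz : Limits.IsZero (ModuleCat.of L M) := ModuleCat.isZero_of_subsingleton _
    rw [← e.mk₀_id_comp, hz.eq_zero_of_src (𝟙 _), Ext.mk₀_zero, Ext.zero_comp]
  | quotient M p e₀ =>
    rintro ⟨N', hN'⟩
    -- A prime containing a power of the maximal ideal is the maximal ideal, so the cyclic pieces of
    -- the filtration are residue fields.
    have hp : p.1 = IsLocalRing.maximalIdeal L := by
      refine le_antisymm (IsLocalRing.le_maximalIdeal p.2.ne_top) ?_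
      refine p.2.le_of_pow_le (n := N') ?_
      intro m hm
      have := hN' m hm (e₀.symm (Ideal.Quotient.mk _ 1))
      rw [← map_smul, LinearEquiv.map_eq_zero_iff] at this
      rw [← Ideal.Quotient.eq_zero_iff_mem, ← this]
      simp [Algebra.smul_def]
    -- the embedding of the residue field in the quotient by `l`
    let g := LinearMap.toSpanSingleton L (L ⧸ Ideal.span {l}) (Ideal.Quotient.mk _ w)
    have hg : LinearMap.ker g = p.1 := by rw [hp]; exact socle_ker_eq hw hw0
    let i : M →ₗ[L] (L ⧸ Ideal.span {l}) := (p.1.liftQ g hg.ge) ∘ₗ e₀.toLinearMap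
    have hi : Function.Injective i := by
      have h1 : Function.Injective (p.1.liftQ g hg.ge) := by
        rw [← LinearMap.ker_eq_bot]
        exact Submodule.ker_liftQ_eq_bot _ _ _ hg.le
      exact h1.comp e₀.injective
    have hS := shortExact_of_linear i (LinearMap.range i).mkQ hi (Submodule.mkQ_surjective _)
      (LinearMap.exact_map_mkQ_range i)
    obtain ⟨n, rfl⟩ := Nat.exists_eq_add_of_le' hn
    have := ext_quotient_subsingleton hl n
    have hC : Subsingleton (Ext (ModuleCat.of L ((L ⧸ Ideal.span {l}) ⧸ LinearMap.range i))
        (ModuleCat.of L L) (n + 2 + 1)) := by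
      refine h _ ⟨N, fun m hm x => ?_⟩
      obtain ⟨x, rfl⟩ := Submodule.mkQ_surjective _ x
      obtain ⟨x, rfl⟩ := Ideal.Quotient.mk_surjective x
      have : m • Ideal.Quotient.mk (Ideal.span {l}) x = 0 := by
        have h1 : m • Ideal.Quotient.mk (Ideal.span {l}) x = Ideal.Quotient.mk _ (m * x) := rfl
        rw [h1, Ideal.Quotient.eq_zero_iff_mem]
        exact Ideal.mul_mem_right _ _ (hN hm)
      rw [← map_smul, this, map_zero]
    refine subsingleton_of_forall_eq 0 fun e => ?_
    obtain ⟨x, rfl⟩ := Ext.contravariant_sequence_exact₁ hS (ModuleCat.of L L) e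
      (show 1 + (n + 2) = n + 2 + 1 by omega) (hC.elim _ _)
    rw [this.elim x 0, Ext.comp_zero]
  | exact M₁ M₂ M₃ f g hf hg hfg h₁ h₃ =>
    rintro ⟨N', hN'⟩
    have h₁ := h₁ ⟨N', fun m hm x => hf (by rw [map_smul, hN' m hm, map_zero])⟩
    have h₃ := h₃ ⟨N', fun m hm x => by
      obtain ⟨x, rfl⟩ := hg x
      rw [← map_smul, hN' m hm, map_zero]⟩
    refine subsingleton_of_forall_eq 0 fun e => ?_
    obtain ⟨x, rfl⟩ := Ext.contravariant_sequence_exact₂ (shortExact_of_linear f g hf hg hfg)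
      (ModuleCat.of L L) e (h₁.elim _ _)
    rw [h₃.elim x 0, Ext.comp_zero]

/-- If a Noetherian local ring `L` has finite injective dimension and `l` is a nonzerodivisor such
that `L / l` has finite length, then the socle of `L / l` is at most one-dimensional. -/
theorem socle_proportional (n : ℕ) [HasInjectiveDimensionLE (ModuleCat.of L L) n]
    (hl : l ∈ nonZeroDivisors L) {N : ℕ}
    (hN : IsLocalRing.maximalIdeal L ^ N ≤ Ideal.span {l}) {z w : L}
    (hz : ∀ m ∈ IsLocalRing.maximalIdeal L, m * z ∈ Ideal.span {l})
    (hw : ∀ m ∈ IsLocalRing.maximalIdeal L, m * w ∈ Ideal.span {l})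
    (hw0 : w ∉ Ideal.span {l}) : ∃ c, z - c * w ∈ Ideal.span {l} := by
  have h2 : ExtVanishes L 2 := by
    -- Descending induction starts in degree n + 2, above the injective dimension, and stops at 2,
    -- the last degree where Ext of L/l is known to vanish.
    have key : ∀ j i, 2 ≤ i → n + 2 = i + j → ExtVanishes L i := by
      intro j
      induction j with
      | zero =>
        intro i hi hij M _ _ _ _
        exact HasInjectiveDimensionLT.subsingleton _ (n + 1) _ (by omega) _
      | succ j ih =>
        intro i hi hij
        exact extVanishes_descend hl hN hw hw0 hi (ih (i + 1) (by omega) (by omega))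
    exact key n 2 le_rfl (by omega)
  let K := L ⧸ IsLocalRing.maximalIdeal L
  let Λ := L ⧸ Ideal.span {l}
  let gw := LinearMap.toSpanSingleton L Λ (Ideal.Quotient.mk _ w)
  let gz := LinearMap.toSpanSingleton L Λ (Ideal.Quotient.mk _ z)
  have hgw : LinearMap.ker gw = IsLocalRing.maximalIdeal L := socle_ker_eq hw hw0
  have hgz : IsLocalRing.maximalIdeal L ≤ LinearMap.ker gz := fun m hm => by
    have : gz m = Ideal.Quotient.mk _ (m * z) := rfl
    rw [LinearMap.mem_ker, this, Ideal.Quotient.eq_zero_iff_mem]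
    exact hz m hm
  let i : K →ₗ[L] Λ := (IsLocalRing.maximalIdeal L).liftQ gw hgw.ge
  let j : K →ₗ[L] Λ := (IsLocalRing.maximalIdeal L).liftQ gz hgz
  have hi : Function.Injective i := by
    rw [← LinearMap.ker_eq_bot]
    exact Submodule.ker_liftQ_eq_bot _ _ _ hgw.le
  have hS := shortExact_of_linear i (LinearMap.range i).mkQ hi (Submodule.mkQ_surjective _)
      (LinearMap.exact_map_mkQ_range i)
  have hT := shortExact_mul hl
  have hC : Subsingleton (Ext (ModuleCat.of L (Λ ⧸ LinearMap.range i)) (ModuleCat.of L L) 2) := by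
    refine h2 _ ⟨N, fun m hm x => ?_⟩
    obtain ⟨x, rfl⟩ := Submodule.mkQ_surjective _ x
    obtain ⟨x, rfl⟩ := Ideal.Quotient.mk_surjective x
    have : m • Ideal.Quotient.mk (Ideal.span {l}) x = 0 := by
      have h1 : m • Ideal.Quotient.mk (Ideal.span {l}) x = Ideal.Quotient.mk _ (m * x) := rfl
      rw [h1, Ideal.Quotient.eq_zero_iff_mem]
      exact Ideal.mul_mem_right _ _ (hN hm)
    rw [← map_smul, this, map_zero]
  -- Here i and j embed or map K into Λ = L/l through w and z. Since Ext²(Λ/K, L) = 0, the pullback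
  -- along j of the extension class of L → L → Λ extends along i to a class η on Λ.
  let h : Ext (ModuleCat.of L K) (ModuleCat.of L Λ) 0 := Ext.mk₀ (ModuleCat.ofHom j)
  obtain ⟨η, hη⟩ := Ext.contravariant_sequence_exact₁ hS (ModuleCat.of L L)
    (h.comp hT.extClass (zero_add 1)) (show 1 + 1 = 2 by omega) (hC.elim _ _)
  obtain ⟨ρ, hρ⟩ := Ext.contravariant_sequence_exact₃ hT (ModuleCat.of L L) η
    (Ext.eq_zero_of_projective _) (show 1 + 0 = 1 by omega)
  obtain ⟨r, rfl⟩ := Ext.homEquiv₀.symm.surjective ρ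
  -- Multiplication by l kills η, because η is the extension class followed by an endomorphism of L,
  -- which commutes with l. Hence η comes from an endomorphism g of Λ.
  have hηl : η.comp (Ext.mk₀ (ModuleCat.ofHom (LinearMap.mulLeft L l))) (add_zero 1) = 0 := by
    rw [← hρ]
    have hc : r ≫ ModuleCat.ofHom (LinearMap.mulLeft L l) =
        ModuleCat.ofHom (LinearMap.mulLeft L l) ≫ r := by
      ext
      change l * (r.hom 1) = r.hom (l * 1)
      rw [← smul_eq_mul, ← smul_eq_mul, map_smul]
    have := hT.extClass_comp
    rw [Ext.homEquiv₀_symm_apply, Ext.comp_assoc_of_third_deg_zero, Ext.mk₀_comp_mk₀, hc,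
      ← Ext.mk₀_comp_mk₀, ← Ext.comp_assoc_of_third_deg_zero]
    erw [this]
    rw [Ext.zero_comp]
  obtain ⟨g, hg⟩ := Ext.covariant_sequence_exact₁ _ hT η hηl (zero_add 1)
  obtain ⟨g, rfl⟩ := Ext.homEquiv₀.symm.surjective g
  -- The map i followed by g, minus j, has trivial extension class, so it lifts to a map q from K to
  -- L.
  have h0 : ((Ext.mk₀ (ModuleCat.ofHom i ≫ g - ModuleCat.ofHom j)).comp hT.extClass
      (zero_add 1)) = 0 := by
    rw [show Ext.mk₀ (ModuleCat.ofHom i ≫ g - ModuleCat.ofHom j) =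
      Ext.mk₀ (ModuleCat.ofHom i ≫ g) - Ext.mk₀ (ModuleCat.ofHom j) from
      map_sub Ext.addEquiv₀.symm _ _, sub_eq_add_neg, Ext.add_comp, Ext.neg_comp, ← Ext.mk₀_comp_mk₀, Ext.comp_assoc_of_second_deg_zero]
    rw [Ext.homEquiv₀_symm_apply] at hg
    erw [hg, hη]
    exact add_neg_cancel _
  obtain ⟨q, hq⟩ := Ext.covariant_sequence_exact₃ _ hT _ (zero_add 1) h0
  obtain ⟨q, rfl⟩ := Ext.homEquiv₀.symm.surjective q
  rw [Ext.homEquiv₀_symm_apply, Ext.mk₀_comp_mk₀] at hq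
  have hq := Ext.mk₀_bijective _ _ |>.1 hq
  obtain ⟨c, hc⟩ := Ideal.Quotient.mk_surjective (g.hom (Ideal.Quotient.mk _ 1))
  have hlm : l ∈ IsLocalRing.maximalIdeal L := by
    rw [IsLocalRing.mem_maximalIdeal, mem_nonunits_iff]
    intro hu
    exact hw0 (by rw [Ideal.span_singleton_eq_top.2 hu]; trivial)
  -- A map from K to L is zero: l kills K but is regular on L. Thus g ∘ i = j, and evaluating at 1
  -- gives z = c w with c a representative of g(1).
  have hq0 : q.hom (Ideal.Quotient.mk (IsLocalRing.maximalIdeal L) 1 : K) = 0 := by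
    refine (mem_nonZeroDivisors_iff.1 hl).1 _ ?_
    rw [← smul_eq_mul]
    erw [← map_smul]
    have : l • (Ideal.Quotient.mk (IsLocalRing.maximalIdeal L) 1 : K) = 0 := by
      have h1 : l • (Ideal.Quotient.mk (IsLocalRing.maximalIdeal L) 1 : K) =
        Ideal.Quotient.mk _ (l * 1) := rfl
      rw [h1, Ideal.Quotient.eq_zero_iff_mem, mul_one]
      exact hlm
    erw [this]
    exact map_zero _
  have hE := congrArg (fun f => f.hom (Ideal.Quotient.mk (IsLocalRing.maximalIdeal L) 1 : K)) hq
  refine ⟨c, ?_⟩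
  have hi1 : i (Ideal.Quotient.mk (IsLocalRing.maximalIdeal L) 1 : K) = Ideal.Quotient.mk _ w := by
    have : gw 1 = Ideal.Quotient.mk _ w := one_smul L _
    rw [← this]; rfl
  have hj1 : j (Ideal.Quotient.mk (IsLocalRing.maximalIdeal L) 1 : K) = Ideal.Quotient.mk _ z := by
    have : gz 1 = Ideal.Quotient.mk _ z := one_smul L _
    rw [← this]; rfl
  have hgi : g.hom (Ideal.Quotient.mk (Ideal.span {l}) w : Λ) = Ideal.Quotient.mk _ (c * w) := by
    have h1 : (Ideal.Quotient.mk (Ideal.span {l}) w : Λ) = w • (Ideal.Quotient.mk _ 1 : Λ) := by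
      have : w • (Ideal.Quotient.mk (Ideal.span {l}) 1 : Λ) = Ideal.Quotient.mk _ (w * 1) := rfl
      rw [this, mul_one]
    rw [h1]
    erw [map_smul]
    erw [← hc]
    rw [mul_comm c w]; rfl
  have hE' : (Ideal.span {l}).mkQ (q.hom (Ideal.Quotient.mk (IsLocalRing.maximalIdeal L) 1 : K)) =
    g.hom (i (Ideal.Quotient.mk (IsLocalRing.maximalIdeal L) 1 : K)) -
      j (Ideal.Quotient.mk (IsLocalRing.maximalIdeal L) 1 : K) := hE
  rw [hq0, map_zero, hi1, hj1] at hE'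
  erw [hgi] at hE'
  rw [← Ideal.Quotient.eq_zero_iff_mem, map_sub, sub_eq_zero]
  exact (sub_eq_zero.1 hE'.symm).symm

end Socle

end

section

open CategoryTheory TensorProduct

universe u

/-! ### A Gorenstein criterion from dual bases over a principal ideal domain. -/

section Duality

/-- Divisible modules over a principal ideal domain are injective. -/
lemma baer_of_divisible {P M : Type*} [CommRing P] [IsDomain P] [IsPrincipalIdealRing P]
    [AddCommGroup M] [Module P M] (h : ∀ a : P, a ≠ 0 → ∀ m : M, ∃ m', a • m' = m) :
    Module.Baer P M := by
  intro I g
  obtain ⟨a, rfl⟩ := (IsPrincipalIdealRing.principal I).principal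
  rcases eq_or_ne a 0 with rfl | ha
  · refine ⟨0, fun x hx => ?_⟩
    have : (⟨x, hx⟩ : Submodule.span P {(0 : P)}) = 0 := by
      ext; simpa using hx
    rw [this, map_zero]; rfl
  · obtain ⟨m, hm⟩ := h a ha (g ⟨a, Submodule.mem_span_singleton_self a⟩)
    refine ⟨LinearMap.toSpanSingleton P M m, fun x hx => ?_⟩
    obtain ⟨c, rfl⟩ := Submodule.mem_span_singleton.1 hx
    have : (⟨c • a, hx⟩ : Submodule.span P {a}) = c • ⟨a, Submodule.mem_span_singleton_self a⟩ :=
      rfl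
    rw [this, map_smul g, ← hm, LinearMap.toSpanSingleton_apply, smul_assoc]

variable {P R : Type u} [CommRing P] [CommRing R] [Algebra P R]
  {ι : Type*} [Fintype ι]

/-- If an algebra `R` over `P` has a functional `Φ` with finite dual bases, then `R ⊗ Q` is an
injective `R`-module for every injective `P`-module `Q`. -/
lemma injective_tensor_of_dual_bases (Φ : R →ₗ[P] P) (e e' : ι → R)
    (h : ∀ r, ∑ i, Φ (r * e' i) • e i = r) (Q : Type u) [AddCommGroup Q] [Module P Q]
    [Module.Injective P Q] : Module.Injective R (R ⊗[P] Q) := by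
  -- The tensor product is identified with Hom_P(R, Q) by sending x to r ↦ T(r x); `huniq` recovers
  -- x from this map. An R-linear extension problem thereby becomes a P-linear one into Q.
  let T : R ⊗[P] Q →ₗ[P] Q := (TensorProduct.lid P Q).toLinearMap ∘ₗ Φ.rTensor Q
  have hT : ∀ r q, T (r ⊗ₜ q) = Φ r • q := fun r q => by simp [T]
  have huniq : ∀ x : R ⊗[P] Q, ∑ i, e i ⊗ₜ[P] T (e' i • x) = x := by
    intro x
    induction x with
    | zero => simp
    | add x y hx hy =>
      simp only [smul_add, map_add, TensorProduct.tmul_add, Finset.sum_add_distrib, hx, hy]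
    | tmul r q =>
      simp only [TensorProduct.smul_tmul', hT, smul_eq_mul]
      conv_rhs => rw [← h r, TensorProduct.sum_tmul]
      refine Finset.sum_congr rfl fun i _ => ?_
      rw [TensorProduct.tmul_smul, TensorProduct.smul_tmul', mul_comm]
  have huniq' : ∀ x y : R ⊗[P] Q, (∀ r : R, T (r • x) = T (r • y)) → x = y := by
    intro x y hxy
    rw [← huniq x, ← huniq y]
    simp only [hxy]
  refine Module.Baer.injective ?_
  intro I g
  let I' : Submodule P R := I.restrictScalars P
  let g' : I' →ₗ[P] Q := T ∘ₗ (g.restrictScalars P)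
  obtain ⟨u, hu⟩ := Module.Injective.extension_property P Q I' R I'.subtype
    I'.injective_subtype g'
  -- The tensor that corresponds to the P-linear extension u.
  let x₀ : R ⊗[P] Q := ∑ i, e' i ⊗ₜ u (e i)
  have hx₀ : ∀ r : R, T (r • x₀) = u r := by
    intro r
    simp only [x₀, Finset.smul_sum, map_sum, TensorProduct.smul_tmul', hT, smul_eq_mul,
      ← map_smul]
    rw [← map_sum, h]
  refine ⟨LinearMap.toSpanSingleton R _ x₀, fun x hx => huniq' _ _ fun r => ?_⟩
  rw [LinearMap.toSpanSingleton_apply, smul_smul, hx₀]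
  have h1 := LinearMap.congr_fun hu ⟨r * x, I.mul_mem_left r hx⟩
  have h2 : u (r * x) = T (g ⟨r * x, I.mul_mem_left r hx⟩) := h1
  rw [h2]
  have h3 : (⟨r * x, I.mul_mem_left r hx⟩ : I) = r • ⟨x, hx⟩ := rfl
  rw [h3, map_smul]

/-- A finite algebra over a principal ideal domain with a functional admitting dual bases
is Gorenstein. -/
theorem isGorensteinRing_of_dual_bases [IsDomain P] [IsPrincipalIdealRing P] [IsNoetherianRing R]
    (Φ : R →ₗ[P] P) (e e' : ι → R) (h : ∀ r, ∑ i, Φ (r * e' i) • e i = r) :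
    IsGorensteinRing R := by
  refine ⟨inferInstance, fun m _ => ⟨1, ?_⟩⟩
  -- The dual bases exhibit R as a direct summand of a finite free P-module.
  have hflat : Module.Flat P R := by
    have : Module.Projective P R := by
      let s : R →ₗ[P] (ι → P) := LinearMap.pi fun i =>
        Φ ∘ₗ ((LinearMap.mulRight P (e' i)))
      let t : (ι → P) →ₗ[P] R := Fintype.linearCombination P e
      refine Module.Projective.of_split s t ?_
      ext r
      simpa [s, t, Fintype.linearCombination_apply] using h r
    infer_instance
  -- The injective resolution 0 → P → K → K/P, tensored with the flat algebra R, bounds the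
  -- injective dimension of R by 1.
  let K := FractionRing P
  let N : Submodule P K := LinearMap.range (Algebra.linearMap P K)
  have hK : ∀ a : P, a ≠ 0 → ∀ m : K, ∃ m', a • m' = m := fun a ha m => by
    have ha' : algebraMap P K a ≠ 0 := by
      simpa using ha
    exact ⟨(algebraMap P K a)⁻¹ * m, by
      rw [Algebra.smul_def, ← mul_assoc, mul_inv_cancel₀ ha', one_mul]⟩
  have : Module.Injective P K := (baer_of_divisible hK).injective
  have : Module.Injective P (K ⧸ N) := by
    refine (baer_of_divisible fun a ha m => ?_).injective
    obtain ⟨m, rfl⟩ := Submodule.mkQ_surjective _ m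
    obtain ⟨m', hm'⟩ := hK a ha m
    exact ⟨N.mkQ m', by rw [← map_smul, hm']⟩
  have h0 := injective_tensor_of_dual_bases Φ e e' h K
  have h1 := injective_tensor_of_dual_bases Φ e e' h (K ⧸ N)
  have hinj : Function.Injective (Algebra.linearMap P K) := IsFractionRing.injective P K
  let f : R ⊗[P] P →ₗ[R] R ⊗[P] K := AlgebraTensorModule.lTensor R R (Algebra.linearMap P K)
  let g : R ⊗[P] K →ₗ[R] R ⊗[P] (K ⧸ N) := AlgebraTensorModule.lTensor R R N.mkQ
  have hf : Function.Injective f := Module.Flat.lTensor_preserves_injective_linearMap _ hinj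
  have hg : Function.Surjective g := LinearMap.lTensor_surjective _ (Submodule.mkQ_surjective _)
  have hfg : Function.Exact f g := lTensor_exact R
    (LinearMap.exact_map_mkQ_range (Algebra.linearMap P K)) (Submodule.mkQ_surjective _)
  have hS := shortExact_of_linear f g hf hg hfg
  have hR : HasInjectiveDimensionLE (ModuleCat.of R (R ⊗[P] P)) 1 := by
    have i0 : Injective (ModuleCat.of R (R ⊗[P] K)) :=
      (Module.injective_iff_injective_object R _).1 h0
    have i1 : Injective (ModuleCat.of R (R ⊗[P] (K ⧸ N))) :=
      (Module.injective_iff_injective_object R _).1 h1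
    exact hS.hasInjectiveDimensionLT_X₁ 1
      (inferInstanceAs (HasInjectiveDimensionLT (ModuleCat.of R (R ⊗[P] (K ⧸ N))) 1))
      (inferInstanceAs (HasInjectiveDimensionLT (ModuleCat.of R (R ⊗[P] K)) (1 + 1)))
  have hR' : HasInjectiveDimensionLE (ModuleCat.of R R) 1 :=
    (ModuleCat.hasInjectiveDimensionLE_iff_of_linearEquiv (M := ModuleCat.of R (R ⊗[P] P))
      (N := ModuleCat.of R R) (AlgebraTensorModule.rid P R R) 1).1 hR
  have hL := (ModuleCat.of R R).localizedModule_hasInjectiveDimensionLE 1 m.primeCompl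
  refine (ModuleCat.hasInjectiveDimensionLE_iff_of_linearEquiv
      (M := (ModuleCat.of R R).localizedModule m.primeCompl)
      (N := ModuleCat.of (Localization.AtPrime m) (Localization.AtPrime m)) ?_ 1).1 hL
  exact Shrink.linearEquiv (Localization.AtPrime m) (LocalizedModule m.primeCompl R) |>.trans
    (IsLocalizedModule.mapEquiv m.primeCompl (LocalizedModule.mkLinearMap m.primeCompl R)
      (Algebra.linearMap R (Localization.AtPrime m)) (Localization.AtPrime m)
      (LinearEquiv.refl R R))

end Duality

end

section

open MvPolynomial

/-! ### Homogeneous components of products with a form. -/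

section HomogeneousComponents

variable {σ k : Type*} [CommRing k]

lemma homogeneousComponent_mul_of_isHomogeneous {m : ℕ} {l : MvPolynomial σ k}
    (hl : l.IsHomogeneous m) (H : MvPolynomial σ k) (t : ℕ) :
    homogeneousComponent (m + t) (l * H) = l * homogeneousComponent t H := by
  conv_lhs => rw [← sum_homogeneousComponent H, Finset.mul_sum, map_sum]
  have h : ∀ i, homogeneousComponent (m + t) (l * homogeneousComponent i H) =
      if t = i then l * homogeneousComponent i H else 0 := by
    intro i
    rw [homogeneousComponent_of_mem (hl.mul (homogeneousComponent_isHomogeneous i H))]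
    simp
  simp only [h, Finset.sum_ite_eq, Finset.mem_range]
  split_ifs with h1
  · rfl
  · rw [homogeneousComponent_eq_zero _ _ (by omega), mul_zero]

lemma homogeneousComponent_mul_of_lt {m : ℕ} {l : MvPolynomial σ k}
    (hl : l.IsHomogeneous m) (H : MvPolynomial σ k) {t : ℕ} (ht : t < m) :
    homogeneousComponent t (l * H) = 0 := by
  rw [← sum_homogeneousComponent H, Finset.mul_sum, map_sum]
  refine Finset.sum_eq_zero fun i _ => ?_
  rw [homogeneousComponent_of_mem (hl.mul (homogeneousComponent_isHomogeneous i H)), if_neg]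
  omega

end HomogeneousComponents

/-! ### Homogeneous ideals of algebra-valued points. -/

section HomogeneousVanishing

variable {k : Type*} [Field k] {n : ℕ} {A : Type*} [CommRing A] [Algebra k A]

/-- Evaluation at the multiple `X • a` of a point `a`. -/
noncomputable def coneEval (a : Fin (n + 1) → A) :
    MvPolynomial (Fin (n + 1)) k →ₐ[k] Polynomial A :=
  aeval fun i => Polynomial.C (a i) * Polynomial.X

/-- The ideal generated by the forms vanishing at an `A`-valued point `a`. -/
noncomputable def vanishingForms (a : Fin (n + 1) → A) : Ideal (MvPolynomial (Fin (n + 1)) k) :=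
  RingHom.ker (coneEval (k := k) a)

variable (a : Fin (n + 1) → A)

lemma coneEval_of_isHomogeneous {F : MvPolynomial (Fin (n + 1)) k} {t : ℕ}
    (hF : F.IsHomogeneous t) :
    coneEval a F = Polynomial.C (aeval a F) * Polynomial.X ^ t := by
  rw [coneEval, aeval_def, aeval_def, eval₂_eq', eval₂_eq', map_sum, Finset.sum_mul]
  refine Finset.sum_congr rfl fun d hd => ?_
  have hd' : ∑ i, d i = t := by
    have := hF (mem_support_iff.1 hd)
    rw [← this, Finsupp.weight_apply, Finsupp.sum_fintype _ _ (by simp)]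
    simp
  rw [map_mul, map_prod]
  simp only [mul_pow, Finset.prod_mul_distrib, Finset.prod_pow_eq_pow_sum, hd', map_pow]
  rw [mul_assoc]; rfl

lemma coeff_coneEval (F : MvPolynomial (Fin (n + 1)) k) (t : ℕ) :
    (coneEval a F).coeff t = aeval a (homogeneousComponent t F) := by
  conv_lhs => rw [← sum_homogeneousComponent F, map_sum, Polynomial.finsetSum_coeff]
  simp only [coneEval_of_isHomogeneous a (homogeneousComponent_isHomogeneous _ F),
    Polynomial.coeff_C_mul, Polynomial.coeff_X_pow]
  simp only [mul_ite, mul_one, mul_zero, Finset.sum_ite_eq, Finset.mem_range]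
  split_ifs with h
  · rfl
  · rw [homogeneousComponent_eq_zero _ _ (by omega), map_zero]

lemma mem_vanishingForms {F : MvPolynomial (Fin (n + 1)) k} :
    F ∈ vanishingForms a ↔ ∀ t, aeval a (homogeneousComponent t F) = 0 := by
  rw [vanishingForms, RingHom.mem_ker, Polynomial.ext_iff]
  simp [coeff_coneEval]

lemma mem_vanishingForms_of_isHomogeneous {F : MvPolynomial (Fin (n + 1)) k} {t : ℕ}
    (hF : F.IsHomogeneous t) : F ∈ vanishingForms a ↔ aeval a F = 0 := by
  rw [vanishingForms, RingHom.mem_ker, coneEval_of_isHomogeneous a hF]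
  constructor
  · intro h
    have := congrArg (fun p => Polynomial.coeff p t) h
    rwa [Polynomial.coeff_C_mul, Polynomial.coeff_X_pow, if_pos rfl, mul_one,
      Polynomial.coeff_zero] at this
  · intro h
    rw [h, map_zero, zero_mul]

/-- A homogeneous ideal is determined by the forms it contains. -/
lemma le_of_forms {I J : Ideal (MvPolynomial (Fin (n + 1)) k)}
    (hI : ∀ F ∈ I, ∀ t : ℕ, homogeneousComponent t F ∈ I)
    (h : ∀ t F, F.IsHomogeneous t → F ∈ I → F ∈ J) : I ≤ J := by
  intro F hF
  rw [← sum_homogeneousComponent F]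
  exact J.sum_mem fun t _ => h t _ (homogeneousComponent_isHomogeneous t F) (hI F hF t)

lemma vanishingForms_component {F : MvPolynomial (Fin (n + 1)) k} (hF : F ∈ vanishingForms a)
    (t : ℕ) : homogeneousComponent t F ∈ vanishingForms a := by
  rw [mem_vanishingForms_of_isHomogeneous a (homogeneousComponent_isHomogeneous t F)]
  exact (mem_vanishingForms a).1 hF t

lemma map_homogeneousSubmodule (t : ℕ) :
    (homogeneousSubmodule (Fin (n + 1)) k t).map (aeval a).toLinearMap =
      (Submodule.span k (Set.range a)) ^ t := by
  rw [← homogeneousSubmodule_one_pow, Submodule.map_pow, homogeneousSubmodule_one_eq_span_X,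
    Submodule.map_span, ← Set.range_comp]
  congr 3
  ext i
  simp

lemma mem_span_pow_iff {x : A} {t : ℕ} : x ∈ (Submodule.span k (Set.range a)) ^ t ↔
    ∃ F : MvPolynomial (Fin (n + 1)) k, F.IsHomogeneous t ∧ aeval a F = x := by
  rw [← map_homogeneousSubmodule]
  rfl

lemma mem_span_iff {x : A} : x ∈ Submodule.span k (Set.range a) ↔
    ∃ F : MvPolynomial (Fin (n + 1)) k, F.IsHomogeneous 1 ∧ aeval a F = x := by
  rw [← mem_span_pow_iff, pow_one]

lemma span_pow_mono (h1 : (1 : A) ∈ Submodule.span k (Set.range a)) :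
    Monotone fun t : ℕ => (Submodule.span k (Set.range a)) ^ t := by
  refine monotone_nat_of_le_succ fun t x hx => ?_
  rw [pow_succ, ← mul_one x]
  exact Submodule.mul_mem_mul hx h1

/-- A linear form of value 1 goes to the variable of the polynomial ring A[X] under `coneEval`, and
this variable is a nonzerodivisor; so the ideal is saturated. -/
lemma isProjectiveSubscheme_vanishingForms (h1 : (1 : A) ∈ Submodule.span k (Set.range a)) :
    IsProjectiveSubscheme (vanishingForms (k := k) a) := by
  refine ⟨fun F hF t => vanishingForms_component a hF t, fun F hF => ?_⟩
  obtain ⟨l, hl, hl1⟩ := (mem_span_iff a).1 h1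
  have hlF : l * F ∈ vanishingForms a := by
    have hl' : l ∈ Ideal.span (Set.range (X : Fin (n + 1) → MvPolynomial (Fin (n + 1)) k)) := by
      rw [← mem_homogeneousSubmodule, homogeneousSubmodule_one_eq_span_X] at hl
      exact Submodule.span_le_restrictScalars k _ _ hl
    refine Submodule.span_induction (p := fun x _ => x * F ∈ vanishingForms a) ?_ ?_ ?_ ?_ hl'
    · rintro _ ⟨i, rfl⟩; exact hF i
    · simp
    · intro x y _ _ hx hy; rw [add_mul]; exact add_mem hx hy
    · intro c x _ hx; rw [smul_eq_mul, mul_assoc]; exact Ideal.mul_mem_left _ _ hx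
  rw [vanishingForms, RingHom.mem_ker] at hlF ⊢
  rw [map_mul, coneEval_of_isHomogeneous a hl, hl1, map_one, one_mul, pow_one] at hlF
  ext t
  have := congrArg (fun p => Polynomial.coeff p (t + 1)) hlF
  simpa using this

lemma hilbertFunction_eq {I : Ideal (MvPolynomial (Fin (n + 1)) k)} (hI : I = vanishingForms a)
    (t : ℕ) : hilbertFunction I t =
      Module.finrank k ↥((Submodule.span k (Set.range a)) ^ t : Submodule k A) := by
  subst hI
  let g : homogeneousSubmodule (Fin (n + 1)) k t →ₗ[k] A :=
    (aeval a).toLinearMap ∘ₗ (homogeneousSubmodule (Fin (n + 1)) k t).subtype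
  have hker : ((vanishingForms a).restrictScalars k).comap
      (homogeneousSubmodule (Fin (n + 1)) k t).subtype = LinearMap.ker g := by
    ext ⟨F, hF⟩
    exact mem_vanishingForms_of_isHomogeneous a hF
  have hrange : LinearMap.range g = (Submodule.span k (Set.range a)) ^ t := by
    rw [LinearMap.range_comp, Submodule.range_subtype, map_homogeneousSubmodule]
  rw [hilbertFunction, hker, ← hrange]
  exact g.quotKerEquivRange.finrank_eq

/-- The coordinate ring of a zero-dimensional scheme spans, by powers of the linear forms. -/
lemma exists_span_pow_eq_top [Module.Finite k A] (h1 : (1 : A) ∈ Submodule.span k (Set.range a))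
    (hgen : Function.Surjective (aeval a : MvPolynomial (Fin (n + 1)) k →ₐ[k] A)) :
    ∃ t, (Submodule.span k (Set.range a)) ^ t = ⊤ := by
  have hex : ∀ x : A, ∃ t, x ∈ (Submodule.span k (Set.range a)) ^ t := by
    intro x
    obtain ⟨F, rfl⟩ := hgen x
    refine ⟨F.totalDegree, ?_⟩
    have hF := congrArg (aeval a) (sum_homogeneousComponent F)
    rw [map_sum] at hF
    rw [← hF]
    refine Submodule.sum_mem _ fun i hi => ?_
    exact span_pow_mono a h1 (Nat.lt_succ_iff.1 (Finset.mem_range.1 hi))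
      ((mem_span_pow_iff a).2 ⟨_, homogeneousComponent_isHomogeneous i F, rfl⟩)
  obtain ⟨N, hN⟩ := monotone_stabilizes_iff_noetherian.2 (inferInstanceAs (IsNoetherian k A))
    ⟨_, span_pow_mono (k := k) a h1⟩
  refine ⟨N, ?_⟩
  rw [eq_top_iff]
  rintro x -
  obtain ⟨t, ht⟩ := hex x
  rcases le_total N t with h | h
  · have := hN t h
    simp only [OrderHom.coe_mk] at this
    rw [this]; exact ht
  · exact span_pow_mono a h1 h ht

/-- The powers of V = ⟨a⟩ increase because 1 ∈ V, their dimensions are the values of the Hilbert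
function, and their union is A. Once the dimension is constant the power is all of A. -/
lemma finite_of_hilbertFunction {I : Ideal (MvPolynomial (Fin (n + 1)) k)}
    (hI : I = vanishingForms a) (h1 : (1 : A) ∈ Submodule.span k (Set.range a))
    (hgen : Function.Surjective (aeval a : MvPolynomial (Fin (n + 1)) k →ₐ[k] A)) {d : ℕ}
    (hd : ∀ᶠ t in Filter.atTop, hilbertFunction I t = d) :
    Module.Finite k A ∧ Module.finrank k A = d := by
  obtain ⟨N, hN⟩ := Filter.eventually_atTop.1 hd
  have hfg : ∀ t, ((Submodule.span k (Set.range a)) ^ t).FG := fun t =>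
    (Submodule.fg_span (Set.finite_range a)).pow t
  have hstab : ∀ t, N ≤ t →
      (Submodule.span k (Set.range a)) ^ N = (Submodule.span k (Set.range a)) ^ t := by
    intro t ht
    have := Module.Finite.iff_fg.2 (hfg t)
    refine Submodule.eq_of_le_of_finrank_eq (span_pow_mono a h1 ht) ?_
    rw [← hilbertFunction_eq a hI, ← hilbertFunction_eq a hI, hN N le_rfl, hN t ht]
  have htop : (Submodule.span k (Set.range a)) ^ N = ⊤ := by
    rw [eq_top_iff]
    rintro x -
    obtain ⟨F, rfl⟩ := hgen x
    rw [← sum_homogeneousComponent F, map_sum]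
    refine Submodule.sum_mem _ fun i hi => ?_
    have hx : aeval a (homogeneousComponent i F) ∈ (Submodule.span k (Set.range a)) ^ i :=
      (mem_span_pow_iff a).2 ⟨_, homogeneousComponent_isHomogeneous i F, rfl⟩
    rw [hstab (max N i) (le_max_left _ _)]
    exact span_pow_mono a h1 (le_max_right _ _) hx
  have hfin : Module.Finite k A := ⟨htop ▸ hfg N⟩
  refine ⟨hfin, ?_⟩
  rw [← hN N le_rfl, hilbertFunction_eq a hI, htop, finrank_top]

lemma hilbertFunction_eventually {I : Ideal (MvPolynomial (Fin (n + 1)) k)}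
    (hI : I = vanishingForms a) {W : Submodule k A}
    {t₀ : ℕ} (hW : ∀ t, t₀ ≤ t → (Submodule.span k (Set.range a)) ^ t = W) :
    ∀ᶠ t in Filter.atTop, hilbertFunction I t = Module.finrank k W := by
  filter_upwards [Filter.eventually_ge_atTop t₀] with t ht
  rw [hilbertFunction_eq a hI, hW t ht]

end HomogeneousVanishing

/-! ### Passing between a projective scheme and an affine chart. -/

section AffineChart

variable {k : Type*} [Field k] {n : ℕ} {I : Ideal (MvPolynomial (Fin (n + 1)) k)}

/-- The forms of `I` are the forms vanishing in the affine chart `l = 1`. -/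
lemma mem_of_mem_sup_span_sub_one (hI : ∀ F ∈ I, ∀ t : ℕ, homogeneousComponent t F ∈ I)
    {l : MvPolynomial (Fin (n + 1)) k} (hl : l.IsHomogeneous 1) (hreg : ∀ F, l * F ∈ I → F ∈ I)
    {F : MvPolynomial (Fin (n + 1)) k} {t : ℕ} (hF : F.IsHomogeneous t)
    (hF' : F ∈ I ⊔ Ideal.span {l - 1}) : F ∈ I := by
  obtain ⟨G, hG, K, hK, rfl⟩ := Submodule.mem_sup.1 hF'
  obtain ⟨H, rfl⟩ := Ideal.mem_span_singleton'.1 hK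
  -- With F = G + H(l - 1), degree j + 1 reads F_(j+1) ≡ l H_j - H_(j+1) modulo I.
  have hc : ∀ j, homogeneousComponent (j + 1) (G + H * (l - 1)) - (l * homogeneousComponent j H -
      homogeneousComponent (j + 1) H) ∈ I := by
    intro j
    have : G + H * (l - 1) = G + (l * H - H) := by ring
    rw [this, map_add, map_sub, add_comm j 1, homogeneousComponent_mul_of_isHomogeneous hl,
      add_sub_cancel_right]
    exact hI _ hG _
  have hc0 : homogeneousComponent 0 (G + H * (l - 1)) + homogeneousComponent 0 H ∈ I := by
    have : G + H * (l - 1) = G + (l * H - H) := by ring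
    rw [this, map_add, map_sub, homogeneousComponent_mul_of_lt hl _ zero_lt_one, zero_sub,
      neg_add_cancel_right]
    exact hI _ hG _
  have hne : ∀ j, j ≠ t → homogeneousComponent j (G + H * (l - 1)) = 0 := fun j hj => by
    rw [homogeneousComponent_of_mem hF, if_neg hj]
  -- Below degree t the left side is zero, so the components of H lie in I by ascending induction.
  have hlt : ∀ j, j < t → homogeneousComponent j H ∈ I := by
    intro j
    induction j with
    | zero => intro h; rw [hne 0 h.ne, zero_add] at hc0; exact hc0
    | succ j ih =>
      intro h
      have h2 := hc j
      rw [hne _ h.ne, zero_sub, neg_sub] at h2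
      exact (Submodule.sub_mem_iff_left _ (I.mul_mem_left l (ih (by omega)))).1 h2
  -- Above degree t one descends from degrees where H vanishes, cancelling the regular form l each
  -- time.
  have hHt : homogeneousComponent t H ∈ I := by
    have hup : ∀ m, homogeneousComponent (t + m) H ∈ I → homogeneousComponent t H ∈ I := by
      intro m
      induction m with
      | zero => exact id
      | succ m ih =>
        intro h
        apply ih
        have h2 := hc (t + m)
        rw [hne _ (by omega), zero_sub, neg_sub] at h2
        exact hreg _ ((Submodule.sub_mem_iff_right _ h).1 h2)
    refine hup (H.totalDegree + 1) ?_
    rw [homogeneousComponent_eq_zero _ _ (by omega)]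
    exact I.zero_mem
  have hFt : homogeneousComponent t (G + H * (l - 1)) = G + H * (l - 1) :=
    homogeneousComponent_eq_self hF
  rw [← hFt]
  cases t with
  | zero => exact (Submodule.add_mem_iff_left _ hHt).1 hc0
  | succ t =>
    have h2 := hc t
    have h3 : l * homogeneousComponent t H - homogeneousComponent (t + 1) H ∈ I :=
      I.sub_mem (I.mul_mem_left l (hlt t (by omega))) hHt
    exact (Submodule.sub_mem_iff_left _ h3).1 h2

variable {A : Type*} [CommRing A] [Algebra k A]

/-- A projective scheme lying in the chart `l ≠ 0` is defined by the forms vanishing at the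
tautological point of its coordinate ring `A`. -/
lemma exists_point_of_chart (hI : ∀ F ∈ I, ∀ t : ℕ, homogeneousComponent t F ∈ I)
    {l : MvPolynomial (Fin (n + 1)) k} (hl : l.IsHomogeneous 1) (hreg : ∀ F, l * F ∈ I → F ∈ I)
    (e : (MvPolynomial (Fin (n + 1)) k ⧸ (I ⊔ Ideal.span {l - 1})) ≃ₐ[k] A) :
    ∃ a : Fin (n + 1) → A, I = vanishingForms a ∧ aeval a l = 1 ∧
      Function.Surjective (aeval a : MvPolynomial (Fin (n + 1)) k →ₐ[k] A) := by
  let q : MvPolynomial (Fin (n + 1)) k →ₐ[k] A :=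
    e.toAlgHom.comp (Ideal.Quotient.mkₐ k (I ⊔ Ideal.span {l - 1}))
  have hq : (aeval fun i => q (X i)) = q := by
    ext i; simp
  have hq0 : ∀ F, q F = 0 ↔ F ∈ I ⊔ Ideal.span {l - 1} := by
    intro F
    rw [← Ideal.Quotient.eq_zero_iff_mem]
    exact e.map_eq_zero_iff
  refine ⟨fun i => q (X i), ?_, ?_, ?_⟩
  · apply le_antisymm
    · refine le_of_forms hI fun t F hF hFI => ?_
      rw [mem_vanishingForms_of_isHomogeneous _ hF, hq, hq0]
      exact Ideal.mem_sup_left hFI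
    · refine le_of_forms (fun F hF t => vanishingForms_component _ hF t) fun t F hF hFI => ?_
      rw [mem_vanishingForms_of_isHomogeneous _ hF, hq, hq0] at hFI
      exact mem_of_mem_sup_span_sub_one hI hl hreg hF hFI
  · rw [hq, ← sub_eq_zero, ← map_one q, ← map_sub, hq0]
    exact Ideal.mem_sup_right (Ideal.mem_span_singleton_self _)
  · rw [hq]
    exact e.surjective.comp (Ideal.Quotient.mkₐ_surjective k _)

end AffineChart

/-! ### A linear form avoiding the scheme. -/

section Regular

variable {k : Type*} [Field k] [Infinite k] {n : ℕ}

/-- A closed subscheme of projective space is disjoint from the support of a general hyperplane,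
as far as its associated points are concerned. -/
lemma exists_linear_regular {I : Ideal (MvPolynomial (Fin (n + 1)) k)}
    (hI : IsProjectiveSubscheme I) :
    ∃ l : MvPolynomial (Fin (n + 1)) k, l.IsHomogeneous 1 ∧ ∀ F, l * F ∈ I → F ∈ I := by
  classical
  let S := MvPolynomial (Fin (n + 1)) k
  let f : Ideal S → Submodule k (homogeneousSubmodule (Fin (n + 1)) k 1) := fun p =>
    (p.restrictScalars k).comap (homogeneousSubmodule (Fin (n + 1)) k 1).subtype
  have hfin := associatedPrimes.finite S (S ⧸ I)
  -- An associated prime containing all the variables would be the annihilator of some F with X_i F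
  -- ∈ I for all i, and saturation would put F in I.
  have htop : ⊤ ∉ hfin.toFinset.image f := by
    rw [Finset.mem_image]
    rintro ⟨p, hp, hp'⟩
    rw [Set.Finite.mem_toFinset, AssociatedPrimes.mem_iff, isAssociatedPrime_iff] at hp
    obtain ⟨hprime, x, hx⟩ := hp
    obtain ⟨F, rfl⟩ := Ideal.Quotient.mk_surjective x
    have hX : ∀ i, X i ∈ p := fun i => by
      have : (⟨X i, isHomogeneous_X k i⟩ : homogeneousSubmodule (Fin (n + 1)) k 1) ∈ f p := by
        rw [hp']; trivial
      exact this
    have hF : F ∈ I := by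
      refine hI.2 F fun i => ?_
      have := hX i
      rw [hx, Submodule.mem_colon_singleton] at this
      rw [← Ideal.Quotient.eq_zero_iff_mem]
      exact this
    apply hprime.ne_top
    rw [hx, Ideal.Quotient.eq_zero_iff_mem.2 hF]
    ext; simp
  -- Over an infinite field, finitely many proper subspaces do not cover the space of linear forms.
  have hne := Subspace.biUnion_ne_univ_of_top_notMem htop
  obtain ⟨⟨l, hl⟩, hl'⟩ := (Set.ne_univ_iff_exists_notMem _).1 hne
  refine ⟨l, hl, fun F hF => ?_⟩
  by_contra hFI
  have hmem : l ∈ ⋃ p ∈ associatedPrimes S (S ⧸ I), (p : Set S) := by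
    rw [biUnion_associatedPrimes_eq_zero_divisors]
    refine ⟨Ideal.Quotient.mk I F, ?_, ?_⟩
    · rwa [Ne, Ideal.Quotient.eq_zero_iff_mem]
    · have : l • (Ideal.Quotient.mk I F) = Ideal.Quotient.mk I (l * F) := rfl
      rw [this, Ideal.Quotient.eq_zero_iff_mem]
      exact hF
  apply hl'
  simp only [Set.mem_iUnion] at hmem ⊢
  obtain ⟨p, hp, hlp⟩ := hmem
  exact ⟨f p, Finset.mem_image_of_mem f (hfin.mem_toFinset.2 hp), hlp⟩

end Regular

end

section

open MvPolynomial

/-! ### The Gorenstein condition at the vertex of the cone. -/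

section VertexSocle

universe u

/-- Descent of `socle_proportional` from the localization at a maximal ideal. -/
lemma socle_proportional_of_localization {R : Type u} [CommRing R] [IsNoetherianRing R]
    (m : Ideal R) [hm : m.IsMaximal] (d : ℕ)
    [CategoryTheory.HasInjectiveDimensionLE
      (ModuleCat.of (Localization.AtPrime m) (Localization.AtPrime m)) d]
    {l : R} (hl : l ∈ nonZeroDivisors R) (hrad : m ≤ (Ideal.span {l}).radical) {z w : R}
    (hz : ∀ x ∈ m, x * z ∈ Ideal.span {l}) (hw : ∀ x ∈ m, x * w ∈ Ideal.span {l})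
    (hw0 : w ∉ Ideal.span {l}) : ∃ s ∉ m, ∃ r, s * z - r * w ∈ Ideal.span {l} := by
  let L := Localization.AtPrime m
  let φ := algebraMap R L
  have hspanL : Ideal.span {φ l} = (Ideal.span {l}).map φ := by
    rw [Ideal.map_span, Set.image_singleton]
  -- A class killed by m which dies in the localization is already zero: it is killed by some s
  -- outside m, and s is invertible modulo m.
  have hclear : ∀ x, (∀ y ∈ m, y * x ∈ Ideal.span {l}) → φ x ∈ Ideal.span {φ l} →
      x ∈ Ideal.span {l} := by
    intro x hmx hx
    rw [hspanL, IsLocalization.algebraMap_mem_map_algebraMap_iff m.primeCompl] at hx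
    obtain ⟨s, hs, hsx⟩ := hx
    obtain ⟨t, y, hy, h1⟩ := hm.exists_inv hs
    have : x = t * (s * x) + y * x := by linear_combination (-x) * h1
    rw [this]
    exact add_mem (Ideal.mul_mem_left _ _ hsx) (hmx y hy)
  have hmax : IsLocalRing.maximalIdeal L = m.map φ :=
    (Localization.AtPrime.map_eq_maximalIdeal).symm
  have hsoc : ∀ x, (∀ y ∈ m, y * x ∈ Ideal.span {l}) →
      ∀ y ∈ IsLocalRing.maximalIdeal L, y * φ x ∈ Ideal.span {φ l} := by
    intro x hx
    have : IsLocalRing.maximalIdeal L ≤ Submodule.comap (LinearMap.mulRight L (φ x))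
        (Ideal.span {φ l}) := by
      rw [hmax, Ideal.map_le_iff_le_comap]
      intro y hy
      have h2 := Ideal.mem_map_of_mem φ (hx y hy)
      rw [← hspanL, map_mul] at h2
      exact h2
    exact fun y hy => this hy
  have hreg : φ l ∈ nonZeroDivisors L :=
    IsLocalization.map_nonZeroDivisors_le m.primeCompl L ⟨l, hl, rfl⟩
  obtain ⟨N, hN⟩ : ∃ N, IsLocalRing.maximalIdeal L ^ N ≤ Ideal.span {φ l} := by
    obtain ⟨N, hN⟩ := Ideal.exists_pow_le_of_le_radical_of_fg hrad (IsNoetherian.noetherian m)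
    refine ⟨N, ?_⟩
    rw [hmax, ← Ideal.map_pow, hspanL]
    exact Ideal.map_mono hN
  obtain ⟨c, hc⟩ := socle_proportional d hreg hN (hsoc z hz) (hsoc w hw)
    (fun h => hw0 (hclear w hw h))
  obtain ⟨r, s, rfl⟩ := IsLocalization.exists_mk'_eq m.primeCompl c
  refine ⟨s, s.2, r, hclear _ (fun y hy => ?_) ?_⟩
  · have : y * (s * z - r * w) = s * (y * z) - r * (y * w) := by ring
    rw [this]
    exact sub_mem (Ideal.mul_mem_left _ _ (hz y hy)) (Ideal.mul_mem_left _ _ (hw y hy))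
  · have h1 := Ideal.mul_mem_left _ (φ s) hc
    have h2 : φ s * (φ z - IsLocalization.mk' L r s * φ w) = φ (s * z - r * w) := by
      rw [map_sub, map_mul, map_mul, ← IsLocalization.mk'_spec L r s]
      ring
    rwa [h2] at h1

variable {k : Type u} [Field k] {n : ℕ} {I : Ideal (MvPolynomial (Fin (n + 1)) k)}

lemma sub_C_constantCoeff_mem (F : MvPolynomial (Fin (n + 1)) k) :
    F - C (constantCoeff F) ∈ Ideal.span (Set.range (X : Fin (n + 1) → MvPolynomial _ k)) := by
  induction F using MvPolynomial.induction_on with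
  | C c => simp
  | add p q hp hq =>
    have : p + q - C (constantCoeff (p + q)) =
        (p - C (constantCoeff p)) + (q - C (constantCoeff q)) := by
      simp only [map_add]; ring
    rw [this]; exact add_mem hp hq
  | mul_X p i _ =>
    simp only [map_mul, constantCoeff_X, mul_zero, map_zero, sub_zero]
    exact Ideal.mul_mem_left _ _ (Ideal.subset_span ⟨i, rfl⟩)

lemma constantCoeff_mul_sub_mem {J : Ideal (MvPolynomial (Fin (n + 1)) k)}
    {z : MvPolynomial (Fin (n + 1)) k} (hz : ∀ i, X i * z ∈ J) (F : MvPolynomial (Fin (n + 1)) k) :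
    F * z - C (constantCoeff F) * z ∈ J := by
  rw [← sub_mul]
  refine Submodule.span_induction (p := fun x _ => x * z ∈ J) ?_ ?_ ?_ ?_
    (sub_C_constantCoeff_mem F)
  · rintro _ ⟨i, rfl⟩; exact hz i
  · simp
  · intro x y _ _ hx hy; rw [add_mul]; exact add_mem hx hy
  · intro c x _ hx; rw [smul_eq_mul, mul_assoc]; exact Ideal.mul_mem_left _ _ hx

/-- If the cone over a zero-dimensional scheme is Gorenstein, then its Artinian reduction by a
regular linear form has a one-dimensional socle. -/
lemma socle_of_isGorensteinRing (hI : ∀ F ∈ I, ∀ t : ℕ, homogeneousComponent t F ∈ I)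
    (hG : IsGorensteinRing (MvPolynomial (Fin (n + 1)) k ⧸ I))
    {l : MvPolynomial (Fin (n + 1)) k} (hreg : ∀ F, l * F ∈ I → F ∈ I)
    {N : ℕ} (hN : ∀ i, X i ^ N ∈ I ⊔ Ideal.span {l}) {z w : MvPolynomial (Fin (n + 1)) k}
    (hz : ∀ i, X i * z ∈ I ⊔ Ideal.span {l}) (hw : ∀ i, X i * w ∈ I ⊔ Ideal.span {l})
    (hw0 : w ∉ I ⊔ Ideal.span {l}) : ∃ c : k, z - C c * w ∈ I ⊔ Ideal.span {l} := by
  obtain ⟨hnoeth, hG⟩ := hG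
  let q := Ideal.Quotient.mk I
  have hIC : ∀ F ∈ I, constantCoeff F = 0 := by
    intro F hF
    by_contra h0
    apply hw0
    have h1 := hI F hF 0
    rw [homogeneousComponent_zero] at h1
    have : I = ⊤ := Ideal.eq_top_of_isUnit_mem _ h1
      ((isUnit_iff_ne_zero.2 (show coeff 0 F ≠ 0 from h0)).map C)
    rw [this]; simp
  -- The kernel of ε is the maximal ideal of the vertex of the cone, the only localization that is
  -- needed.
  let ε : (MvPolynomial (Fin (n + 1)) k ⧸ I) →+* k := Ideal.Quotient.lift I constantCoeff hIC
  have hεs : Function.Surjective ε := fun c => ⟨q (C c), by simp [ε, q]⟩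
  have hm : (RingHom.ker ε).IsMaximal := RingHom.ker_isMaximal_of_surjective ε hεs
  obtain ⟨d, hd⟩ := hG (RingHom.ker ε)
  have hmem : ∀ F, q F ∈ RingHom.ker ε ↔ constantCoeff F = 0 := fun F => Iff.rfl
  have hspan : ∀ F, q F ∈ Ideal.span {q l} ↔ F ∈ I ⊔ Ideal.span {l} := by
    intro F
    rw [← Set.image_singleton, ← Ideal.map_span, Ideal.mem_map_iff_of_surjective _
      Ideal.Quotient.mk_surjective]
    constructor
    · rintro ⟨G, hG, hGF⟩
      have : F = (F - G) + G := by ring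
      rw [this]
      refine Submodule.add_mem_sup ?_ hG
      rw [← Ideal.Quotient.eq_zero_iff_mem, map_sub, sub_eq_zero]
      exact hGF.symm
    · intro h
      obtain ⟨G, hG, K, hK, rfl⟩ := Submodule.mem_sup.1 h
      refine ⟨K, hK, ?_⟩
      simp only [q, map_add, Ideal.Quotient.eq_zero_iff_mem.2 hG, zero_add]
  have hsoc : ∀ F, (∀ i, X i * F ∈ I ⊔ Ideal.span {l}) →
      ∀ x ∈ RingHom.ker ε, x * q F ∈ Ideal.span {q l} := by
    intro F hF x hx
    obtain ⟨G, rfl⟩ := Ideal.Quotient.mk_surjective x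
    have h1 := constantCoeff_mul_sub_mem hF G
    rw [(hmem G).1 hx, map_zero, zero_mul, sub_zero, ← hspan, map_mul] at h1
    exact h1
  have hrad : RingHom.ker ε ≤ (Ideal.span {q l}).radical := by
    intro x hx
    obtain ⟨G, rfl⟩ := Ideal.Quotient.mk_surjective x
    have h1 := sub_C_constantCoeff_mem G
    rw [(hmem G).1 hx, map_zero, sub_zero] at h1
    have h2 := Ideal.mem_map_of_mem q h1
    rw [Ideal.map_span, ← Set.range_comp] at h2
    refine Ideal.span_le.2 ?_ h2
    rintro _ ⟨i, rfl⟩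
    exact ⟨N, by rw [Function.comp_apply, ← map_pow]; exact (hspan _).2 (hN i)⟩
  have hreg' : q l ∈ nonZeroDivisors (MvPolynomial (Fin (n + 1)) k ⧸ I) := by
    refine mem_nonZeroDivisors_iff_right.2 fun x hx => ?_
    obtain ⟨G, rfl⟩ := Ideal.Quotient.mk_surjective x
    rw [← map_mul, Ideal.Quotient.eq_zero_iff_mem, mul_comm] at hx
    exact Ideal.Quotient.eq_zero_iff_mem.2 (hreg _ hx)
  obtain ⟨s, hs, r, h⟩ := socle_proportional_of_localization (RingHom.ker ε) d hreg' hrad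
    (hsoc z hz) (hsoc w hw) (fun h => hw0 ((hspan w).1 h))
  obtain ⟨R, rfl⟩ := Ideal.Quotient.mk_surjective r
  obtain ⟨T, rfl⟩ := Ideal.Quotient.mk_surjective s
  have hT : constantCoeff T ≠ 0 := fun h => hs ((hmem T).2 h)
  have h3 : T * z - R * w ∈ I ⊔ Ideal.span {l} := by
    rw [← hspan, map_sub, map_mul, map_mul]; exact h
  have hT1 := constantCoeff_mul_sub_mem hz T
  have hR1 := constantCoeff_mul_sub_mem hw R
  refine ⟨(constantCoeff T)⁻¹ * constantCoeff R, ?_⟩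
  -- On socle classes every polynomial acts through its constant term, so the coefficients T and R
  -- may be replaced by scalars.
  have h4 : C (constantCoeff T) * z - C (constantCoeff R) * w ∈ I ⊔ Ideal.span {l} := by
    have : C (constantCoeff T) * z - C (constantCoeff R) * w = (T * z - R * w) -
      (T * z - C (constantCoeff T) * z) + (R * w - C (constantCoeff R) * w) := by ring
    rw [this]
    exact add_mem (sub_mem h3 hT1) hR1
  have h5 := Ideal.mul_mem_left _ (C (constantCoeff T)⁻¹) h4
  convert h5 using 1
  rw [mul_sub, ← mul_assoc, ← mul_assoc, ← C_mul, ← C_mul, inv_mul_cancel₀ hT, C_1, one_mul]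

variable {A : Type*} [CommRing A] [Algebra k A]

/-- The functional on the coordinate ring of a nondegenerate arithmetically Gorenstein scheme that
vanishes on the linear forms generates the dualizing module. -/
theorem exists_nondegenerate_functional {a : Fin (n + 1) → A} (hI : I = vanishingForms a)
    (hG : IsGorensteinRing (MvPolynomial (Fin (n + 1)) k ⧸ I))
    {l : MvPolynomial (Fin (n + 1)) k} (hl : l.IsHomogeneous 1) (hl1 : aeval a l = 1)
    (hgen : Function.Surjective (aeval a : MvPolynomial (Fin (n + 1)) k →ₐ[k] A))
    [Module.Finite k A]
    (hd : Module.finrank k (Submodule.span k (Set.range a)) + 1 = Module.finrank k A) :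
    ∃ φ : A →ₗ[k] k, LinearMap.ker φ = Submodule.span k (Set.range a) ∧
      ∀ x, (∀ y, φ (x * y) = 0) → x = 0 := by
  set V := Submodule.span k (Set.range a) with hV
  have h1 : (1 : A) ∈ V := (mem_span_iff a).2 ⟨l, hl, hl1⟩
  have hVtop : V < ⊤ := by
    rw [lt_top_iff_ne_top]
    intro h
    rw [h, finrank_top] at hd
    omega
  obtain ⟨φ, hφ0, hφV⟩ := V.exists_le_ker_of_lt_top hVtop
  have hker : LinearMap.ker φ = V := by
    refine (Submodule.eq_of_le_of_finrank_eq hφV ?_).symm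
    have h2 := LinearMap.finrank_range_add_finrank_ker φ
    have h3 : LinearMap.range φ = ⊤ := LinearMap.range_eq_top.2 (LinearMap.surjective hφ0)
    rw [h3, finrank_top, Module.finrank_self] at h2
    omega
  refine ⟨φ, hker, fun x hx => ?_⟩
  have hIh : ∀ F ∈ I, ∀ t : ℕ, homogeneousComponent t F ∈ I := by
    subst hI; exact fun F hF t => vanishingForms_component a hF t
  have hreg : ∀ F, l * F ∈ I → F ∈ I := by
    intro F hF
    subst hI
    rw [mem_vanishingForms] at hF ⊢
    intro t
    have := hF (1 + t)
    rwa [homogeneousComponent_mul_of_isHomogeneous hl, map_mul, hl1, one_mul] at this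
  -- a form of degree `t + 1` whose value is divisible by `l`
  have hdiv : ∀ (t : ℕ) (F : MvPolynomial (Fin (n + 1)) k), F.IsHomogeneous (t + 1) →
      aeval a F ∈ V ^ t → F ∈ I ⊔ Ideal.span {l} := by
    intro t F hF hFV
    obtain ⟨G, hG, hGF⟩ := (mem_span_pow_iff a).1 hFV
    have : F = (F - l * G) + l * G := by ring
    rw [this]
    refine Submodule.add_mem_sup ?_ (Ideal.mul_mem_right _ _ (Ideal.mem_span_singleton_self l))
    rw [hI, mem_vanishingForms_of_isHomogeneous a (t := t + 1)]
    · rw [map_sub, map_mul, hl1, one_mul, hGF, sub_self]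
    · have := hl.mul hG
      rw [add_comm 1 t] at this
      exact hF.sub this
  have hdiv' : ∀ (t : ℕ) (F : MvPolynomial (Fin (n + 1)) k), F.IsHomogeneous (t + 1) →
      F ∈ I ⊔ Ideal.span {l} → aeval a F ∈ V ^ t := by
    intro t F hF hFm
    obtain ⟨G, hG, K, hK, rfl⟩ := Submodule.mem_sup.1 hFm
    obtain ⟨H, rfl⟩ := Ideal.mem_span_singleton'.1 hK
    have h2 := homogeneousComponent_eq_self hF
    rw [map_add, mul_comm H l, add_comm t 1, homogeneousComponent_mul_of_isHomogeneous hl] at h2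
    rw [mul_comm H l, ← h2, map_add, map_mul, hl1, one_mul]
    have h3 := hIh G hG (1 + t)
    rw [hI, mem_vanishingForms_of_isHomogeneous a (homogeneousComponent_isHomogeneous _ _)] at h3
    rw [h3, zero_add]
    exact (mem_span_pow_iff a).2 ⟨_, homogeneousComponent_isHomogeneous _ _, rfl⟩
  -- the top power of `V`
  have hex := exists_span_pow_eq_top (k := k) a h1 hgen
  classical
  obtain ⟨t, ht, htmin⟩ : ∃ t, V ^ t = ⊤ ∧ ∀ s, s < t → V ^ s ≠ ⊤ :=
    ⟨Nat.find hex, Nat.find_spec hex, fun s hs => Nat.find_min hex hs⟩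
  have ht2 : 2 ≤ t := by
    by_contra hlt
    have : V ^ t ≤ V ^ 1 := span_pow_mono a h1 (by omega)
    rw [ht, pow_one] at this
    exact hVtop.ne (top_le_iff.1 this)
  obtain ⟨t, rfl⟩ : ∃ s, t = s + 2 := ⟨t - 2, by omega⟩
  obtain ⟨v, hv⟩ : ∃ v, v ∉ V ^ (t + 1) := by
    by_contra hall
    push Not at hall
    exact htmin (t + 1) (by omega) (eq_top_iff.2 fun v _ => hall v)
  obtain ⟨w, hw, hwv⟩ := (mem_span_pow_iff a).1 (show v ∈ V ^ (t + 2) by rw [ht]; trivial)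
  have hxV : x ∈ V := by
    rw [← hker, LinearMap.mem_ker, ← mul_one x]; exact hx 1
  obtain ⟨z, hz, hzx⟩ := (mem_span_iff a).1 hxV
  -- The linear form z of value x is a socle class modulo l because aᵢ x ∈ ker φ = V; the form w is
  -- one because V^(t+2) is already everything, and it is nonzero because its value avoids V^(t+1).
  obtain ⟨c, hc⟩ := socle_of_isGorensteinRing (z := z) (w := w) (N := t + 2 + 1) hIh hG hreg
    (fun i => hdiv (t + 2) _ (by simpa using (isHomogeneous_X k i).pow (t + 2 + 1)) (by rw [ht]; trivial))
    (fun i => hdiv 1 _ ((isHomogeneous_X k i).mul hz) (by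
      rw [pow_one, map_mul, aeval_X, hzx, ← hker, LinearMap.mem_ker, mul_comm]; exact hx _))
    (fun i => hdiv (t + 2) _ (by simpa [add_comm, add_left_comm] using (isHomogeneous_X k i).mul hw)
      (by rw [ht]; trivial))
    (fun h => hv (hwv ▸ hdiv' (t + 1) w hw h))
  -- The form w has degree t + 2 ≥ 2, so it contributes nothing to the degree one part of the
  -- relation.
  have hcomp : z ∈ I ⊔ Ideal.span {l} := by
    obtain ⟨G, hG, K, hK, hGK⟩ := Submodule.mem_sup.1 hc
    obtain ⟨H, rfl⟩ := Ideal.mem_span_singleton'.1 hK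
    have h2 := congrArg (homogeneousComponent 1) hGK
    rw [map_sub, homogeneousComponent_C_mul, homogeneousComponent_eq_self hz,
      homogeneousComponent_of_mem hw, if_neg (by omega), mul_zero, sub_zero, map_add, mul_comm H l,
      homogeneousComponent_mul_of_isHomogeneous hl H 0] at h2
    rw [← h2]
    exact Submodule.add_mem_sup (hIh G hG 1)
      (Ideal.mul_mem_right _ _ (Ideal.mem_span_singleton_self l))
  -- Hence x lies in V⁰ = k, and a scalar annihilated by a nonzero functional is zero.
  have hx0 := hdiv' 0 z hz hcomp
  rw [pow_zero, hzx, Submodule.mem_one] at hx0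
  obtain ⟨c', rfl⟩ := hx0
  have hc' : c' = 0 := by
    by_contra hne
    apply hφ0
    ext y
    have := hx y
    rw [← Algebra.smul_def, map_smul, smul_eq_mul] at this
    exact (mul_eq_zero.1 this).resolve_left hne
  rw [hc', map_zero]

end VertexSocle

end

section

open MvPolynomial

/-! ### Invariants of the three exceptional algebras. -/

section TestAlgebras

/-- A `k`-algebra in which every element is a scalar plus a nilpotent. -/
def HasNilpotentResidues (k A : Type*) [Field k] [CommRing A] [Algebra k A] : Prop :=
  ∀ x : A, ∃ c : k, IsNilpotent (x - algebraMap k A c)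

/-- The elements annihilated by the square of the nilradical have square zero. -/
def SecondSocleSqZero (A : Type*) [CommRing A] : Prop :=
  ∀ y : A, (∀ u v : A, IsNilpotent u → IsNilpotent v → y * u * v = 0) → y * y = 0

variable {k : Type*} [Field k]

lemma A16_hasNilpotentResidues : HasNilpotentResidues k (A16 k) := by
  intro x
  obtain ⟨p, rfl⟩ := Ideal.Quotient.mk_surjective x
  refine ⟨p.eval 0, 6, ?_⟩
  have h : Polynomial.X ∣ p - Polynomial.C (p.eval 0) := by
    rw [Polynomial.X_dvd_iff, Polynomial.coeff_sub, Polynomial.coeff_C_zero,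
      Polynomial.coeff_zero_eq_eval_zero, sub_self]
  change (Ideal.Quotient.mk _ p - Ideal.Quotient.mk _ (Polynomial.C (p.eval 0))) ^ 6 = 0
  rw [← map_sub, ← map_pow, Ideal.Quotient.eq_zero_iff_mem, Ideal.mem_span_singleton]
  exact pow_dvd_pow_of_dvd h 6

/-- The annihilator of X² is generated by X⁴, and X⁸ is divisible by X⁶. -/
lemma A16_secondSocleSqZero : SecondSocleSqZero (A16 k) := by
  intro y hy
  obtain ⟨p, rfl⟩ := Ideal.Quotient.mk_surjective y
  have hX : IsNilpotent (Ideal.Quotient.mk (Ideal.span {(Polynomial.X : Polynomial k) ^ 6})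
      Polynomial.X) := ⟨6, by
    rw [← map_pow, Ideal.Quotient.eq_zero_iff_mem]; exact Ideal.mem_span_singleton_self _⟩
  have h := hy _ _ hX hX
  rw [← map_mul, ← map_mul, Ideal.Quotient.eq_zero_iff_mem, Ideal.mem_span_singleton] at h
  rw [← map_mul, Ideal.Quotient.eq_zero_iff_mem, Ideal.mem_span_singleton]
  obtain ⟨r, hr⟩ := h
  have hp : p = Polynomial.X ^ 4 * r := by
    have hX2 : (Polynomial.X : Polynomial k) ^ 2 ≠ 0 := pow_ne_zero _ Polynomial.X_ne_zero
    apply mul_right_cancel₀ hX2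
    linear_combination hr
  exact ⟨Polynomial.X ^ 2 * r * r, by rw [hp]; ring⟩

variable {A : Type*} [CommRing A] [Algebra k A]

/-- Monomial normal form in an algebra generated by `x` and `y` with `x ^ 3 = 0`,
`y ^ 2 = e * x ^ 2`. -/
lemma exists_normal_form {x : Fin 2 → A}
    (hgen : Function.Surjective (aeval x : MvPolynomial (Fin 2) k →ₐ[k] A)) {e : k}
    (h3 : x 0 ^ 3 = 0) (h2 : x 1 ^ 2 = e • x 0 ^ 2) (z : A) :
    ∃ c : Fin 6 → k, z = c 0 • 1 + c 1 • x 0 + c 2 • x 1 + c 3 • x 0 ^ 2 + c 4 • (x 0 * x 1) +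
      c 5 • (x 0 ^ 2 * x 1) := by
  obtain ⟨F, rfl⟩ := hgen z
  simp only [Algebra.smul_def] at h2 ⊢
  induction F using MvPolynomial.induction_on with
  | C a => exact ⟨![a, 0, 0, 0, 0, 0], by simp⟩
  | add p q hp hq =>
    obtain ⟨c, hc⟩ := hp
    obtain ⟨d, hd⟩ := hq
    refine ⟨c + d, ?_⟩
    rw [map_add, hc, hd]
    simp only [Pi.add_apply, map_add]
    ring
  | mul_X p i hp =>
    obtain ⟨c, hc⟩ := hp
    rw [map_mul, hc, aeval_X]
    fin_cases i
    · refine ⟨![0, c 0, 0, c 1, c 2, c 4], ?_⟩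
      simp only [Matrix.cons_val, map_zero, Fin.mk_zero, Fin.isValue]
      linear_combination (algebraMap k A (c 3) + algebraMap k A (c 5) * x 1) * h3
    · refine ⟨![0, 0, c 0, e * c 2, c 1, c 3], ?_⟩
      simp only [Matrix.cons_val, map_zero, map_mul, Fin.mk_one, Fin.isValue]
      linear_combination (algebraMap k A (c 2) + algebraMap k A (c 4) * x 0 +
        algebraMap k A (c 5) * x 0 ^ 2) * h2 + (algebraMap k A e * (algebraMap k A (c 4) +
        algebraMap k A (c 5) * x 0)) * h3

lemma hasNilpotentResidues_of_generators {x : Fin 2 → A}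
    (hgen : Function.Surjective (aeval x : MvPolynomial (Fin 2) k →ₐ[k] A))
    (hx : ∀ i, IsNilpotent (x i)) : HasNilpotentResidues k A := by
  intro z
  obtain ⟨F, rfl⟩ := hgen z
  refine ⟨constantCoeff F, ?_⟩
  have h := Ideal.mem_map_of_mem (aeval x : MvPolynomial (Fin 2) k →ₐ[k] A)
    (sub_C_constantCoeff_mem F)
  rw [map_sub, aeval_C, Ideal.map_span, ← Set.range_comp] at h
  rw [← mem_nilradical]
  refine Ideal.span_le.2 ?_ h
  rintro _ ⟨i, rfl⟩
  exact mem_nilradical.2 (by simpa using hx i)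

/-- Each product used as a test isolates one coefficient in front of the nonzero top monomial: (x₀,
x₀x₁) removes the coefficient of 1, then (x₀, x₁) that of x₀ and (x₀, x₀) that of x₁. What remains
has order at least 2, and its square has order at least 4, hence vanishes. -/
lemma secondSocleSqZero_of_generators {x : Fin 2 → A}
    (hgen : Function.Surjective (aeval x : MvPolynomial (Fin 2) k →ₐ[k] A)) {e : k}
    (h3 : x 0 ^ 3 = 0) (h2 : x 1 ^ 2 = e • x 0 ^ 2) (hs : x 0 ^ 2 * x 1 ≠ 0) :
    SecondSocleSqZero A := by
  intro y hy
  obtain ⟨c, rfl⟩ := exists_normal_form hgen h3 h2 y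
  have hn0 : IsNilpotent (x 0) := ⟨3, h3⟩
  simp only [Algebra.smul_def] at *
  have hn1 : IsNilpotent (x 1) := ⟨4, by
    linear_combination (x 1 ^ 2 + algebraMap k A e * x 0 ^ 2) * h2 +
      algebraMap k A e ^ 2 * x 0 * h3⟩
  have hzero : ∀ d : k, algebraMap k A d * (x 0 ^ 2 * x 1) = 0 → d = 0 := fun d hd => by
    rw [← Algebra.smul_def] at hd
    exact (smul_eq_zero.1 hd).resolve_right hs
  have e0 : c 0 = 0 := hzero _ (by
    have := hy (x 0) (x 0 * x 1) hn0 ((Commute.all _ _).isNilpotent_mul_left hn1)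
    linear_combination this - (algebraMap k A (c 1) * x 1 + algebraMap k A (c 2) * 0 +
      algebraMap k A (c 3) * x 0 * x 1 + algebraMap k A (c 4) * x 1 ^ 2 +
      algebraMap k A (c 5) * x 0 * x 1 ^ 2) * h3 - algebraMap k A (c 2) * x 0 ^ 2 * h2
      - algebraMap k A (c 2) * algebraMap k A e * x 0 * h3)
  have e1 : c 1 = 0 := hzero _ (by
    have := hy (x 0) (x 1) hn0 hn1
    rw [e0, map_zero] at this
    linear_combination this - (algebraMap k A (c 3) * x 1 + algebraMap k A (c 5) * x 1 ^ 2) * h3 -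
      (algebraMap k A (c 2) * x 0 + algebraMap k A (c 4) * x 0 ^ 2) * h2 -
      algebraMap k A e * (algebraMap k A (c 2) + algebraMap k A (c 4) * x 0) * h3)
  have e2 : c 2 = 0 := hzero _ (by
    have := hy (x 0) (x 0) hn0 hn0
    rw [e0, e1, map_zero] at this
    linear_combination this - (algebraMap k A (c 3) * x 0 + algebraMap k A (c 4) * x 1 +
      algebraMap k A (c 5) * x 0 * x 1) * h3)
  rw [e0, e1, e2, map_zero]
  linear_combination (algebraMap k A (c 3) ^ 2 * x 0 +
    2 * algebraMap k A (c 3) * algebraMap k A (c 4) * x 1 +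
    2 * algebraMap k A (c 3) * algebraMap k A (c 5) * x 0 * x 1 +
    2 * algebraMap k A (c 4) * algebraMap k A (c 5) * x 1 ^ 2 +
    algebraMap k A (c 5) ^ 2 * x 0 * x 1 ^ 2 + algebraMap k A (c 4) ^ 2 * algebraMap k A e * x 0) *
    h3 + algebraMap k A (c 4) ^ 2 * x 0 ^ 2 * h2

/-- The classes of the variables in a quotient of `k[x₁, x₂]`. -/
lemma surjective_aeval_mk (J : Ideal (MvPolynomial (Fin 2) k)) :
    Function.Surjective (aeval (fun i => Ideal.Quotient.mk J (X i)) :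
      MvPolynomial (Fin 2) k →ₐ[k] MvPolynomial (Fin 2) k ⧸ J) := by
  have : (aeval (fun i => Ideal.Quotient.mk J (X i)) :
      MvPolynomial (Fin 2) k →ₐ[k] MvPolynomial (Fin 2) k ⧸ J) = Ideal.Quotient.mkₐ k J := by
    ext i; simp
  rw [this]
  exact Ideal.Quotient.mkₐ_surjective k J

lemma coeff_mul_X_pow_of_lt {i : Fin 2} {m : ℕ} {d : Fin 2 →₀ ℕ} (h : d i < m)
    (F : MvPolynomial (Fin 2) k) : coeff d (F * X i ^ m) = 0 := by
  rw [X_pow_eq_monomial, coeff_mul_monomial', if_neg]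
  intro hle
  have := hle i
  simp at this
  omega

lemma A1sp_top_ne_zero :
    (Ideal.Quotient.mk _ (X 0) : A1sp k) ^ 2 * (Ideal.Quotient.mk _ (X 1) : A1sp k) ≠ 0 := by
  rw [← map_pow, ← map_mul, Ne, Ideal.Quotient.eq_zero_iff_mem, Ideal.mem_span_pair]
  rintro ⟨a, b, h⟩
  have h1 := congrArg (coeff (Finsupp.single 0 2 + Finsupp.single 1 1)) h
  rw [coeff_add, coeff_mul_X_pow_of_lt (by simp), coeff_mul_X_pow_of_lt (by simp), add_zero,
    X_pow_eq_monomial, X, monomial_mul, coeff_monomial, if_pos rfl] at h1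
  simp at h1

/-- In a multiple a(x₁² - x₀²) the coefficient of x₁ in a enters x₀²x₁ and x₁³ with opposite signs,
and x₀³ contributes to neither; membership would therefore give 1 = 0. -/
lemma A2sp_top_ne_zero :
    (Ideal.Quotient.mk _ (X 0) : A2sp k) ^ 2 * (Ideal.Quotient.mk _ (X 1) : A2sp k) ≠ 0 := by
  rw [← map_pow, ← map_mul, Ne, Ideal.Quotient.eq_zero_iff_mem, Ideal.mem_span_pair]
  rintro ⟨a, b, h⟩
  have h1 := congrArg (coeff (Finsupp.single 0 2 + Finsupp.single 1 1)) h
  have h2 := congrArg (coeff (Finsupp.single 1 3)) h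
  have e1 : coeff (Finsupp.single 0 2 + Finsupp.single 1 1) (a * X 0 ^ 2) =
      coeff (Finsupp.single 1 1) a := by
    rw [X_pow_eq_monomial, add_comm, coeff_mul_monomial, mul_one]
  have e2 : coeff (Finsupp.single 1 3) (a * X 1 ^ 2) = coeff (Finsupp.single 1 1) a := by
    have : (Finsupp.single 1 3 : Fin 2 →₀ ℕ) = Finsupp.single 1 1 + Finsupp.single 1 2 := by
      rw [← Finsupp.single_add]
    rw [X_pow_eq_monomial, this, coeff_mul_monomial, mul_one]
  rw [mul_sub, coeff_add, coeff_sub, e1, coeff_mul_X_pow_of_lt (by simp),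
    coeff_mul_X_pow_of_lt (by simp), X_pow_eq_monomial, X, monomial_mul, coeff_monomial,
    if_pos rfl] at h1
  rw [mul_sub, coeff_add, coeff_sub, e2, coeff_mul_X_pow_of_lt (by simp),
    coeff_mul_X_pow_of_lt (by simp), X_pow_eq_monomial, X, monomial_mul, coeff_monomial,
    if_neg (by
      intro h
      have := DFunLike.congr_fun h 0
      simp at this)] at h2
  have : (1 : k) = 0 := by linear_combination -h1 - h2
  exact one_ne_zero this

lemma A1sp_relations : (Ideal.Quotient.mk _ (X 0) : A1sp k) ^ 3 = 0 ∧
    (Ideal.Quotient.mk _ (X 1) : A1sp k) ^ 2 =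
      (0 : k) • (Ideal.Quotient.mk _ (X 0) : A1sp k) ^ 2 := by
  rw [zero_smul, ← map_pow, ← map_pow, Ideal.Quotient.eq_zero_iff_mem,
    Ideal.Quotient.eq_zero_iff_mem]
  exact ⟨Ideal.subset_span (by simp), Ideal.subset_span (by simp)⟩

lemma A2sp_relations : (Ideal.Quotient.mk _ (X 0) : A2sp k) ^ 3 = 0 ∧
    (Ideal.Quotient.mk _ (X 1) : A2sp k) ^ 2 =
      (1 : k) • (Ideal.Quotient.mk _ (X 0) : A2sp k) ^ 2 := by
  rw [one_smul, ← sub_eq_zero (b := (Ideal.Quotient.mk _ (X 0) : A2sp k) ^ 2), ← map_pow, ← map_pow,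
    ← map_pow, ← map_sub, Ideal.Quotient.eq_zero_iff_mem, Ideal.Quotient.eq_zero_iff_mem]
  exact ⟨Ideal.subset_span (by simp), Ideal.subset_span (by simp)⟩

lemma isNilpotent_generators {x : Fin 2 → A} {e : k} (h3 : x 0 ^ 3 = 0)
    (h2 : x 1 ^ 2 = e • x 0 ^ 2) (i : Fin 2) : IsNilpotent (x i) := by
  rw [Algebra.smul_def] at h2
  fin_cases i
  · exact ⟨3, h3⟩
  · exact ⟨4, by
      simp only [Fin.mk_one]
      linear_combination (x 1 ^ 2 + algebraMap k A e * x 0 ^ 2) * h2 +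
        algebraMap k A e ^ 2 * x 0 * h3⟩

lemma A1sp_properties : HasNilpotentResidues k (A1sp k) ∧ SecondSocleSqZero (A1sp k) :=
  ⟨hasNilpotentResidues_of_generators (surjective_aeval_mk _)
    (isNilpotent_generators A1sp_relations.1 A1sp_relations.2),
    secondSocleSqZero_of_generators (surjective_aeval_mk _) A1sp_relations.1 A1sp_relations.2
      A1sp_top_ne_zero⟩

lemma A2sp_properties : HasNilpotentResidues k (A2sp k) ∧ SecondSocleSqZero (A2sp k) :=
  ⟨hasNilpotentResidues_of_generators (surjective_aeval_mk _)
    (isNilpotent_generators A2sp_relations.1 A2sp_relations.2),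
    secondSocleSqZero_of_generators (surjective_aeval_mk _) A2sp_relations.1 A2sp_relations.2
      A2sp_top_ne_zero⟩

end TestAlgebras

/-! ### Italian ideals exclude the exceptional algebras. -/

section ItalianObstruction

variable {k : Type*} [Field k] {A : Type*} [CommRing A] [Algebra k A]

/-- A product y F(u) depends only on the coordinates modulo the annihilator of y. -/
lemma mul_aeval_congr {σ : Type*} {y : A} {u v : σ → A} (h : ∀ i, y * u i = y * v i)
    (F : MvPolynomial σ k) : y * aeval u F = y * aeval v F := by
  induction F using MvPolynomial.induction_on with
  | C c => simp
  | add p q hp hq => simp only [map_add, mul_add, hp, hq]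
  | mul_X p i hp =>
    simp only [map_mul, aeval_X]
    rw [← mul_assoc, hp, mul_right_comm, h, mul_right_comm, mul_assoc]

lemma aeval_smul_of_isHomogeneous {n t : ℕ} {F : MvPolynomial (Fin (n + 1)) k}
    (hF : F.IsHomogeneous t) (c : Fin (n + 1) → A) (b : A) :
    aeval (fun i => c i * b) F = aeval c F * b ^ t := by
  have h : (aeval (fun i => c i * b) : MvPolynomial (Fin (n + 1)) k →ₐ[k] A) =
      ((Polynomial.aeval b : Polynomial A →ₐ[A] A).restrictScalars k).comp (coneEval c) := by
    ext i; simp [coneEval]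
  rw [h, AlgHom.comp_apply, coneEval_of_isHomogeneous c hF,
    AlgHom.restrictScalars_apply, map_mul, map_pow, Polynomial.aeval_X, Polynomial.aeval_C]
  rfl

lemma exists_linear_coeffs {n : ℕ} {F : MvPolynomial (Fin n) k} (hF : F.IsHomogeneous 1) :
    ∃ c : Fin n → k, F = ∑ i, C (c i) * X i := by
  have h : F ∈ Submodule.span k (Set.range (X : Fin n → MvPolynomial (Fin n) k)) := by
    rw [← homogeneousSubmodule_one_eq_span_X]; exact hF
  obtain ⟨c, hc⟩ := (Submodule.mem_span_range_iff_exists_fun k).1 h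
  exact ⟨c, by rw [← hc]; simp only [C_mul']⟩

lemma aeval_inclHyperplane (b : Fin 5 → A) (F : MvPolynomial (Fin 4) k) :
    aeval b (inclHyperplane k F) = aeval (fun i : Fin 4 => b i.castSucc) F := by
  rw [inclHyperplane, aeval_rename]; rfl

/-- The relations of the Italian construction are incompatible with a local ring whose second socle
has square zero. -/
theorem false_of_italianIdeal {b : Fin 5 → A} (hb : LinearIndependent k b)
    (hgen : Function.Surjective (aeval b : MvPolynomial (Fin 5) k →ₐ[k] A))
    (h1 : (1 : A) ∈ Submodule.span k (Set.range b)) {φ : A →ₗ[k] k}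
    (hker : LinearMap.ker φ = Submodule.span k (Set.range b))
    (hφ : ∀ x, (∀ y, φ (x * y) = 0) → x = 0) (hres : HasNilpotentResidues k A)
    (hsoc : SecondSocleSqZero A) {J : Ideal (MvPolynomial (Fin 5) k)} {f : MvPolynomial (Fin 4) k}
    {g : MvPolynomial (Fin 5) k} (hf : f.IsHomogeneous 2) (hg : g.IsHomogeneous 1)
    (hg' : g ∉ (inclHyperplane k).range) (hJ : italianIdeal J f g = vanishingForms b) : False := by
  obtain ⟨γ, rfl⟩ := exists_linear_coeffs hg
  have hle : Ideal.span {X 1 * X 4, X 2 * X 4, X 3 * X 4,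
      inclHyperplane k f + X 4 * ∑ i, C (γ i) * X i} ≤ vanishingForms (k := k) b := by
    rw [← hJ]; exact le_sup_right
  have hX : ∀ i : Fin 5, i = 1 ∨ i = 2 ∨ i = 3 → b 4 * b i = 0 := by
    intro i hi
    have hmem : X i * X 4 ∈ vanishingForms (k := k) b :=
      hle (Ideal.subset_span (by rcases hi with rfl | rfl | rfl <;> simp))
    rw [mem_vanishingForms_of_isHomogeneous b ((isHomogeneous_X k i).mul (isHomogeneous_X k 4)),
      map_mul, aeval_X, aeval_X] at hmem
    rw [mul_comm]; exact hmem
  have hX1 := hX 1 (by simp)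
  have hX2 := hX 2 (by simp)
  have hX3 := hX 3 (by simp)
  set y := b 4 with hy
  have hmem := hle (Ideal.subset_span (show inclHyperplane k f + X 4 * ∑ i, C (γ i) * X i ∈ _ by
    right; right; right; rfl))
  have hfh : (inclHyperplane k f).IsHomogeneous 2 := hf.rename_isHomogeneous
  rw [mem_vanishingForms_of_isHomogeneous b (t := 2) (hfh.add ((isHomogeneous_X k 4).mul hg)),
    map_add, map_mul, map_sum, aeval_X, aeval_inclHyperplane] at hmem
  simp only [map_mul, aeval_C, aeval_X, Fin.sum_univ_five, ← hy] at hmem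
  -- The coefficient of x₄ is exactly what keeps g out of k[x₀, …, x₃].
  have hγ4 : γ 4 ≠ 0 := by
    intro h0
    apply hg'
    refine ⟨∑ i : Fin 4, C (γ i.castSucc) * X i, ?_⟩
    simp [inclHyperplane, Fin.sum_univ_castSucc (n := 4), show (Fin.last 4) = 4 from rfl, h0]
  -- the value of `f` along `b 4`
  let δ : Fin 4 → A := ![1, 0, 0, 0]
  have hyf : ∃ c : k, y * aeval (fun i : Fin 4 => b i.castSucc) f =
      algebraMap k A c * (y * b 0 ^ 2) := by
    have h2 : ∀ i : Fin 4, y * b i.castSucc = y * (δ i * b 0) := by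
      intro i
      fin_cases i
      · simp [δ]
      · simpa [δ] using hX1
      · simpa [δ] using hX2
      · simpa [δ] using hX3
    have h3 : aeval δ f = algebraMap k A (aeval (![1, 0, 0, 0] : Fin 4 → k) f) := by
      rw [← aeval_algebraMap_apply]
      congr 2
      ext i; fin_cases i <;> simp [δ]
    exact ⟨_, by rw [mul_aeval_congr h2, aeval_smul_of_isHomogeneous hf, h3]; ring⟩
  obtain ⟨c, hc⟩ := hyf
  -- Multiply the relation f + y g = 0 by y; modulo the annihilator of y only the coordinates x₀ and
  -- x₄ survive.
  have hcubic : y * (algebraMap k A c * b 0 ^ 2 + algebraMap k A (γ 0) * y * b 0 +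
      algebraMap k A (γ 4) * y ^ 2) = 0 := by
    linear_combination y * hmem - hc - algebraMap k A (γ 1) * y * hX1 -
      algebraMap k A (γ 2) * y * hX2 - algebraMap k A (γ 3) * y * hX3
  -- units and nilpotents
  have hunit : ∀ (x : A) (s : k), s ≠ 0 → IsNilpotent x → IsUnit (algebraMap k A s + x) :=
    fun x s hs hx => hx.isUnit_add_left_of_commute
      ((isUnit_iff_ne_zero.2 hs).map (algebraMap k A)) (Commute.all _ _)
  have hnu : ∀ x : A, ¬ IsNilpotent x → IsUnit x := by
    intro x hx
    obtain ⟨s, hs⟩ := hres x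
    rcases eq_or_ne s 0 with rfl | hs0
    · rw [map_zero, sub_zero] at hs; exact absurd hs hx
    · have := hunit _ s hs0 hs
      rwa [add_sub_cancel] at this
  have hy0 : y ≠ 0 := hb.ne_zero 4
  have hynil : IsNilpotent y := by
    by_contra h
    exact hb.ne_zero 1 ((hnu y h).mul_right_eq_zero.1 hX1)
  have hbnil : ∀ i, i = 1 ∨ i = 2 ∨ i = 3 → IsNilpotent (b i) := fun i hi => by
    by_contra h
    exact hy0 ((hnu _ h).mul_left_eq_zero.1 (hX i hi))
  have hcancel : ∀ x, IsUnit x → y * x ≠ 0 := fun x hx h => hy0 (hx.mul_left_eq_zero.1 h)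
  obtain ⟨lam, hlam⟩ := (Submodule.mem_span_range_iff_exists_fun k).1 h1
  rw [Fin.sum_univ_five] at hlam
  simp only [Algebra.smul_def, ← hy] at hlam
  have hnilmul : ∀ (x z : A), IsNilpotent z → IsNilpotent (x * z) := fun x z hz =>
    (Commute.all _ _).isNilpotent_mul_left hz
  have hniladd : ∀ {x z : A}, IsNilpotent x → IsNilpotent z → IsNilpotent (x + z) :=
    fun hx hz => (Commute.all _ _).isNilpotent_add hx hz
  have hnontriv : Nontrivial A := ⟨y, 0, hy0⟩
  have hb0 : IsUnit (b 0) := by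
    apply hnu
    intro h
    have : IsNilpotent (1 : A) := by
      rw [← hlam]
      exact hniladd (hniladd (hniladd (hniladd (hnilmul _ _ h)
        (hnilmul _ _ (hbnil 1 (by simp)))) (hnilmul _ _ (hbnil 2 (by simp))))
        (hnilmul _ _ (hbnil 3 (by simp)))) (hnilmul _ _ hynil)
    exact this.not_isUnit isUnit_one
  have hyV : y = algebraMap k A (lam 0) * (y * b 0) + algebraMap k A (lam 4) * y ^ 2 := by
    linear_combination (-y) * hlam + algebraMap k A (lam 1) * hX1 + algebraMap k A (lam 2) * hX2 +
      algebraMap k A (lam 3) * hX3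
  have hlam0 : lam 0 ≠ 0 := by
    intro h0
    rw [h0, map_zero, zero_mul, zero_add] at hyV
    refine hcancel (algebraMap k A 1 + (- algebraMap k A (lam 4)) * y)
      (hunit _ 1 one_ne_zero (hnilmul _ _ hynil)) ?_
    rw [map_one]
    linear_combination hyV
  have hyb0 : y * b 0 = algebraMap k A (lam 0)⁻¹ * (y - algebraMap k A (lam 4) * y ^ 2) := by
    have hinv : algebraMap k A (lam 0)⁻¹ * algebraMap k A (lam 0) = 1 := by
      rw [← map_mul, inv_mul_cancel₀ hlam0, map_one]
    linear_combination (-(algebraMap k A (lam 0)⁻¹)) * hyV - (y * b 0) * hinv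
  -- If y² = 0 then yA = ky; since y ∈ V = ker φ, nondegeneracy would give y = 0.
  have hysq : y ^ 2 ≠ 0 := by
    intro h0
    rw [h0, mul_zero, sub_zero] at hyb0
    have hall : ∀ x : A, ∃ s : k, y * x = s • y := by
      intro x
      obtain ⟨F, rfl⟩ := hgen x
      induction F using MvPolynomial.induction_on with
      | C s => exact ⟨s, by rw [aeval_C, Algebra.smul_def, mul_comm]⟩
      | add p q hp hq =>
        obtain ⟨s, hs⟩ := hp
        obtain ⟨t, ht⟩ := hq
        exact ⟨s + t, by rw [map_add, mul_add, hs, ht, add_smul]⟩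
      | mul_X p i hp =>
        obtain ⟨s, hs⟩ := hp
        rw [map_mul, ← mul_assoc, hs, aeval_X, smul_mul_assoc]
        fin_cases i
        · exact ⟨s * (lam 0)⁻¹, by
            rw [mul_smul]
            congr 1
            rw [Algebra.smul_def]; exact hyb0⟩
        · exact ⟨0, by rw [zero_smul]; exact (congrArg (s • ·) hX1).trans (smul_zero s)⟩
        · exact ⟨0, by rw [zero_smul]; exact (congrArg (s • ·) hX2).trans (smul_zero s)⟩
        · exact ⟨0, by rw [zero_smul]; exact (congrArg (s • ·) hX3).trans (smul_zero s)⟩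
        · refine ⟨0, ?_⟩
          rw [zero_smul]
          have : y * y = 0 := by rw [← sq]; exact h0
          exact (congrArg (s • ·) this).trans (smul_zero s)
    refine hy0 (hφ y fun x => ?_)
    obtain ⟨s, hs⟩ := hall x
    have hyker : φ y = 0 := by
      rw [← LinearMap.mem_ker, hker]; exact Submodule.subset_span ⟨4, rfl⟩
    rw [hs, map_smul, hyker, smul_zero]
  -- With c ≠ 0 the bracket would be a unit plus a nilpotent. The same argument, using y² ≠ 0, then
  -- gives γ₀ = 0, and the cubic reduces to γ₄ y³ = 0.
  have hc0 : c = 0 := by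
    by_contra hne
    have hu : IsUnit (algebraMap k A c * b 0 ^ 2) :=
      ((isUnit_iff_ne_zero.2 hne).map (algebraMap k A)).mul (hb0.pow 2)
    refine hcancel _ ?_ hcubic
    rw [add_assoc]
    refine IsNilpotent.isUnit_add_left_of_commute (hniladd ?_ ?_) hu (Commute.all _ _)
    · rw [mul_right_comm]; exact hnilmul _ _ hynil
    · exact hnilmul _ _ (hynil.pow_succ 1)
  rw [hc0, map_zero, zero_mul, zero_add] at hcubic
  have hγ0 : γ 0 = 0 := by
    by_contra hne
    have hu : IsUnit (algebraMap k A (γ 0) * b 0) :=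
      ((isUnit_iff_ne_zero.2 hne).map (algebraMap k A)).mul hb0
    have hu' : IsUnit (algebraMap k A (γ 0) * b 0 + algebraMap k A (γ 4) * y) :=
      IsNilpotent.isUnit_add_left_of_commute (hnilmul _ _ hynil) hu (Commute.all _ _)
    apply hysq
    rw [← hu'.mul_left_eq_zero]
    linear_combination hcubic
  have hy3 : y ^ 3 = 0 := by
    rw [hγ0, map_zero, zero_mul, zero_mul, zero_add] at hcubic
    rw [← ((isUnit_iff_ne_zero.2 hγ4).map (algebraMap k A)).mul_right_eq_zero]
    linear_combination hcubic
  have hall : ∀ x : A, ∃ s t : k, y * x = algebraMap k A s * y + algebraMap k A t * y ^ 2 := by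
    intro x
    obtain ⟨F, rfl⟩ := hgen x
    induction F using MvPolynomial.induction_on with
    | C s => exact ⟨s, 0, by rw [aeval_C, map_zero]; ring⟩
    | add p q hp hq =>
      obtain ⟨s, t, hs⟩ := hp
      obtain ⟨s', t', ht⟩ := hq
      exact ⟨s + s', t + t', by rw [map_add, mul_add, hs, ht, map_add, map_add]; ring⟩
    | mul_X p i hp =>
      obtain ⟨s, t, hs⟩ := hp
      rw [map_mul, ← mul_assoc, hs, aeval_X]
      fin_cases i
      · refine ⟨s * (lam 0)⁻¹, t * (lam 0)⁻¹ - s * (lam 0)⁻¹ * lam 4, ?_⟩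
        simp only [map_sub, map_mul, Fin.zero_eta]
        linear_combination (algebraMap k A s + algebraMap k A t * y) * hyb0 -
          algebraMap k A t * algebraMap k A (lam 0)⁻¹ * algebraMap k A (lam 4) * hy3
      · refine ⟨0, 0, ?_⟩
        simp only [map_zero, Fin.mk_one]
        linear_combination (algebraMap k A s + algebraMap k A t * y) * hX1
      · refine ⟨0, 0, ?_⟩
        simp only [map_zero, Fin.reduceFinMk]
        linear_combination (algebraMap k A s + algebraMap k A t * y) * hX2
      · refine ⟨0, 0, ?_⟩
        simp only [map_zero, Fin.reduceFinMk]
        linear_combination (algebraMap k A s + algebraMap k A t * y) * hX3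
      · refine ⟨0, s, ?_⟩
        simp only [map_zero, Fin.reduceFinMk, ← hy]
        linear_combination algebraMap k A t * hy3
  -- Since yA = ⟨y, y²⟩ and y³ = 0, nilpotents send y into ky², so y is killed by products of two
  -- nilpotents.
  have hnil : ∀ u : A, IsNilpotent u → ∃ t : k, y * u = algebraMap k A t * y ^ 2 := by
    intro u hu
    obtain ⟨s, t, hst⟩ := hall u
    have hs : s = 0 := by
      by_contra hne
      refine hcancel (algebraMap k A s + ((algebraMap k A t) * y + (-1) * u))
        (hunit _ s hne (hniladd (hnilmul _ _ hynil) (hnilmul _ _ hu))) ?_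
      linear_combination -hst
    exact ⟨t, by rw [hst, hs, map_zero]; ring⟩
  apply hysq
  rw [sq]
  refine hsoc y fun u v hu hv => ?_
  obtain ⟨s, hs⟩ := hnil u hu
  obtain ⟨t, ht⟩ := hnil v hv
  linear_combination v * hs + algebraMap k A s * y * ht + algebraMap k A s * algebraMap k A t * hy3

end ItalianObstruction

end

section

open MvPolynomial

/-! ### Linear coordinate changes acting on points. -/

section ProjectiveEquivalence

variable {k : Type*} [Field k] {n : ℕ} {A : Type*} [CommRing A] [Algebra k A]

/-- The action of matrices on tuples of elements of an algebra. -/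
def matAct (M : Matrix (Fin (n + 1)) (Fin (n + 1)) k) (a : Fin (n + 1) → A) : Fin (n + 1) → A :=
  fun i => ∑ j, M i j • a j

lemma matAct_mul (M N : Matrix (Fin (n + 1)) (Fin (n + 1)) k) (a : Fin (n + 1) → A) :
    matAct M (matAct N a) = matAct (M * N) a := by
  ext i
  simp only [matAct, Matrix.mul_apply, Finset.smul_sum, Finset.sum_smul, smul_smul]
  rw [Finset.sum_comm]

lemma matAct_one (a : Fin (n + 1) → A) :
    matAct (1 : Matrix (Fin (n + 1)) (Fin (n + 1)) k) a = a := by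
  ext i
  simp [matAct, Matrix.one_apply]

lemma aeval_linSubst (M : GL (Fin (n + 1)) k) (a : Fin (n + 1) → A)
    (F : MvPolynomial (Fin (n + 1)) k) : aeval a (linSubst M F) = aeval (matAct M.1 a) F := by
  have : (aeval a).comp (linSubst M) = aeval (matAct M.1 a) := by
    ext i
    simp [linSubst, matAct, Algebra.smul_def]
  rw [← this]; rfl

lemma comap_linSubst_vanishingForms (M : GL (Fin (n + 1)) k) (a : Fin (n + 1) → A) :
    (vanishingForms a).comap (linSubst M) = vanishingForms (k := k) (matAct M.1 a) := by
  have : (coneEval a).comp (linSubst M) = coneEval (k := k) (matAct M.1 a) := by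
    ext i
    simp [linSubst, coneEval, matAct, Finset.sum_mul, Algebra.smul_def, mul_assoc,
      IsScalarTower.algebraMap_apply k A (Polynomial A)]
  rw [vanishingForms, vanishingForms, ← this]
  rfl

lemma comap_linSubst_comap (M N : GL (Fin (n + 1)) k) (I : Ideal (MvPolynomial (Fin (n + 1)) k)) :
    (I.comap (linSubst N)).comap (linSubst M) = I.comap (linSubst (M * N)) := by
  have hX : ∀ (P : GL (Fin (n + 1)) k) i, linSubst P (X i) = ∑ j, C (P.1 i j) * X j := fun P i => by
    rw [linSubst, aeval_X]
  have hC : ∀ (P : GL (Fin (n + 1)) k) c, linSubst P (C c) = C c := fun P c => by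
    rw [← algebraMap_eq, AlgHom.commutes]
  have : (linSubst N).comp (linSubst M) = linSubst (M * N) := by
    refine MvPolynomial.algHom_ext fun i => ?_
    rw [AlgHom.comp_apply, hX, hX, map_sum]
    simp only [map_mul, hX, hC, Units.val_mul, Matrix.mul_apply, map_sum, Finset.mul_sum,
      Finset.sum_mul]
    rw [Finset.sum_comm]
    simp only [mul_assoc]
  ext F
  rw [Ideal.mem_comap, Ideal.mem_comap, Ideal.mem_comap, ← this, AlgHom.comp_apply]

lemma comap_linSubst_one (I : Ideal (MvPolynomial (Fin (n + 1)) k)) :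
    I.comap (linSubst 1) = I := by
  have : linSubst (1 : GL (Fin (n + 1)) k) = AlgHom.id k _ := by
    ext i
    simp [linSubst, Matrix.one_apply]
  rw [this]; rfl

lemma ProjectivelyEquivalent.refl (I : Ideal (MvPolynomial (Fin (n + 1)) k)) :
    ProjectivelyEquivalent I I := ⟨1, (comap_linSubst_one I).symm⟩

lemma ProjectivelyEquivalent.symm {I J : Ideal (MvPolynomial (Fin (n + 1)) k)}
    (h : ProjectivelyEquivalent I J) : ProjectivelyEquivalent J I := by
  obtain ⟨M, rfl⟩ := h
  exact ⟨M⁻¹, by rw [comap_linSubst_comap, inv_mul_cancel, comap_linSubst_one]⟩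

lemma ProjectivelyEquivalent.trans {I J K : Ideal (MvPolynomial (Fin (n + 1)) k)}
    (h : ProjectivelyEquivalent I J) (h' : ProjectivelyEquivalent J K) :
    ProjectivelyEquivalent I K := by
  obtain ⟨M, rfl⟩ := h
  obtain ⟨N, rfl⟩ := h'
  exact ⟨N * M, by rw [comap_linSubst_comap]⟩

lemma span_matAct_le (M : Matrix (Fin (n + 1)) (Fin (n + 1)) k) (a : Fin (n + 1) → A) :
    Submodule.span k (Set.range (matAct M a)) ≤ Submodule.span k (Set.range a) := by
  rw [Submodule.span_le]
  rintro _ ⟨i, rfl⟩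
  exact Submodule.sum_mem _ fun j _ => Submodule.smul_mem _ _ (Submodule.subset_span ⟨j, rfl⟩)

lemma matAct_inv_matAct (M : GL (Fin (n + 1)) k) (a : Fin (n + 1) → A) :
    matAct (M⁻¹).1 (matAct M.1 a) = a := by
  rw [matAct_mul]
  have : (M⁻¹).1 * M.1 = 1 := by rw [← Units.val_mul, inv_mul_cancel]; rfl
  rw [this, matAct_one]

lemma span_matAct (M : GL (Fin (n + 1)) k) (a : Fin (n + 1) → A) :
    Submodule.span k (Set.range (matAct M.1 a)) = Submodule.span k (Set.range a) := by
  refine le_antisymm (span_matAct_le _ _) ?_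
  conv_lhs => rw [← matAct_inv_matAct M a]
  exact span_matAct_le _ _

lemma surjective_aeval_matAct (M : GL (Fin (n + 1)) k) {a : Fin (n + 1) → A}
    (h : Function.Surjective (aeval a : MvPolynomial (Fin (n + 1)) k →ₐ[k] A)) :
    Function.Surjective (aeval (matAct M.1 a) : MvPolynomial (Fin (n + 1)) k →ₐ[k] A) := by
  intro x
  obtain ⟨F, rfl⟩ := h x
  exact ⟨linSubst M⁻¹ F, by rw [aeval_linSubst, matAct_inv_matAct]⟩

/-- Bases of the same space of linear forms define projectively equivalent schemes. -/
lemma projectivelyEquivalent_of_span_eq {a b : Fin (n + 1) → A} (ha : LinearIndependent k a)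
    (hb : LinearIndependent k b)
    (h : Submodule.span k (Set.range a) = Submodule.span k (Set.range b)) :
    ProjectivelyEquivalent (vanishingForms (k := k) a) (vanishingForms b) := by
  have h1 : ∀ i, ∃ c : Fin (n + 1) → k, ∑ j, c j • a j = b i := fun i => by
    rw [← Submodule.mem_span_range_iff_exists_fun, h]; exact Submodule.subset_span ⟨i, rfl⟩
  have h2 : ∀ i, ∃ c : Fin (n + 1) → k, ∑ j, c j • b j = a i := fun i => by
    rw [← Submodule.mem_span_range_iff_exists_fun, ← h]; exact Submodule.subset_span ⟨i, rfl⟩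
  choose M hM using h1
  choose N hN using h2
  have hMa : matAct (Matrix.of M) a = b := funext hM
  have hNb : matAct (Matrix.of N) b = a := funext hN
  have key : ∀ (c : Fin (n + 1) → A) (_ : LinearIndependent k c)
      (P : Matrix (Fin (n + 1)) (Fin (n + 1)) k), matAct P c = c → P = 1 := by
    intro c hc P hP
    ext i j
    have h3 : ∑ j, (P i j - (1 : Matrix _ _ k) i j) • c j = 0 := by
      simp only [sub_smul, Finset.sum_sub_distrib]
      have e1 := congrFun hP i
      have e2 := congrFun (matAct_one (k := k) c) i
      simp only [matAct] at e1 e2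
      rw [e1, e2, sub_self]
    exact sub_eq_zero.1 (Fintype.linearIndependent_iff.1 hc _ h3 j)
  refine ⟨⟨Matrix.of M, Matrix.of N, key b hb _ ?_, key a ha _ ?_⟩, ?_⟩
  · rw [← matAct_mul, hNb, hMa]
  · rw [← matAct_mul, hMa, hNb]
  · rw [comap_linSubst_vanishingForms]
    simp only [hMa]

end ProjectiveEquivalence

/-! ### Italian schemes lie outside the three orbits. -/

section Necessity

universe u

variable {k : Type u} [Field k]

/-- The algebraic description of a nondegenerate arithmetically Gorenstein scheme of degree six. -/
lemma exists_algebraic_data {A : Type*} [CommRing A] [Algebra k A]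
    {I : Ideal (MvPolynomial (Fin 5) k)} (hI : I ∈ hilbAGCodim k 4 6 0)
    {l : MvPolynomial (Fin 5) k} (hl : l.IsHomogeneous 1) (hreg : ∀ F, l * F ∈ I → F ∈ I)
    (e : (MvPolynomial (Fin 5) k ⧸ (I ⊔ Ideal.span {l - 1})) ≃ₐ[k] A) :
    ∃ a : Fin 5 → A, I = vanishingForms a ∧ (1 : A) ∈ Submodule.span k (Set.range a) ∧
      Function.Surjective (aeval a : MvPolynomial (Fin 5) k →ₐ[k] A) ∧ LinearIndependent k a ∧
      Module.Finite k A ∧ Module.finrank k A = 6 ∧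
      ∃ φ : A →ₗ[k] k, LinearMap.ker φ = Submodule.span k (Set.range a) ∧
        ∀ x, (∀ y, φ (x * y) = 0) → x = 0 := by
  obtain ⟨⟨hproj, hdeg, hG⟩, hcodim⟩ := hI
  obtain ⟨a, hIa, hl1, hgen⟩ := exists_point_of_chart hproj.1 hl hreg e
  have h1 : (1 : A) ∈ Submodule.span k (Set.range a) := (mem_span_iff a).2 ⟨l, hl, hl1⟩
  obtain ⟨hfin, hrank⟩ := finite_of_hilbertFunction a hIa h1 hgen hdeg
  have hfd : Module.Finite k (homogeneousSubmodule (Fin 5) k 1) :=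
    Module.Finite.iff_fg.2 (homogeneousSubmodule_fg (Fin 5) k 1)
  have hbot : homogeneousSubmodule (Fin 5) k 1 ⊓ I.restrictScalars k = ⊥ := by
    have : Module.Finite k ↥(homogeneousSubmodule (Fin 5) k 1 ⊓ I.restrictScalars k) :=
      Submodule.finiteDimensional_inf_left _ _
    exact Submodule.finrank_eq_zero.1 hcodim
  have hind : LinearIndependent k a := by
    rw [Fintype.linearIndependent_iff]
    intro c hc
    have hL : (∑ i, C (c i) * X i : MvPolynomial (Fin 5) k).IsHomogeneous 1 := by
      refine IsHomogeneous.sum _ _ _ fun i _ => ?_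
      have := (isHomogeneous_C (Fin 5) (c i)).mul (isHomogeneous_X k i)
      rwa [zero_add] at this
    have hmem : (∑ i, C (c i) * X i : MvPolynomial (Fin 5) k) ∈
        homogeneousSubmodule (Fin 5) k 1 ⊓ I.restrictScalars k := by
      refine ⟨hL, ?_⟩
      change _ ∈ I
      rw [hIa, mem_vanishingForms_of_isHomogeneous a hL, ← hc]
      simp [Algebra.smul_def]
    rw [hbot, Submodule.mem_bot] at hmem
    intro i
    have := congrArg (coeff (Finsupp.single i 1)) hmem
    simpa [coeff_sum, coeff_C_mul, coeff_X, Finsupp.single_left_inj] using this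
  refine ⟨a, hIa, h1, hgen, hind, hfin, hrank, ?_⟩
  exact exists_nondegenerate_functional hIa hG hl hl1 hgen
    (by rw [finrank_span_eq_card hind, hrank]; rfl)

/-- A linear change moves the point of A so that its vanishing ideal is the Italian ideal itself,
without changing the span of the coordinates; then `false_of_italianIdeal` applies. -/
theorem notMem_orbitO_of_isItalian {X : Ideal (MvPolynomial (Fin 5) k)} (hX : IsItalian X)
    {A : Type*} [CommRing A] [Algebra k A]
    (hA : HasNilpotentResidues k A ∧ SecondSocleSqZero A) : X ∉ orbitO k A := by
  rintro ⟨I, hI, ⟨l, hl, hreg, ⟨e⟩⟩, hIX⟩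
  obtain ⟨J, f, g, -, -, -, hlast, hg, hg', hJX⟩ := hX
  obtain ⟨a, hIa, h1, hgen, hind, -, -, φ, hker, hφ⟩ := exists_algebraic_data hI hl hreg e
  obtain ⟨P, hP⟩ := hIX.trans hJX.symm
  rw [hIa, comap_linSubst_vanishingForms] at hP
  have hf : f.IsHomogeneous 2 := by
    obtain ⟨-, -, -, -, -, α₄, -, -, -, h4, -, -, -, -, rfl'⟩ := hlast
    have := (h4 0 0).1
    rw [rfl'] at this
    exact (IsHomogeneous.rename_isHomogeneous_iff (Fin.castSucc_injective 4)).1 this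
  have hind' : LinearIndependent k (matAct P.1 a) := by
    rw [linearIndependent_iff_card_eq_finrank_span, Set.finrank, span_matAct,
      finrank_span_eq_card hind]
  exact false_of_italianIdeal hind' (surjective_aeval_matAct P hgen) (by rwa [span_matAct])
    (by rwa [span_matAct]) hφ hA.1 hA.2 hf hg hg' hP

end Necessity

end

section

open MvPolynomial

/-! ### Variables as regular sequences. -/

section RegularVariables

variable {k σ : Type*} [Field k]

/-- The substitution of zero for the variables in `s`. -/
noncomputable def killVars (k : Type*) {σ : Type*} [Field k] (s : Set σ) :
    MvPolynomial σ k →ₐ[k] MvPolynomial σ k :=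
  open scoped Classical in aeval fun i => if i ∈ s then 0 else X i

lemma killVars_X_of_mem {s : Set σ} {i : σ} (h : i ∈ s) : killVars k s (X i) = 0 := by
  simp [killVars, h]

lemma killVars_X_of_notMem {s : Set σ} {i : σ} (h : i ∉ s) : killVars k s (X i) = X i := by
  simp [killVars, h]

lemma killVars_C (s : Set σ) (c : k) : killVars k s (C c) = C c := (killVars k s).commutes c

lemma sub_killVars_mem (s : Set σ) (F : MvPolynomial σ k) :
    F - killVars k s F ∈ Ideal.span (X '' s : Set (MvPolynomial σ k)) := by
  induction F using MvPolynomial.induction_on with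
  | C c => rw [killVars_C, sub_self]; exact zero_mem _
  | add p q hp hq =>
    rw [map_add, add_sub_add_comm]
    exact add_mem hp hq
  | mul_X p i hp =>
    have : p * X i - killVars k s (p * X i) =
        (p - killVars k s p) * X i + killVars k s p * (X i - killVars k s (X i)) := by
      rw [map_mul]; ring
    rw [this]
    refine add_mem (Ideal.mul_mem_right _ _ hp) (Ideal.mul_mem_left _ _ ?_)
    by_cases h : i ∈ s
    · rw [killVars_X_of_mem h, sub_zero]
      exact Ideal.subset_span ⟨i, h, rfl⟩
    · rw [killVars_X_of_notMem h, sub_self]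
      exact zero_mem _

lemma exists_eq_killVars_singleton (i : σ) (F : MvPolynomial σ k) :
    ∃ G, F = killVars k {i} F + X i * G := by
  have h := sub_killVars_mem {i} F
  rw [Set.image_singleton, Ideal.mem_span_singleton] at h
  obtain ⟨G, hG⟩ := h
  exact ⟨G, by rw [← hG]; ring⟩

lemma X_dvd_of_dvd_mul {i j : σ} (hij : i ≠ j) {F : MvPolynomial σ k} (h : X i ∣ X j * F) :
    X i ∣ F := by
  obtain ⟨G, hG⟩ := h
  have := congrArg (killVars k {i}) hG
  rw [map_mul, map_mul, killVars_X_of_mem (Set.mem_singleton i), zero_mul,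
    killVars_X_of_notMem (by simpa using hij.symm)] at this
  obtain ⟨H, hH⟩ := exists_eq_killVars_singleton i F
  rw [(mul_eq_zero.1 this).resolve_left (X_ne_zero j), zero_add] at hH
  exact ⟨H, hH⟩

/-- Killing x_i and x_j leaves a polynomial ring in which x_l is still regular. -/
lemma exists_add_of_mul_eq_add {i j l : σ} (hi : i ≠ l) (hj : j ≠ l)
    {F G H : MvPolynomial σ k} (h : X l * F = X i * G + X j * H) :
    ∃ G' H', F = X i * G' + X j * H' := by
  have := congrArg (killVars k {i, j}) h
  rw [map_mul, map_add, map_mul, map_mul, 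
    killVars_X_of_mem (Set.mem_insert i {j}), killVars_X_of_mem (Set.mem_insert_of_mem i (Set.mem_singleton j)),
    zero_mul, zero_mul, add_zero,
    killVars_X_of_notMem (by simp [hi.symm, hj.symm] : l ∉ ({i, j} : Set σ))] at this
  have h0 := sub_killVars_mem {i, j} F
  rw [(mul_eq_zero.1 this).resolve_left (X_ne_zero l), sub_zero, Set.image_pair,
    Ideal.mem_span_pair] at h0
  obtain ⟨a, b, hab⟩ := h0
  exact ⟨a, b, by rw [← hab]; ring⟩

end RegularVariables

/-! ### Lifting exactness from the quotient by a variable. -/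

section Lifting

variable {k σ : Type*} [Field k] {m n p : Type*} [Fintype n] [Fintype p]

/-- A complex of matrices of forms which is exact modulo a variable is exact. -/
lemma exists_mulVec_eq_of_exact_mod (i : σ) {A A₀ A₁ : Matrix m n (MvPolynomial σ k)}
    {B B₀ B₁ : Matrix n p (MvPolynomial σ k)} (hAB : A * B = 0)
    (hA : A = A₀ + (X i : MvPolynomial σ k) • A₁) (hB : B = B₀ + (X i : MvPolynomial σ k) • B₁)
    (hA₀ : A₀.map (killVars k {i}) = A₀) {b : ℕ} (hhom : ∀ r s, (B r s).IsHomogeneous b)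
    (hex : ∀ v, A₀.mulVec v = 0 → ∃ w, B₀.mulVec w = v) {v : n → MvPolynomial σ k}
    (hv : A.mulVec v = 0) : ∃ w, B.mulVec w = v := by
  classical
  -- Reduce v modulo the variable, solve there, and subtract the lifted solution; the error is
  -- divisible by the variable, and its quotient is again a cycle.
  have step : ∀ v : n → MvPolynomial σ k, A.mulVec v = 0 →
      ∃ w v', v = B.mulVec w + (X i : MvPolynomial σ k) • v' ∧ A.mulVec v' = 0 := by
    intro v hv
    choose g hg using fun r => exists_eq_killVars_singleton (k := k) i (v r)
    have hg' : v = (fun r => killVars k {i} (v r)) + (X i : MvPolynomial σ k) • g := by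
      ext1 r; simpa using hg r
    have h1 : A₀.mulVec (fun r => killVars k {i} (v r)) = 0 := by
      ext1 r
      have h2 := congrArg (killVars k {i}) (congrFun hv r)
      rw [hA, Matrix.add_mulVec] at h2
      simp only [Matrix.mulVec, dotProduct, Pi.add_apply, Matrix.smul_apply, smul_eq_mul,
        Pi.zero_apply, map_zero, map_add, map_sum, map_mul, killVars_X_of_mem (Set.mem_singleton i),
        zero_mul, Finset.sum_const_zero, add_zero] at h2
      simp only [Matrix.mulVec, dotProduct, Pi.zero_apply]
      rw [← h2]
      refine Finset.sum_congr rfl fun s _ => ?_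
      conv_lhs => rw [← hA₀]
      rfl
    obtain ⟨w, hw⟩ := hex _ h1
    have h3 : v = B.mulVec w + (X i : MvPolynomial σ k) • (g - B₁.mulVec w) := by
      rw [hg', ← hw, hB, Matrix.add_mulVec, Matrix.smul_mulVec, smul_sub]
      abel
    refine ⟨w, _, h3, ?_⟩
    have h4 := hv
    rw [h3, Matrix.mulVec_add, Matrix.mulVec_mulVec, hAB, Matrix.zero_mulVec, zero_add,
      Matrix.mulVec_smul] at h4
    ext1 r
    have h5 := congrFun h4 r
    simp only [Pi.smul_apply, smul_eq_mul, Pi.zero_apply] at h5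
    exact (mul_eq_zero.1 h5).resolve_left (X_ne_zero i)
  have iter : ∀ N : ℕ, ∃ w v', v = B.mulVec w + (X i : MvPolynomial σ k) ^ N • v' ∧
      A.mulVec v' = 0 := by
    intro N
    induction N with
    | zero => exact ⟨0, v, by simp, hv⟩
    | succ N ih =>
      obtain ⟨w, v', h1, h2⟩ := ih
      obtain ⟨w', v'', h3, h4⟩ := step v' h2
      refine ⟨w + (X i : MvPolynomial σ k) ^ N • w', v'', ?_, h4⟩
      rw [Matrix.mulVec_add, Matrix.mulVec_smul, pow_succ, mul_smul, add_assoc, ← smul_add, ← h3]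
      exact h1
  obtain ⟨N, hN⟩ : ∃ N, ∀ r, (v r).totalDegree < N :=
    ⟨∑ r, (v r).totalDegree + 1, fun r => Nat.lt_succ_of_le
      (Finset.single_le_sum (f := fun r => (v r).totalDegree) (fun _ _ => Nat.zero_le _)
        (Finset.mem_univ r))⟩
  -- The remainder is divisible by the power b + N of the variable, so it is invisible in lower
  -- degrees, where all of v lives. As B is homogeneous of degree b, truncating w below degree N
  -- gives an exact solution.
  obtain ⟨w, v', h1, -⟩ := iter (b + N)
  have hsum : ∀ r, ∑ t ∈ Finset.range (b + N), homogeneousComponent t (v r) = v r := by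
    intro r
    conv_rhs => rw [← sum_homogeneousComponent (v r)]
    refine (Finset.sum_subset (fun t ht => ?_) fun t _ ht => ?_).symm
    · have := hN r
      simp only [Finset.mem_range] at ht ⊢
      omega
    · refine homogeneousComponent_eq_zero _ _ ?_
      simp only [Finset.mem_range] at ht
      omega
  have hcomp : ∀ r t, t < b + N →
      homogeneousComponent t (v r) = homogeneousComponent t (B.mulVec w r) := by
    intro r t ht
    rw [h1]
    simp only [Pi.add_apply, Pi.smul_apply, smul_eq_mul, map_add]
    rw [homogeneousComponent_mul_of_lt ((isHomogeneous_X k i).pow _) _ (by omega), add_zero]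
  refine ⟨fun s => ∑ t ∈ Finset.range N, homogeneousComponent t (w s), ?_⟩
  ext1 r
  rw [← hsum r, Finset.sum_range_add, Finset.sum_eq_zero, zero_add]
  · simp only [Matrix.mulVec, dotProduct, Finset.mul_sum]
    rw [Finset.sum_comm]
    refine Finset.sum_congr rfl fun t ht => ?_
    rw [hcomp r _ (by have := Finset.mem_range.1 ht; omega)]
    simp only [Matrix.mulVec, dotProduct, map_sum]
    exact Finset.sum_congr rfl fun s _ => (homogeneousComponent_mul_of_isHomogeneous (hhom r s) _ _).symm
  · intro t ht
    have ht' := Finset.mem_range.1 ht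
    rw [hcomp r t (by omega)]
    simp only [Matrix.mulVec, dotProduct, map_sum]
    exact Finset.sum_eq_zero fun s _ => homogeneousComponent_mul_of_lt (hhom r s) _ ht'

end Lifting

/-! ### The apolar quadrics of a sum of three squares, and the Koszul complex. -/

section BaseComplex

/-- The quadrics apolar to `x² + y² + z²`. -/
def apolarRow {R : Type*} [CommRing R] (x y z : R) : Matrix (Fin 1) (Fin 5) R :=
  !![x * y, x * z, y * z, x ^ 2 - y ^ 2, x ^ 2 - z ^ 2]

/-- The linear syzygies of the quadrics apolar to `x² + y² + z²`. -/
def apolarSyzygies {R : Type*} [CommRing R] (x y z : R) : Matrix (Fin 5) (Fin 5) R :=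
  !![0, -x, y, z, 0; x, 0, -z, 0, -y; -y, z, 0, -x, x; -z, 0, x, 0, 0; 0, y, -x, 0, 0]

/-- The vector of variables, as the first map of a Koszul complex. -/
def koszulRow {R : Type*} (x y z : R) : Matrix (Fin 1) (Fin 3) R := !![x, y, z]

/-- The middle map of a Koszul complex on three elements. -/
def koszulSyzygies {R : Type*} [CommRing R] (x y z : R) : Matrix (Fin 3) (Fin 3) R :=
  !![0, z, -y; -z, 0, x; y, -x, 0]

lemma apolarRow_mul {R : Type*} [CommRing R] (x y z : R) :
    apolarRow x y z * apolarSyzygies x y z = 0 := by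
  ext i j
  fin_cases i; fin_cases j <;>
    simp [apolarRow, apolarSyzygies, Matrix.mul_apply, Fin.sum_univ_succ] <;> ring

lemma apolarSyzygies_transpose {R : Type*} [CommRing R] (x y z : R) :
    (apolarSyzygies x y z).transpose = -apolarSyzygies x y z := by
  ext i j
  fin_cases i <;> fin_cases j <;> simp [apolarSyzygies]

lemma koszulRow_mul {R : Type*} [CommRing R] (x y z : R) :
    koszulRow x y z * koszulSyzygies x y z = 0 := by
  ext i j
  fin_cases i; fin_cases j <;>
    simp [koszulRow, koszulSyzygies, Matrix.mul_apply, Fin.sum_univ_succ] <;> ring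

lemma koszulSyzygies_transpose {R : Type*} [CommRing R] (x y z : R) :
    (koszulSyzygies x y z).transpose = -koszulSyzygies x y z := by
  ext i j
  fin_cases i <;> fin_cases j <;> simp [koszulSyzygies]

lemma koszulSyzygies_mul {R : Type*} [CommRing R] (x y z : R) :
    koszulSyzygies x y z * (koszulRow x y z).transpose = 0 := by
  rw [← Matrix.transpose_transpose (koszulSyzygies x y z), ← Matrix.transpose_mul,
    koszulSyzygies_transpose, Matrix.mul_neg, koszulRow_mul, neg_zero, Matrix.transpose_zero]

variable {k σ : Type*} [Field k] {i j l : σ}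

lemma exists_koszulSyzygies_mulVec (hij : i ≠ j) (hil : i ≠ l) (hjl : j ≠ l)
    {v : Fin 3 → MvPolynomial σ k} (hv : (koszulRow (X i) (X j) (X l)).mulVec v = 0) :
    ∃ w, (koszulSyzygies (X i) (X j) (X l)).mulVec w = v := by
  have h := congrFun hv 0
  simp [koszulRow, Matrix.mulVec, dotProduct, Fin.sum_univ_succ] at h
  have h1 : (X l : MvPolynomial σ k) * v 2 = X i * (-v 0) + X j * (-v 1) := by
    linear_combination h
  obtain ⟨a, b, hab⟩ := exists_add_of_mul_eq_add hil hjl h1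
  have h2 : (X i : MvPolynomial σ k) * (v 0 + X l * a) = X j * (-(v 1 + X l * b)) := by
    linear_combination h - X l * hab
  obtain ⟨c, hc⟩ := X_dvd_of_dvd_mul hij (Dvd.intro _ h2)
  have h3 : v 0 = X j * c - X l * a := by
    have := mul_left_cancel₀ (X_ne_zero i)
      (show (X i : MvPolynomial σ k) * (v 0 + X l * a) = X i * (X j * c) by
        linear_combination h2 + X j * hc)
    linear_combination this
  refine ⟨![b, -a, -c], ?_⟩
  ext1 r
  fin_cases r
  · simp [koszulSyzygies, Matrix.mulVec, dotProduct, Fin.sum_univ_succ]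
    linear_combination -h3
  · simp [koszulSyzygies, Matrix.mulVec, dotProduct, Fin.sum_univ_succ]
    linear_combination hc
  · simp [koszulSyzygies, Matrix.mulVec, dotProduct, Fin.sum_univ_succ]
    linear_combination -hab

lemma exists_koszulRow_transpose_mulVec (hij : i ≠ j)
    {v : Fin 3 → MvPolynomial σ k} (hv : (koszulSyzygies (X i) (X j) (X l)).mulVec v = 0) :
    ∃ w, (koszulRow (X i) (X j) (X l)).transpose.mulVec w = v := by
  have h0 := congrFun hv 0
  have h1 := congrFun hv 1
  have h2 := congrFun hv 2
  simp [koszulSyzygies, Matrix.mulVec, dotProduct, Fin.sum_univ_succ] at h0 h1 h2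
  obtain ⟨c, hc⟩ := X_dvd_of_dvd_mul hij
    (show (X i : MvPolynomial σ k) ∣ X j * v 0 from ⟨v 1, by linear_combination h2⟩)
  refine ⟨fun _ => c, ?_⟩
  have e1 : v 1 = X j * c := mul_left_cancel₀ (X_ne_zero i) (by linear_combination -h2 + X j * hc)
  have e2 : v 2 = X l * c := mul_left_cancel₀ (X_ne_zero i) (by linear_combination h1 + X l * hc)
  ext1 r
  fin_cases r <;> simp [koszulRow, Matrix.mulVec, dotProduct, *]

/-- Four of the five equations suffice: cancelling one variable at a time expresses every coordinate
through a single polynomial t. -/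
lemma exists_apolarRow_transpose_mulVec (hij : i ≠ j) (hil : i ≠ l) (hjl : j ≠ l)
    {v : Fin 5 → MvPolynomial σ k} (hv : (apolarSyzygies (X i) (X j) (X l)).mulVec v = 0) :
    ∃ w, (apolarRow (X i) (X j) (X l)).transpose.mulVec w = v := by
  have h0 := congrFun hv 0
  have h1 := congrFun hv 1
  have h3 := congrFun hv 3
  have h4 := congrFun hv 4
  simp [apolarSyzygies, Matrix.mulVec, dotProduct, Fin.sum_univ_succ] at h0 h1 h3 h4
  obtain ⟨s, hs⟩ := X_dvd_of_dvd_mul hil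
    (show (X i : MvPolynomial σ k) ∣ X l * v 0 from ⟨v 2, by linear_combination -h3⟩)
  have e2 : v 2 = X l * s := mul_left_cancel₀ (X_ne_zero i) (by linear_combination h3 + X l * hs)
  obtain ⟨t, ht⟩ := X_dvd_of_dvd_mul hjl (X_dvd_of_dvd_mul hij.symm
    (show (X j : MvPolynomial σ k) ∣ X i * (X l * s) from
      ⟨v 1, by linear_combination -h4 - X i * e2⟩))
  have e1 : v 1 = X i * X l * t := mul_left_cancel₀ (X_ne_zero j)
    (by linear_combination h4 + X i * e2 + X i * X l * ht)
  have e3 : v 3 = (X i ^ 2 - X j ^ 2) * t := mul_left_cancel₀ (X_ne_zero l)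
    (by linear_combination h0 + X i * e1 - X j * e2 - X j * X l * ht)
  have e4 : v 4 = (X i ^ 2 - X l ^ 2) * t := mul_left_cancel₀ (X_ne_zero j)
    (by linear_combination -h1 + X i * hs - X l * e2 + (X i ^ 2 - X l ^ 2) * ht)
  refine ⟨fun _ => t, ?_⟩
  ext1 r
  fin_cases r <;> simp [apolarRow, Matrix.mulVec, dotProduct, *] <;> ring

lemma exists_apolarSyzygies_mulVec (hij : i ≠ j) (hil : i ≠ l) (hjl : j ≠ l)
    {v : Fin 5 → MvPolynomial σ k} (hv : (apolarRow (X i) (X j) (X l)).mulVec v = 0) :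
    ∃ w, (apolarSyzygies (X i) (X j) (X l)).mulVec w = v := by
  have h := congrFun hv 0
  simp [apolarRow, Matrix.mulVec, dotProduct, Fin.sum_univ_succ] at h
  obtain ⟨p, q, hpq⟩ := exists_add_of_mul_eq_add hil hjl
    (show (X l : MvPolynomial σ k) * (X l * v 4) =
      X i * (X j * v 0 + X l * v 1 + X i * v 3 + X i * v 4) + X j * (X l * v 2 - X j * v 3) by
      linear_combination -h)
  obtain ⟨E₁, E₂, hE⟩ := exists_add_of_mul_eq_add hil hjl hpq
  obtain ⟨p', q', hpq'⟩ := exists_add_of_mul_eq_add hij hjl.symm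
    (show (X j : MvPolynomial σ k) * (X j * (v 3 + X i * E₁)) =
      X i * (X j * (v 0 + X i * E₂ + X j * E₁) + X l * (v 1 - X l * E₁) +
        X i * (v 3 + X i * E₁)) + X l * (X j * (v 2 - X l * E₂)) by
      linear_combination -h + (X i ^ 2 - X l ^ 2) * hE)
  obtain ⟨a, b, hD⟩ := exists_add_of_mul_eq_add hij hjl.symm hpq'
  obtain ⟨p'', q'', hpq''⟩ := exists_add_of_mul_eq_add hij.symm hil.symm
    (show (X i : MvPolynomial σ k) * (X i * (X i * a)) =
      X j * (X j * (v 3 + X i * E₁) - X i * (v 0 + X i * E₂ + X j * E₁)) +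
        X l * (-X i ^ 2 * b - X i * (v 1 - X l * E₁) - X j * (v 2 - X l * E₂)) by
      linear_combination h - (X i ^ 2 - X l ^ 2) * hE - X i ^ 2 * hD)
  obtain ⟨p₃, q₃, hpq₃⟩ := exists_add_of_mul_eq_add hij.symm hil.symm hpq''
  obtain ⟨a₁, a₂, ha⟩ := exists_add_of_mul_eq_add hij.symm hil.symm hpq₃
  -- After subtracting multiples of the syzygies only a relation among xy, xz, yz is left; each of
  -- its coefficients is divisible by the variable missing from its monomial.
  have key : X i * X j * (v 0 + X i * E₂ + X j * E₁ - a₁ * (X j ^ 2 - X i ^ 2)) +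
      X i * X l * (v 1 - X l * E₁ + X i * (b + X i * a₂) + X j * X l * a₁) +
      X j * X l * (v 2 - X l * E₂ - X j * (b + X i * a₂) - X i * X l * a₁) = 0 := by
    linear_combination h - (X i ^ 2 - X l ^ 2) * hE - (X i ^ 2 - X j ^ 2) * hD -
      (X i ^ 2 - X j ^ 2) * X i * ha
  obtain ⟨c, hc⟩ := X_dvd_of_dvd_mul hil (X_dvd_of_dvd_mul hij
    (show (X i : MvPolynomial σ k) ∣ X j * (X l * (v 2 - X l * E₂ - X j * (b + X i * a₂) -
      X i * X l * a₁)) from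
      ⟨-(X j * (v 0 + X i * E₂ + X j * E₁ - a₁ * (X j ^ 2 - X i ^ 2)) +
        X l * (v 1 - X l * E₁ + X i * (b + X i * a₂) + X j * X l * a₁)), by linear_combination key⟩))
  obtain ⟨d, hd⟩ := X_dvd_of_dvd_mul hjl (X_dvd_of_dvd_mul hij.symm
    (show (X j : MvPolynomial σ k) ∣ X i * (X l * (v 1 - X l * E₁ + X i * (b + X i * a₂) +
      X j * X l * a₁)) from
      ⟨-(X i * (v 0 + X i * E₂ + X j * E₁ - a₁ * (X j ^ 2 - X i ^ 2)) +
        X l * (v 2 - X l * E₂ - X j * (b + X i * a₂) - X i * X l * a₁)), by linear_combination key⟩))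
  have hA : v 0 + X i * E₂ + X j * E₁ - a₁ * (X j ^ 2 - X i ^ 2) = -X l * (c + d) :=
    mul_left_cancel₀ (mul_ne_zero (X_ne_zero i) (X_ne_zero j))
      (by linear_combination key - X i * X l * hd - X j * X l * hc)
  refine ⟨![-(b + X i * a₂), E₂ + X i * a₁, -E₁ + X j * a₁, -(c + d), -d], ?_⟩
  ext1 r
  fin_cases r <;> simp [apolarSyzygies, Matrix.mulVec, dotProduct, Fin.sum_univ_succ]
  · linear_combination -hA
  · linear_combination -hd
  · linear_combination -hc
  · linear_combination -hD - X i * ha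
  · linear_combination -hE

end BaseComplex

end

section

open MvPolynomial

/-! ### Tensoring a self-dual resolution with the Koszul complex of a linear form. -/

section Cone

variable {k : Type*} [Field k] {n : ℕ}

/-- The entries of `M` are forms of the degrees prescribed by the degrees `a` and `b` of the
generators of the target and of the source. -/
def IsGradedBlock {m m' : Type*} (a : m → ℕ) (b : m' → ℕ)
    (M : Matrix m m' (MvPolynomial (Fin 5) k)) : Prop :=
  ∀ i j, (M i j).IsHomogeneous (b j - a i) ∧ (b j < a i → M i j = 0)

lemma IsGradedBlock.submatrix {m m' : Type*} {a : m → ℕ} {b : m' → ℕ}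
    {M : Matrix m m' (MvPolynomial (Fin 5) k)} (h : IsGradedBlock a b M) {p q : ℕ}
    {a' : Fin p → ℕ} {b' : Fin q → ℕ} {e : Fin p → m} {e' : Fin q → m'} (ha : ∀ i, a' i = a (e i))
    (hb : ∀ i, b' i = b (e' i)) : IsGradedMatrix a' b' (M.submatrix e e') := by
  intro i j
  rw [ha, hb]
  exact h (e i) (e' j)

lemma IsGradedBlock.of_isHomogeneous {m m' : Type*} {a b d : ℕ}
    {M : Matrix m m' (MvPolynomial (Fin 5) k)} (h : ∀ i j, (M i j).IsHomogeneous d)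
    (hd : b = a + d) : IsGradedBlock (fun _ => a) (fun _ => b) M := by
  subst hd
  refine fun i j => ⟨?_, fun h' => absurd h' (by simp)⟩
  change (M i j).IsHomogeneous (a + d - a)
  rw [Nat.add_sub_cancel_left]
  exact h i j

lemma IsGradedBlock.zero {m m' : Type*} {a : m → ℕ} {b : m' → ℕ} :
    IsGradedBlock a b (0 : Matrix m m' (MvPolynomial (Fin 5) k)) :=
  fun _ _ => ⟨isHomogeneous_zero _ _ _, fun _ => rfl⟩

lemma IsGradedBlock.neg {m m' : Type*} {a : m → ℕ} {b : m' → ℕ}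
    {M : Matrix m m' (MvPolynomial (Fin 5) k)} (h : IsGradedBlock a b M) :
    IsGradedBlock a b (-M) :=
  fun i j => ⟨(h i j).1.neg, fun h' => by rw [Matrix.neg_apply, (h i j).2 h', neg_zero]⟩

lemma IsGradedBlock.smul_one {m : Type*} [DecidableEq m] {u : MvPolynomial (Fin 5) k} {a b d : ℕ}
    (hu : u.IsHomogeneous d) (hd : b = a + d) :
    IsGradedBlock (fun _ => a) (fun _ => b) (u • (1 : Matrix m m (MvPolynomial (Fin 5) k))) := by
  refine .of_isHomogeneous (fun i j => ?_) hd
  rw [Matrix.smul_apply, Matrix.one_apply]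
  split_ifs
  · rwa [smul_eq_mul, mul_one]
  · rw [smul_zero]
    exact isHomogeneous_zero _ _ _

lemma IsGradedBlock.fromBlocks {m m' l l' : Type*} {a : m → ℕ} {a' : m' → ℕ} {b : l → ℕ}
    {b' : l' → ℕ} {A : Matrix m l (MvPolynomial (Fin 5) k)} {B C D} (hA : IsGradedBlock a b A)
    (hB : IsGradedBlock a b' B) (hC : IsGradedBlock a' b C) (hD : IsGradedBlock a' b' D) :
    IsGradedBlock (Sum.elim a a') (Sum.elim b b') (Matrix.fromBlocks A B C D) := by
  rintro (i | i) (j | j)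
  exacts [hA i j, hB i j, hC i j, hD i j]

lemma IsGradedBlock.fromCols {m l l' : Type*} {a : m → ℕ} {b : l → ℕ}
    {b' : l' → ℕ} {A : Matrix m l (MvPolynomial (Fin 5) k)} {B} (hA : IsGradedBlock a b A)
    (hB : IsGradedBlock a b' B) : IsGradedBlock a (Sum.elim b b') (Matrix.fromCols A B) := by
  rintro i (j | j)
  exacts [hA i j, hB i j]

lemma IsGradedBlock.fromRows {m m' l : Type*} {a : m → ℕ} {a' : m' → ℕ} {b : l → ℕ}
    {A : Matrix m l (MvPolynomial (Fin 5) k)} {C} (hA : IsGradedBlock a b A)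
    (hC : IsGradedBlock a' b C) : IsGradedBlock (Sum.elim a a') b (Matrix.fromRows A C) := by
  rintro (i | i) j
  exacts [hA i j, hC i j]

/-- A resolution `0 → S → Sⁿ → Sⁿ → S` by matrices of forms of constant degrees, such that the
linear form `u` is regular modulo the image of the first map. -/
structure IsSelfDualResolution (D₁ : Matrix (Fin 1) (Fin n) (MvPolynomial (Fin 5) k))
    (D₂ : Matrix (Fin n) (Fin n) (MvPolynomial (Fin 5) k))
    (D₃ : Matrix (Fin n) (Fin 1) (MvPolynomial (Fin 5) k)) (u : MvPolynomial (Fin 5) k)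
    (p q r : ℕ) : Prop where
  hom₁ : ∀ i j, (D₁ i j).IsHomogeneous p
  hom₂ : ∀ i j, (D₂ i j).IsHomogeneous q
  hom₃ : ∀ i j, (D₃ i j).IsHomogeneous r
  hom : u.IsHomogeneous 1
  mul₁ : D₁ * D₂ = 0
  mul₂ : D₂ * D₃ = 0
  exact₁ : ∀ v, D₁.mulVec v = 0 → ∃ w, D₂.mulVec w = v
  exact₂ : ∀ v, D₂.mulVec v = 0 → ∃ w, D₃.mulVec w = v
  injective : ∀ v, D₃.mulVec v = 0 → v = 0
  regular : ∀ v w, D₁.mulVec v = u • w → ∃ v', D₁.mulVec v' = w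

lemma smul_one_mulVec {m R : Type*} [Fintype m] [DecidableEq m] [CommRing R] (u : R) (v : m → R) :
    (u • (1 : Matrix m m R)).mulVec v = u • v := by
  rw [Matrix.smul_mulVec, Matrix.one_mulVec]

lemma exact_mulVecLin {l m p R : Type*} [Fintype m] [Fintype p] [CommRing R] {M : Matrix l m R}
    {N : Matrix m p R} (h : M * N = 0) (hex : ∀ v, M.mulVec v = 0 → ∃ w, N.mulVec w = v) :
    Function.Exact N.mulVecLin M.mulVecLin := by
  intro v
  simp only [Matrix.mulVecLin_apply, Set.mem_range]
  refine ⟨hex v, ?_⟩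
  rintro ⟨w, rfl⟩
  rw [Matrix.mulVec_mulVec, h, Matrix.zero_mulVec]

lemma exact_mulVecLin_submatrix {l m p l' m' p' R : Type*} [Fintype m] [Fintype p] [Fintype m']
    [Fintype p'] [CommRing R] {M : Matrix l m R} {N : Matrix m p R} (h : M * N = 0)
    (hex : ∀ v, M.mulVec v = 0 → ∃ w, N.mulVec w = v) (e₁ : l' ≃ l) (e₂ : m' ≃ m) (e₃ : p' ≃ p) :
    Function.Exact (N.submatrix e₂ e₃).mulVecLin (M.submatrix e₁ e₂).mulVecLin := by
  refine exact_mulVecLin (by rw [Matrix.submatrix_mul_equiv, h]; rfl) fun v hv => ?_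
  rw [Matrix.submatrix_mulVec_equiv] at hv
  obtain ⟨w, hw⟩ := hex (v ∘ e₂.symm) (by
    ext i
    simpa using congrFun hv (e₁.symm i))
  refine ⟨w ∘ e₃, ?_⟩
  rw [Matrix.submatrix_mulVec_equiv]
  ext i
  simpa [Function.comp_assoc] using congrFun hw (e₂ i)

namespace IsSelfDualResolution

variable {D₁ : Matrix (Fin 1) (Fin n) (MvPolynomial (Fin 5) k)}
    {D₂ : Matrix (Fin n) (Fin n) (MvPolynomial (Fin 5) k)}
    {D₃ : Matrix (Fin n) (Fin 1) (MvPolynomial (Fin 5) k)} {u : MvPolynomial (Fin 5) k}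
    {p q r : ℕ}

/-- The first map of the tensor product with the Koszul complex of `u`. -/
noncomputable def cone₁ (D₁ : Matrix (Fin 1) (Fin n) (MvPolynomial (Fin 5) k)) (u : MvPolynomial (Fin 5) k) :
    Matrix (Fin 1) (Fin n ⊕ Fin 1) (MvPolynomial (Fin 5) k) :=
  Matrix.fromCols D₁ (u • 1)

/-- The second map of the tensor product with the Koszul complex of `u`. -/
noncomputable def cone₂ (D₁ : Matrix (Fin 1) (Fin n) (MvPolynomial (Fin 5) k))
    (D₂ : Matrix (Fin n) (Fin n) (MvPolynomial (Fin 5) k)) (u : MvPolynomial (Fin 5) k) :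
    Matrix (Fin n ⊕ Fin 1) (Fin n ⊕ Fin n) (MvPolynomial (Fin 5) k) :=
  Matrix.fromBlocks D₂ (u • 1) 0 (-D₁)

/-- The third map of the tensor product with the Koszul complex of `u`. -/
noncomputable def cone₃ (D₂ : Matrix (Fin n) (Fin n) (MvPolynomial (Fin 5) k))
    (D₃ : Matrix (Fin n) (Fin 1) (MvPolynomial (Fin 5) k)) (u : MvPolynomial (Fin 5) k) :
    Matrix (Fin n ⊕ Fin n) (Fin n ⊕ Fin 1) (MvPolynomial (Fin 5) k) :=
  Matrix.fromBlocks (-(u • 1)) D₃ D₂ 0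

/-- The last map of the tensor product with the Koszul complex of `u`. -/
noncomputable def cone₄ (D₃ : Matrix (Fin n) (Fin 1) (MvPolynomial (Fin 5) k)) (u : MvPolynomial (Fin 5) k) :
    Matrix (Fin n ⊕ Fin 1) (Fin 1) (MvPolynomial (Fin 5) k) :=
  Matrix.fromRows D₃ (u • 1)

lemma cone₁_mul_cone₂ (h : IsSelfDualResolution D₁ D₂ D₃ u p q r) :
    cone₁ D₁ u * cone₂ D₁ D₂ u = 0 := by
  rw [cone₁, cone₂, Matrix.fromCols_mul_fromBlocks, h.mul₁]
  ext i (j | j) <;> simp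

lemma cone₂_mul_cone₃ (h : IsSelfDualResolution D₁ D₂ D₃ u p q r) :
    cone₂ D₁ D₂ u * cone₃ D₂ D₃ u = 0 := by
  rw [cone₂, cone₃, Matrix.fromBlocks_multiply, h.mul₂, Matrix.neg_mul, h.mul₁]
  ext (i | i) (j | j) <;> simp

lemma cone₃_mul_cone₄ (h : IsSelfDualResolution D₁ D₂ D₃ u p q r) :
    cone₃ D₂ D₃ u * cone₄ D₃ u = 0 := by
  rw [cone₃, cone₄, Matrix.fromBlocks_mul_fromRows, h.mul₂]
  ext (i | i) j <;> simp

lemma sum_eq_zero_iff {m m' R : Type*} [Zero R] {a : m → R} {b : m' → R} :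
    Sum.elim a b = 0 ↔ a = 0 ∧ b = 0 := by
  rw [← Sum.elim_zero_zero, Sum.elim_eq_iff]

/-- This is the only place of the complex where the regularity of u on the cokernel of `D₁` enters;
further on, exactness of the original resolution is enough. -/
lemma exists_cone₂_mulVec (h : IsSelfDualResolution D₁ D₂ D₃ u p q r)
    {v : Fin n ⊕ Fin 1 → MvPolynomial (Fin 5) k} (hv : (cone₁ D₁ u).mulVec v = 0) :
    ∃ w, (cone₂ D₁ D₂ u).mulVec w = v := by
  rw [cone₁, Matrix.fromCols_mulVec, smul_one_mulVec] at hv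
  obtain ⟨c, hc⟩ := h.regular (-(v ∘ Sum.inl)) (v ∘ Sum.inr) (by
    rw [Matrix.mulVec_neg]; exact neg_eq_of_add_eq_zero_right hv)
  obtain ⟨e, he⟩ := h.exact₁ (v ∘ Sum.inl + u • c) (by
    rw [Matrix.mulVec_add, Matrix.mulVec_smul, hc, hv])
  refine ⟨Sum.elim e (-c), ?_⟩
  rw [cone₂, Matrix.fromBlocks_mulVec, Sum.elim_comp_inl, Sum.elim_comp_inr, he, smul_one_mulVec,
    Matrix.zero_mulVec, zero_add, Matrix.neg_mulVec, Matrix.mulVec_neg, neg_neg, hc, smul_neg,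
    add_neg_cancel_right, Sum.elim_comp_inl_inr]

lemma exists_cone₃_mulVec (h : IsSelfDualResolution D₁ D₂ D₃ u p q r)
    {v : Fin n ⊕ Fin n → MvPolynomial (Fin 5) k} (hv : (cone₂ D₁ D₂ u).mulVec v = 0) :
    ∃ w, (cone₃ D₂ D₃ u).mulVec w = v := by
  rw [cone₂, Matrix.fromBlocks_mulVec, sum_eq_zero_iff, smul_one_mulVec, Matrix.zero_mulVec,
    zero_add, Matrix.neg_mulVec, neg_eq_zero] at hv
  obtain ⟨e, he⟩ := h.exact₁ _ hv.2
  obtain ⟨g, hg⟩ := h.exact₂ (v ∘ Sum.inl + u • e) (by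
    rw [Matrix.mulVec_add, Matrix.mulVec_smul, he, hv.1])
  refine ⟨Sum.elim e g, ?_⟩
  rw [cone₃, Matrix.fromBlocks_mulVec, Sum.elim_comp_inl, Sum.elim_comp_inr, he, hg,
    Matrix.neg_mulVec, smul_one_mulVec, Matrix.zero_mulVec, add_zero, add_comm (v ∘ Sum.inl),
    neg_add_cancel_left, Sum.elim_comp_inl_inr]

lemma exists_cone₄_mulVec (h : IsSelfDualResolution D₁ D₂ D₃ u p q r)
    {v : Fin n ⊕ Fin 1 → MvPolynomial (Fin 5) k} (hv : (cone₃ D₂ D₃ u).mulVec v = 0) :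
    ∃ w, (cone₄ D₃ u).mulVec w = v := by
  rw [cone₃, Matrix.fromBlocks_mulVec, sum_eq_zero_iff, Matrix.neg_mulVec, smul_one_mulVec,
    Matrix.zero_mulVec, add_zero] at hv
  obtain ⟨e, he⟩ := h.exact₂ _ hv.2
  have hg := h.injective (v ∘ Sum.inr - u • e) (by
    rw [Matrix.mulVec_sub, Matrix.mulVec_smul, he, sub_eq_neg_add, hv.1])
  refine ⟨e, ?_⟩
  rw [cone₄, Matrix.fromRows_mulVec, he, smul_one_mulVec, ← sub_eq_zero.1 hg,
    Sum.elim_comp_inl_inr]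

lemma eq_zero_of_cone₄_mulVec (h : IsSelfDualResolution D₁ D₂ D₃ u p q r)
    {v : Fin 1 → MvPolynomial (Fin 5) k} (hv : (cone₄ D₃ u).mulVec v = 0) : v = 0 := by
  rw [cone₄, Matrix.fromRows_mulVec, sum_eq_zero_iff] at hv
  exact h.injective v hv.1

lemma isGradedBlock_cone₁ (h : IsSelfDualResolution D₁ D₂ D₃ u p q r) :
    IsGradedBlock (fun _ => 0) (Sum.elim (fun _ => p) fun _ => 1) (cone₁ D₁ u) :=
  .fromCols (.of_isHomogeneous h.hom₁ (zero_add p).symm) (.smul_one h.hom (zero_add 1).symm)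

lemma isGradedBlock_cone₂ (h : IsSelfDualResolution D₁ D₂ D₃ u p q r) :
    IsGradedBlock (Sum.elim (fun _ => p) fun _ => 1) (Sum.elim (fun _ => p + q) fun _ => p + 1)
      (cone₂ D₁ D₂ u) :=
  .fromBlocks (.of_isHomogeneous h.hom₂ rfl) (.smul_one h.hom rfl) .zero
    (IsGradedBlock.of_isHomogeneous h.hom₁ (add_comm p 1)).neg

lemma isGradedBlock_cone₃ (h : IsSelfDualResolution D₁ D₂ D₃ u p q r) :
    IsGradedBlock (Sum.elim (fun _ => p + q) fun _ => p + 1)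
      (Sum.elim (fun _ => p + q + 1) fun _ => p + q + r) (cone₃ D₂ D₃ u) :=
  .fromBlocks (IsGradedBlock.smul_one h.hom rfl).neg (.of_isHomogeneous h.hom₃ rfl)
    (.of_isHomogeneous h.hom₂ (add_right_comm p q 1)) .zero

lemma isGradedBlock_cone₄ (h : IsSelfDualResolution D₁ D₂ D₃ u p q r) :
    IsGradedBlock (Sum.elim (fun _ => p + q + 1) fun _ => p + q + r) (fun _ => p + q + r + 1)
      (cone₄ D₃ u) :=
  .fromRows (.of_isHomogeneous h.hom₃ (add_right_comm (p + q) r 1)) (.smul_one h.hom rfl)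

/-- The tensor product of a resolution with the Koszul complex of a regular linear form. -/
noncomputable def cone (h : IsSelfDualResolution D₁ D₂ D₃ u p q r)
    {I : Ideal (MvPolynomial (Fin 5) k)} (hI : Ideal.span (insert u (Set.range (D₁ 0))) = I)
    {b₁ b₂ b₃ b₄ : List ℕ}
    (e₁ : Fin b₁.length ≃ Fin n ⊕ Fin 1) (e₂ : Fin b₂.length ≃ Fin n ⊕ Fin n)
    (e₃ : Fin b₃.length ≃ Fin n ⊕ Fin 1) (e₄ : Fin b₄.length ≃ Fin 1)
    (h₁ : ∀ i, b₁.get i = Sum.elim (fun _ => p) (fun _ => 1) (e₁ i))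
    (h₂ : ∀ i, b₂.get i = Sum.elim (fun _ => p + q) (fun _ => p + 1) (e₂ i))
    (h₃ : ∀ i, b₃.get i = Sum.elim (fun _ => p + q + 1) (fun _ => p + q + r) (e₃ i))
    (h₄ : ∀ i, b₄.get i = p + q + r + 1) : GradedResolution I b₁ b₂ b₃ b₄ where
  d₁ := (cone₁ D₁ u).submatrix (Equiv.refl _) e₁
  d₂ := (cone₂ D₁ D₂ u).submatrix e₁ e₂
  d₃ := (cone₃ D₂ D₃ u).submatrix e₂ e₃
  d₄ := (cone₄ D₃ u).submatrix e₃ e₄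
  graded₁ := h.isGradedBlock_cone₁.submatrix (fun _ => rfl) h₁
  graded₂ := h.isGradedBlock_cone₂.submatrix h₁ h₂
  graded₃ := h.isGradedBlock_cone₃.submatrix h₂ h₃
  graded₄ := h.isGradedBlock_cone₄.submatrix h₃ h₄
  span_d₁ := by
    rw [← hI]
    congr 1
    ext F
    constructor
    · rintro ⟨i, rfl⟩
      obtain ⟨j, rfl⟩ := e₁.symm.surjective i
      rcases j with j | j
      · exact Or.inr ⟨j, by simp [cone₁]⟩
      · exact Or.inl (by simp [cone₁, Subsingleton.elim j 0])
    · rintro (rfl | ⟨j, rfl⟩)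
      · exact ⟨e₁.symm (Sum.inr 0), by simp [cone₁]⟩
      · exact ⟨e₁.symm (Sum.inl j), by simp [cone₁]⟩
  exact₁ := exact_mulVecLin_submatrix h.cone₁_mul_cone₂ (fun _ => h.exists_cone₂_mulVec)
    (Equiv.refl _) e₁ e₂
  exact₂ := exact_mulVecLin_submatrix h.cone₂_mul_cone₃ (fun _ => h.exists_cone₃_mulVec) e₁ e₂ e₃
  exact₃ := exact_mulVecLin_submatrix h.cone₃_mul_cone₄ (fun _ => h.exists_cone₄_mulVec) e₂ e₃ e₄
  injective₄ := by
    rw [injective_iff_map_eq_zero]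
    intro v hv
    rw [Matrix.mulVecLin_apply, Matrix.submatrix_mulVec_equiv] at hv
    have h0 := h.eq_zero_of_cone₄_mulVec (v := v ∘ e₄.symm) (by
      ext1 i
      simpa using congrFun hv (e₃.symm i))
    ext1 i
    simpa using congrFun h0 (e₄ i)

end IsSelfDualResolution

end Cone

end

section

open MvPolynomial

/-! ### Deformations of the apolar quadrics and of their syzygies. -/

section DeformedQuadrics

variable {k R : Type*} [Field k] [CommRing R] [Algebra k R]

/-- A deformation with parameter `t` of the quadrics apolar to `x² + y² + z²`. -/
def deformedRow (L : Matrix (Fin 3) (Fin 5) k) (t x y z : R) : Matrix (Fin 1) (Fin 5) R :=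
  apolarRow x y z + t • (koszulRow x y z * L.map (algebraMap k R))

/-- A deformation with parameter `t` of the syzygies of the quadrics apolar to `x² + y² + z²`. -/
def deformedSyzygies (H : Matrix (Fin 5) (Fin 5) k) (t x y z : R) : Matrix (Fin 5) (Fin 5) R :=
  apolarSyzygies x y z - t • H.map (algebraMap k R)

variable {R' : Type*} [CommRing R'] [Algebra k R'] (φ : R →ₐ[k] R')

lemma map_apolarRow (x y z : R) :
    (apolarRow x y z).map φ = apolarRow (φ x) (φ y) (φ z) := by
  ext i j
  fin_cases i; fin_cases j <;> simp [apolarRow]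

lemma map_koszulRow (x y z : R) :
    (koszulRow x y z).map φ = koszulRow (φ x) (φ y) (φ z) := by
  ext i j
  fin_cases i; fin_cases j <;> simp [koszulRow]

lemma map_apolarSyzygies (x y z : R) :
    (apolarSyzygies x y z).map φ = apolarSyzygies (φ x) (φ y) (φ z) := by
  ext i j
  fin_cases i <;> fin_cases j <;> simp [apolarSyzygies]

lemma map_koszulSyzygies (x y z : R) :
    (koszulSyzygies x y z).map φ = koszulSyzygies (φ x) (φ y) (φ z) := by
  ext i j
  fin_cases i <;> fin_cases j <;> simp [koszulSyzygies]

lemma map_smul_matrix {m n : Type*} (t : R) (M : Matrix m n R) :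
    (t • M).map φ = φ t • M.map φ := by
  ext i j; simp

lemma map_add_matrix {m n : Type*} (M N : Matrix m n R) :
    (M + N).map φ = M.map φ + N.map φ := by
  ext i j; simp

lemma map_mul_matrix {m n p : Type*} [Fintype n] (M : Matrix m n R) (N : Matrix n p R) :
    (M * N).map φ = M.map φ * N.map φ := by
  ext i j; simp [Matrix.mul_apply]

lemma map_map_algebraMap {m n : Type*} (L : Matrix m n k) :
    (L.map (algebraMap k R)).map φ = L.map (algebraMap k R') := by
  ext i j; simp

lemma map_deformedRow (L : Matrix (Fin 3) (Fin 5) k) (t x y z : R) :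
    (deformedRow L t x y z).map φ = deformedRow L (φ t) (φ x) (φ y) (φ z) := by
  rw [deformedRow, deformedRow, map_add_matrix, map_apolarRow, map_smul_matrix, map_mul_matrix,
    map_koszulRow, map_map_algebraMap]

lemma map_deformedSyzygies (H : Matrix (Fin 5) (Fin 5) k) (t x y z : R) :
    (deformedSyzygies H t x y z).map φ = deformedSyzygies H (φ t) (φ x) (φ y) (φ z) := by
  rw [deformedSyzygies, deformedSyzygies, sub_eq_add_neg, ← neg_smul, map_add_matrix,
    map_apolarSyzygies, map_smul_matrix, map_map_algebraMap, map_neg, neg_smul, ← sub_eq_add_neg]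

/-- The quadrics apolar to `x² + y² + z²` satisfy no quadratic relation. -/
lemma skew_of_apolarRow (h2 : (2 : k) ≠ 0) (h3 : (3 : k) ≠ 0) {H : Matrix (Fin 5) (Fin 5) k}
    (h : ∀ x y z : k, apolarRow x y z * H * (apolarRow x y z).transpose = 0) :
    H.transpose = -H := by
  -- Evaluations at points with small integer coordinates determine the symmetric part of `H`; the
  -- only divisions are by 2 and by 6.
  have e : ∀ x y z : k, (apolarRow x y z * H * (apolarRow x y z).transpose) 0 0 = 0 :=
    fun x y z => by rw [h]; rfl
  simp only [apolarRow, Matrix.mul_apply, Fin.sum_univ_five, Matrix.transpose_apply,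
    Matrix.of_apply, Matrix.cons_val] at e
  have h6 : (6 : k) ≠ 0 := by
    rw [show (6 : k) = 2 * 3 by norm_num]; exact mul_ne_zero h2 h3
  have h4 : (4 : k) ≠ 0 := by
    rw [show (4 : k) = 2 * 2 by norm_num]; exact mul_ne_zero h2 h2
  have dd : H 3 3 = 0 := by linear_combination e 0 1 0
  have ee : H 4 4 = 0 := by linear_combination e 0 0 1
  have de : H 3 4 + H 4 3 = 0 := by linear_combination e 1 0 0 - dd - ee
  have aa : H 0 0 = 0 := (mul_eq_zero.1 (show 2 * H 0 0 = 0 by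
    linear_combination e 1 1 0 + e 1 (-1) 0 - 2 * ee)).resolve_left h2
  have ae : H 0 4 + H 4 0 = 0 := (mul_eq_zero.1 (show 2 * (H 0 4 + H 4 0) = 0 by
    linear_combination e 1 1 0 - e 1 (-1) 0)).resolve_left h2
  have bb : H 1 1 = 0 := (mul_eq_zero.1 (show 2 * H 1 1 = 0 by
    linear_combination e 1 0 1 + e 1 0 (-1) - 2 * dd)).resolve_left h2
  have bd : H 1 3 + H 3 1 = 0 := (mul_eq_zero.1 (show 2 * (H 1 3 + H 3 1) = 0 by
    linear_combination e 1 0 1 - e 1 0 (-1))).resolve_left h2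
  have cc : H 2 2 = 0 := (mul_eq_zero.1 (show 2 * H 2 2 = 0 by
    linear_combination e 0 1 1 + e 0 1 (-1) - 2 * dd - 2 * ee - 2 * de)).resolve_left h2
  have cde : H 2 3 + H 3 2 + (H 2 4 + H 4 2) = 0 :=
    (mul_eq_zero.1 (show 2 * (H 2 3 + H 3 2 + (H 2 4 + H 4 2)) = 0 by
      linear_combination e 0 1 (-1) - e 0 1 1)).resolve_left h2
  have bc : H 1 2 + H 2 1 = 0 := (mul_eq_zero.1 (show 2 * (H 1 2 + H 2 1) = 0 by
    linear_combination e 1 1 1 + e 1 1 (-1) - 2 * aa - 2 * bb - 2 * cc)).resolve_left h2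
  have ac : H 0 2 + H 2 0 = 0 := (mul_eq_zero.1 (show 2 * (H 0 2 + H 2 0) = 0 by
    linear_combination e 1 1 1 + e 1 (-1) 1 - 2 * aa - 2 * bb - 2 * cc)).resolve_left h2
  have ab : H 0 1 + H 1 0 = 0 := by
    linear_combination e 1 1 1 - aa - bb - cc - bc - ac
  have ad : H 0 3 + H 3 0 = 0 := (mul_eq_zero.1 (show 6 * (H 0 3 + H 3 0) = 0 by
    linear_combination -e 1 2 0 + 4 * aa + 9 * dd + ee + 2 * ae - 3 * de)).resolve_left h6
  have be : H 1 4 + H 4 1 = 0 := (mul_eq_zero.1 (show 6 * (H 1 4 + H 4 1) = 0 by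
    linear_combination -e 1 0 2 + 4 * bb + dd + 9 * ee + 2 * bd - 3 * de)).resolve_left h6
  have ce : H 2 4 + H 4 2 = 0 := (mul_eq_zero.1 (show 6 * (H 2 4 + H 4 2) = 0 by
    linear_combination -e 0 1 2 + 4 * cc + dd + 16 * ee + 4 * de - 2 * cde)).resolve_left h6
  have cd : H 2 3 + H 3 2 = 0 := by linear_combination cde - ce
  ext i j
  rw [Matrix.transpose_apply, Matrix.neg_apply, eq_neg_iff_add_eq_zero]
  fin_cases i <;> fin_cases j <;> simp only [Fin.zero_eta, Fin.mk_one, Fin.reduceFinMk] <;>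
    first
    | assumption
    | (rw [add_comm]; assumption)
    | simp [*]

end DeformedQuadrics

/-! ### Skew-symmetry and exactness of the deformed complex. -/

section Deformation

variable {k σ : Type*} [Field k] {o i j l : σ}

/-- Dividing the syzygy identity by x_o and then setting x_o = 0 gives KLM = qH, with K the row of
variables, q the apolar row and M its skew syzygy matrix. As M qᵀ = 0, this yields q H qᵀ = 0, and
the apolar quadrics satisfy no quadratic relation, so the symmetric part of `H` vanishes. -/
lemma deformed_isSyzygy_skew (h2 : (2 : k) ≠ 0) (h3 : (3 : k) ≠ 0)
    (hoi : o ≠ i) (hoj : o ≠ j) (hol : o ≠ l) (hij : i ≠ j) (hil : i ≠ l) (hjl : j ≠ l)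
    {L : Matrix (Fin 3) (Fin 5) k} {H : Matrix (Fin 5) (Fin 5) k}
    (hH : deformedRow L (X o : MvPolynomial σ k) (X i) (X j) (X l) *
      deformedSyzygies H (X o : MvPolynomial σ k) (X i) (X j) (X l) = 0) : H.transpose = -H := by
  have h1 : koszulRow (X i : MvPolynomial σ k) (X j) (X l) *
        L.map (algebraMap k (MvPolynomial σ k)) *
        apolarSyzygies (X i : MvPolynomial σ k) (X j) (X l) =
      deformedRow L (X o : MvPolynomial σ k) (X i) (X j) (X l) *
        H.map (algebraMap k (MvPolynomial σ k)) := by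
    rw [deformedSyzygies, Matrix.mul_sub, sub_eq_zero, Matrix.mul_smul, deformedRow,
      Matrix.add_mul, apolarRow_mul, zero_add, Matrix.smul_mul] at hH
    ext1 r s
    have := congrFun (congrFun hH r) s
    simp only [Matrix.smul_apply, smul_eq_mul] at this
    exact mul_left_cancel₀ (X_ne_zero o) this
  refine skew_of_apolarRow h2 h3 fun x y z => ?_
  classical
  let φ : MvPolynomial σ k →ₐ[k] k :=
    aeval fun s => if s = i then x else if s = j then y else if s = l then z else 0
  have hi : φ (X i) = x := by simp [φ]
  have hj : φ (X j) = y := by simp [φ, hij.symm]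
  have hl : φ (X l) = z := by simp [φ, hil.symm, hjl.symm]
  have ho : φ (X o) = 0 := by simp [φ, hoi, hoj, hol]
  have h4 := congrArg (fun M => M.map φ) h1
  simp only [map_mul_matrix, map_koszulRow, map_map_algebraMap, map_apolarSyzygies, map_deformedRow,
    hi, hj, hl, ho] at h4
  have h5 : deformedRow L 0 x y z = apolarRow x y z := by simp [deformedRow]
  have h6 : (H.map (algebraMap k k)) = H := by ext; rfl
  rw [h5, h6] at h4
  rw [← h4, ← Matrix.transpose_transpose (apolarSyzygies x y z), apolarSyzygies_transpose,
    Matrix.mul_assoc, ← Matrix.transpose_mul, Matrix.mul_neg, apolarRow_mul]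
  simp

lemma isHomogeneous_matrix_mul {m n p : Type*} [Fintype n] {A : Matrix m n (MvPolynomial σ k)}
    {B : Matrix n p (MvPolynomial σ k)} {a b : ℕ} (hA : ∀ r s, (A r s).IsHomogeneous a)
    (hB : ∀ r s, (B r s).IsHomogeneous b) (r : m) (s : p) : ((A * B) r s).IsHomogeneous (a + b) :=
  IsHomogeneous.sum _ _ _ fun t _ => (hA r t).mul (hB t s)

lemma isHomogeneous_map_algebraMap {m n : Type*} (L : Matrix m n k) (r : m) (s : n) :
    (L.map (algebraMap k (MvPolynomial σ k)) r s).IsHomogeneous 0 :=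
  isHomogeneous_C σ (L r s)

lemma isHomogeneous_X_smul {m n : Type*} {A : Matrix m n (MvPolynomial σ k)} {a : ℕ}
    (hA : ∀ r s, (A r s).IsHomogeneous a) (r : m) (s : n) :
    (((X o : MvPolynomial σ k) • A) r s).IsHomogeneous (1 + a) :=
  (isHomogeneous_X k o).mul (hA r s)

lemma isHomogeneous_apolarRow (r s) :
    (apolarRow (X i : MvPolynomial σ k) (X j) (X l) r s).IsHomogeneous 2 := by
  have h : ∀ a b : σ, (X a * X b : MvPolynomial σ k).IsHomogeneous 2 := fun a b =>
    (isHomogeneous_X k a).mul (isHomogeneous_X k b)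
  have h' : ∀ a b : σ, (X a ^ 2 - X b ^ 2 : MvPolynomial σ k).IsHomogeneous 2 := fun a b =>
    (isHomogeneous_X_pow a 2).sub (isHomogeneous_X_pow b 2)
  fin_cases r
  fin_cases s
  exacts [h i j, h i l, h j l, h' i j, h' i l]

lemma isHomogeneous_koszulRow (r s) :
    (koszulRow (X i : MvPolynomial σ k) (X j) (X l) r s).IsHomogeneous 1 := by
  fin_cases r
  fin_cases s
  exacts [isHomogeneous_X k i, isHomogeneous_X k j, isHomogeneous_X k l]

lemma isHomogeneous_koszulSyzygies (r s) :
    (koszulSyzygies (X i : MvPolynomial σ k) (X j) (X l) r s).IsHomogeneous 1 := by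
  have h := isHomogeneous_X k (σ := σ)
  have h0 := isHomogeneous_zero σ k 1
  fin_cases r <;> fin_cases s
  exacts [h0, h l, (h j).neg, (h l).neg, h0, h i, h j, (h i).neg, h0]

lemma isHomogeneous_apolarSyzygies (r s) :
    (apolarSyzygies (X i : MvPolynomial σ k) (X j) (X l) r s).IsHomogeneous 1 := by
  have h := isHomogeneous_X k (σ := σ)
  have h0 := isHomogeneous_zero σ k 1
  fin_cases r <;> fin_cases s
  exacts [h0, (h i).neg, h j, h l, h0, h i, h0, (h l).neg, h0, (h j).neg, (h j).neg, h l, h0,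
    (h i).neg, h i, (h l).neg, h0, h i, h0, h0, h0, h j, (h i).neg, h0, h0]

lemma isHomogeneous_deformedRow (L : Matrix (Fin 3) (Fin 5) k) (r s) :
    (deformedRow L (X o : MvPolynomial σ k) (X i) (X j) (X l) r s).IsHomogeneous 2 :=
  (isHomogeneous_apolarRow r s).add (isHomogeneous_X_smul
    (isHomogeneous_matrix_mul isHomogeneous_koszulRow (isHomogeneous_map_algebraMap L)) r s)

lemma isHomogeneous_deformedSyzygies (H : Matrix (Fin 5) (Fin 5) k) (r s) :
    (deformedSyzygies H (X o : MvPolynomial σ k) (X i) (X j) (X l) r s).IsHomogeneous 1 :=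
  (isHomogeneous_apolarSyzygies r s).sub
    (isHomogeneous_X_smul (isHomogeneous_map_algebraMap H) r s)

/-- When `A` does not involve x_o, the part of v divisible by x_o already solves the equation. -/
lemma exists_mulVec_of_X_smul {m n : Type*} [Fintype n] {A : Matrix m n (MvPolynomial σ k)}
    (hA : A.map (killVars k {o}) = A) (v : n → MvPolynomial σ k) (w : m → MvPolynomial σ k)
    (h : A.mulVec v = (X o : MvPolynomial σ k) • w) : ∃ v', A.mulVec v' = w := by
  choose g hg using fun r => exists_eq_killVars_singleton (k := k) o (v r)
  have hg' : v = (fun r => killVars k {o} (v r)) + (X o : MvPolynomial σ k) • g := by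
    ext1 r; simpa using hg r
  have h1 : A.mulVec (fun r => killVars k {o} (v r)) = 0 := by
    ext1 r
    have h2 := congrArg (killVars k {o}) (congrFun h r)
    simp only [Matrix.mulVec, dotProduct, Pi.smul_apply, smul_eq_mul, map_sum, map_mul,
      killVars_X_of_mem (Set.mem_singleton o), zero_mul] at h2
    simp only [Matrix.mulVec, dotProduct, Pi.zero_apply]
    rw [← h2]
    refine Finset.sum_congr rfl fun s _ => ?_
    conv_lhs => rw [← hA]
    rfl
  refine ⟨g, ?_⟩
  rw [hg', Matrix.mulVec_add, h1, zero_add, Matrix.mulVec_smul] at h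
  ext1 r
  have := congrFun h r
  simp only [Pi.smul_apply, smul_eq_mul] at this
  exact mul_left_cancel₀ (X_ne_zero o) this

/-- With a skew middle matrix, transposing the complex gives the same complex up to sign. -/
lemma deformedSyzygies_mul_transpose {R : Type*} [CommRing R] [Algebra k R]
    {L : Matrix (Fin 3) (Fin 5) k} {H : Matrix (Fin 5) (Fin 5) k} (hskew : H.transpose = -H)
    {t x y z : R} (h : deformedRow L t x y z * deformedSyzygies H t x y z = 0) :
    deformedSyzygies H t x y z * (deformedRow L t x y z).transpose = 0 := by
  have h1 : (deformedSyzygies H t x y z).transpose = -deformedSyzygies H t x y z := by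
    rw [deformedSyzygies, Matrix.transpose_sub, apolarSyzygies_transpose, Matrix.transpose_smul,
      ← Matrix.transpose_map, hskew]
    ext r s
    simp
    ring
  rw [← Matrix.transpose_transpose (deformedSyzygies H t x y z), h1, ← Matrix.transpose_mul,
    Matrix.mul_neg, h, neg_zero, Matrix.transpose_zero]

lemma map_killVars_apolarRow (hoi : o ≠ i) (hoj : o ≠ j) (hol : o ≠ l) :
    (apolarRow (X i : MvPolynomial σ k) (X j) (X l)).map (killVars k {o}) =
      apolarRow (X i) (X j) (X l) := by
  rw [map_apolarRow, killVars_X_of_notMem (by simpa using hoi.symm),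
    killVars_X_of_notMem (by simpa using hoj.symm), killVars_X_of_notMem (by simpa using hol.symm)]

lemma map_killVars_apolarSyzygies (hoi : o ≠ i) (hoj : o ≠ j) (hol : o ≠ l) :
    (apolarSyzygies (X i : MvPolynomial σ k) (X j) (X l)).map (killVars k {o}) =
      apolarSyzygies (X i) (X j) (X l) := by
  rw [map_apolarSyzygies, killVars_X_of_notMem (by simpa using hoi.symm),
    killVars_X_of_notMem (by simpa using hoj.symm), killVars_X_of_notMem (by simpa using hol.symm)]

lemma isSelfDualResolution_koszul :
    IsSelfDualResolution (koszulRow (X 1 : MvPolynomial (Fin 5) k) (X 2) (X 3))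
      (koszulSyzygies (X 1) (X 2) (X 3)) (koszulRow (X 1) (X 2) (X 3)).transpose (X 4) 1 1 1 where
  hom₁ := isHomogeneous_koszulRow
  hom₂ := isHomogeneous_koszulSyzygies
  hom₃ r s := isHomogeneous_koszulRow s r
  hom := isHomogeneous_X k 4
  mul₁ := koszulRow_mul _ _ _
  mul₂ := koszulSyzygies_mul _ _ _
  exact₁ _ := exists_koszulSyzygies_mulVec (by decide) (by decide) (by decide)
  exact₂ _ := exists_koszulRow_transpose_mulVec (by decide)
  injective v hv := by
    have := congrFun hv 0
    simp [koszulRow, Matrix.mulVec, dotProduct] at this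
    ext1 r
    rw [Subsingleton.elim r 0, this, Pi.zero_apply]
  regular := exists_mulVec_of_X_smul (by
    rw [map_koszulRow, killVars_X_of_notMem (by decide), killVars_X_of_notMem (by decide),
      killVars_X_of_notMem (by decide)])

/-- At x₀ = 0 the complex becomes the apolar one, whose exactness lifts through
`exists_mulVec_eq_of_exact_mod`. -/
lemma isSelfDualResolution_deformed (h2 : (2 : k) ≠ 0) (h3 : (3 : k) ≠ 0)
    {L : Matrix (Fin 3) (Fin 5) k} {H : Matrix (Fin 5) (Fin 5) k}
    (hH : deformedRow L (X 0 : MvPolynomial (Fin 5) k) (X 1) (X 2) (X 3) *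
      deformedSyzygies H (X 0 : MvPolynomial (Fin 5) k) (X 1) (X 2) (X 3) = 0) :
    IsSelfDualResolution (deformedRow L (X 0 : MvPolynomial (Fin 5) k) (X 1) (X 2) (X 3))
      (deformedSyzygies H (X 0 : MvPolynomial (Fin 5) k) (X 1) (X 2) (X 3))
      (deformedRow L (X 0 : MvPolynomial (Fin 5) k) (X 1) (X 2) (X 3)).transpose (X 4) 2 1 2 where
  hom₁ := isHomogeneous_deformedRow L
  hom₂ := isHomogeneous_deformedSyzygies H
  hom₃ r s := isHomogeneous_deformedRow L s r
  hom := isHomogeneous_X k 4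
  mul₁ := hH
  mul₂ := deformedSyzygies_mul_transpose (deformed_isSyzygy_skew h2 h3 (by decide) (by decide)
    (by decide) (by decide) (by decide) (by decide) hH) hH
  exact₁ _ := exists_mulVec_eq_of_exact_mod 0 hH rfl
    (B₁ := -H.map (algebraMap k _)) (by rw [deformedSyzygies, smul_neg, sub_eq_add_neg])
    (map_killVars_apolarRow (by decide) (by decide) (by decide))
    (isHomogeneous_deformedSyzygies H)
    (fun _ => exists_apolarSyzygies_mulVec (by decide) (by decide) (by decide))
  exact₂ _ := exists_mulVec_eq_of_exact_mod 0
    (deformedSyzygies_mul_transpose (deformed_isSyzygy_skew h2 h3 (by decide) (by decide)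
    (by decide) (by decide) (by decide) (by decide) hH) hH)
    (A₁ := -H.map (algebraMap k _)) (by rw [deformedSyzygies, smul_neg, sub_eq_add_neg])
    (by rw [deformedRow, Matrix.transpose_add, Matrix.transpose_smul])
    (map_killVars_apolarSyzygies (by decide) (by decide) (by decide))
    (fun r s => isHomogeneous_deformedRow L s r)
    (fun _ => exists_apolarRow_transpose_mulVec (by decide) (by decide) (by decide))
  injective v hv := by
    -- The first quadric reduces to x₁x₂ when x₀ = 0.
    have h0 : deformedRow L (X 0 : MvPolynomial (Fin 5) k) (X 1) (X 2) (X 3) 0 0 ≠ 0 := by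
      intro h
      have := congrArg (killVars k {0}) h
      simp [deformedRow, apolarRow, killVars_X_of_mem,
        killVars_X_of_notMem (k := k) (show (1 : Fin 5) ∉ ({0} : Set (Fin 5)) by decide),
        killVars_X_of_notMem (k := k) (show (2 : Fin 5) ∉ ({0} : Set (Fin 5)) by decide)] at this
    have := congrFun hv 0
    simp only [Matrix.mulVec, dotProduct, Finset.univ_unique, Fin.default_eq_zero, Fin.isValue,
      Finset.sum_singleton, Matrix.transpose_apply, Pi.zero_apply] at this
    ext1 r
    rw [Subsingleton.elim r 0, (mul_eq_zero.1 this).resolve_left h0, Pi.zero_apply]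
  regular := exists_mulVec_of_X_smul (by
    rw [map_deformedRow, killVars_X_of_notMem (by decide), killVars_X_of_notMem (by decide),
      killVars_X_of_notMem (by decide), killVars_X_of_notMem (by decide)])

end Deformation

end

section

open MvPolynomial

/-! ### The comparison with the Koszul complex and its last map. -/

section Comparison

open IsSelfDualResolution

variable {k R : Type*} [Field k] [CommRing R] [Algebra k R]

/-- The coefficients of the apolar quadrics with respect to the coordinates. -/
def apolarCoeffs (x y z : R) : Matrix (Fin 3) (Fin 5) R :=
  !![y, z, 0, x, x; 0, 0, z, -y, 0; 0, 0, 0, 0, -z]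

/-- The comparison of the syzygies of the apolar quadrics with the Koszul syzygies. -/
def apolarComparison (y z : R) : Matrix (Fin 3) (Fin 5) R :=
  !![0, -z, 0, 0, 0; 0, 0, -z, 0, 0; 0, 0, -y, -z, z]

lemma koszulRow_mul_apolarCoeffs (x y z : R) :
    koszulRow x y z * apolarCoeffs x y z = apolarRow x y z := by
  ext r s
  fin_cases r
  fin_cases s <;> simp [koszulRow, apolarCoeffs, apolarRow, Matrix.mul_apply, Fin.sum_univ_succ] <;>
    ring

lemma koszulSyzygies_mul_apolarComparison (x y z : R) :
    koszulSyzygies x y z * apolarComparison y z = apolarCoeffs x y z * apolarSyzygies x y z := by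
  ext r s
  fin_cases r <;> fin_cases s <;>
    simp [koszulSyzygies, apolarCoeffs, apolarComparison, apolarSyzygies, Matrix.mul_apply,
      Fin.sum_univ_succ] <;> ring

/-- This identity is the source of the term -x₃² in the quadric f. -/
lemma apolarComparison_mul (x y z : R) :
    apolarComparison y z * (apolarRow x y z).transpose =
      -z ^ 2 • (koszulRow x y z).transpose := by
  ext r s
  fin_cases s
  fin_cases r <;> simp [apolarComparison, apolarRow, koszulRow, Matrix.mul_apply,
    Fin.sum_univ_succ] <;> ring

/-- The lift of the coefficients of the apolar quadrics to the deformed quadrics. -/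
def deformedCoeffs (L : Matrix (Fin 3) (Fin 5) k) (t x y z : R) : Matrix (Fin 3) (Fin 5) R :=
  apolarCoeffs x y z + t • L.map (algebraMap k R)

/-- The lift of the comparison of syzygies to the deformed quadrics. -/
def deformedComparison (N : Matrix (Fin 3) (Fin 5) k) (t y z : R) : Matrix (Fin 3) (Fin 5) R :=
  apolarComparison y z + t • N.map (algebraMap k R)

lemma koszulRow_mul_deformedCoeffs (L : Matrix (Fin 3) (Fin 5) k) (t x y z : R) :
    koszulRow x y z * deformedCoeffs L t x y z = deformedRow L t x y z := by
  rw [deformedCoeffs, deformedRow, Matrix.mul_add, koszulRow_mul_apolarCoeffs, Matrix.mul_smul]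

variable {R' : Type*} [CommRing R'] [Algebra k R'] (φ : R →ₐ[k] R')

lemma map_deformedCoeffs (L : Matrix (Fin 3) (Fin 5) k) (t x y z : R) :
    (deformedCoeffs L t x y z).map φ = deformedCoeffs L (φ t) (φ x) (φ y) (φ z) := by
  rw [deformedCoeffs, deformedCoeffs, map_add_matrix, map_smul_matrix, map_map_algebraMap]
  congr 1
  ext r s
  fin_cases r <;> fin_cases s <;> simp [apolarCoeffs]

lemma map_deformedComparison (N : Matrix (Fin 3) (Fin 5) k) (t y z : R) :
    (deformedComparison N t y z).map φ = deformedComparison N (φ t) (φ y) (φ z) := by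
  rw [deformedComparison, deformedComparison, map_add_matrix, map_smul_matrix, map_map_algebraMap]
  congr 1
  ext r s
  fin_cases r <;> fin_cases s <;> simp [apolarComparison]

variable {σ : Type*} {o i j l : σ}

lemma isHomogeneous_deformedCoeffs (L : Matrix (Fin 3) (Fin 5) k) (r s) :
    (deformedCoeffs L (X o : MvPolynomial σ k) (X i) (X j) (X l) r s).IsHomogeneous 1 := by
  refine IsHomogeneous.add ?_ (isHomogeneous_X_smul (isHomogeneous_map_algebraMap L) r s)
  have h := isHomogeneous_X k (σ := σ)
  have h0 := isHomogeneous_zero σ k 1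
  fin_cases r <;> fin_cases s
  exacts [h j, h l, h0, h i, h i, h0, h0, h l, (h j).neg, h0, h0, h0, h0, h0, (h l).neg]

lemma isHomogeneous_deformedComparison (N : Matrix (Fin 3) (Fin 5) k) (r s) :
    (deformedComparison N (X o : MvPolynomial σ k) (X j) (X l) r s).IsHomogeneous 1 := by
  refine IsHomogeneous.add ?_ (isHomogeneous_X_smul (isHomogeneous_map_algebraMap N) r s)
  have h := isHomogeneous_X k (σ := σ)
  have h0 := isHomogeneous_zero σ k 1
  fin_cases r <;> fin_cases s
  exacts [h0, (h l).neg, h0, h0, h0, h0, h0, (h l).neg, h0, h0, h0, h0, (h j).neg, (h l).neg, h l]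

/-- A solution of a homogeneous system can be replaced by its component of the expected degree. -/
lemma mulVec_homogeneousComponent {m n : Type*} [Fintype n] {A : Matrix m n (MvPolynomial σ k)}
    {a t : ℕ} (hA : ∀ r s, (A r s).IsHomogeneous a) {v : n → MvPolynomial σ k}
    {w : m → MvPolynomial σ k} (hw : ∀ r, (w r).IsHomogeneous (a + t)) (h : A.mulVec v = w) :
    A.mulVec (fun s => homogeneousComponent t (v s)) = w := by
  ext1 r
  rw [← homogeneousComponent_of_mem (hw r) |>.trans (if_pos rfl), ← h]
  simp only [Matrix.mulVec, dotProduct, map_sum]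
  exact Finset.sum_congr rfl fun s _ => (homogeneousComponent_mul_of_isHomogeneous (hA r s) _ _).symm

/-- The comparison of syzygies of the apolar quadrics lifts to the deformed quadrics. -/
lemma exists_deformedComparison (hij : i ≠ j) (hil : i ≠ l) (hjl : j ≠ l)
    {L : Matrix (Fin 3) (Fin 5) k} {H : Matrix (Fin 5) (Fin 5) k}
    (hH : deformedRow L (X o : MvPolynomial σ k) (X i) (X j) (X l) *
      deformedSyzygies H (X o : MvPolynomial σ k) (X i) (X j) (X l) = 0) :
    ∃ N : Matrix (Fin 3) (Fin 5) k,
      koszulSyzygies (X i : MvPolynomial σ k) (X j) (X l) * deformedComparison N (X o : MvPolynomial σ k) (X j) (X l) =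
        deformedCoeffs L (X o : MvPolynomial σ k) (X i) (X j) (X l) *
          deformedSyzygies H (X o : MvPolynomial σ k) (X i) (X j) (X l) := by
  set W : Matrix (Fin 3) (Fin 5) (MvPolynomial σ k) :=
    L.map (algebraMap k (MvPolynomial σ k)) * deformedSyzygies H (X o : MvPolynomial σ k) (X i) (X j) (X l) -
      apolarCoeffs (X i : MvPolynomial σ k) (X j) (X l) * H.map (algebraMap k (MvPolynomial σ k)) with hW
  have hexp : deformedCoeffs L (X o : MvPolynomial σ k) (X i) (X j) (X l) *
      deformedSyzygies H (X o : MvPolynomial σ k) (X i) (X j) (X l) =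
      koszulSyzygies (X i : MvPolynomial σ k) (X j) (X l) * apolarComparison (X j : MvPolynomial σ k) (X l) +
        (X o : MvPolynomial σ k) • W := by
    rw [koszulSyzygies_mul_apolarComparison, deformedCoeffs, hW, Matrix.add_mul, smul_sub,
      Matrix.smul_mul]
    conv_lhs => rw [deformedSyzygies, Matrix.mul_sub, Matrix.mul_smul]
    rw [← deformedSyzygies]
    abel
  -- The defect of the undeformed comparison is x_o W, and W is a cycle of the Koszul complex
  -- because the other terms of the identity are.
  have hKW : koszulRow (X i : MvPolynomial σ k) (X j) (X l) * W = 0 := by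
    have h := hH
    rw [← koszulRow_mul_deformedCoeffs, Matrix.mul_assoc, hexp, Matrix.mul_add, ← Matrix.mul_assoc,
      koszulRow_mul, Matrix.zero_mul, zero_add, Matrix.mul_smul] at h
    ext1 r s
    have := congrFun (congrFun h r) s
    simp only [Matrix.smul_apply, smul_eq_mul, Matrix.zero_apply] at this
    exact (mul_eq_zero.1 this).resolve_left (X_ne_zero o)
  have hWhom : ∀ r s, (W r s).IsHomogeneous (1 + 0) := by
    intro r s
    refine IsHomogeneous.sub ?_ ?_
    · exact isHomogeneous_matrix_mul (isHomogeneous_map_algebraMap L)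
        (isHomogeneous_deformedSyzygies H) r s
    · refine isHomogeneous_matrix_mul (fun r s => ?_) (isHomogeneous_map_algebraMap H) r s
      simpa [deformedCoeffs] using isHomogeneous_deformedCoeffs (o := i) (i := i) (j := j) (l := l)
        (0 : Matrix (Fin 3) (Fin 5) k) r s
  choose w hw using fun s => exists_koszulSyzygies_mulVec hij hil hjl
    (v := fun r => W r s) (funext fun r => congrFun (congrFun hKW r) s)
  -- Both W and the Koszul syzygies are linear, so the lift may be taken with constant entries;
  -- these form N.
  have hw' := fun s => mulVec_homogeneousComponent (isHomogeneous_koszulSyzygies)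
    (fun r => hWhom r s) (hw s)
  refine ⟨Matrix.of fun r s => coeff 0 (w s r), ?_⟩
  rw [hexp, deformedComparison, Matrix.mul_add, Matrix.mul_smul]
  congr 2
  ext1 r s
  rw [← congrFun (hw' s) r]
  simp only [Matrix.mul_apply, Matrix.mulVec, dotProduct, homogeneousComponent_zero]
  rfl

/-- The last map of the comparison of the deformed complex with the Koszul complex. -/
lemma exists_lastMap (hij : i ≠ j)
    {L N : Matrix (Fin 3) (Fin 5) k} {H : Matrix (Fin 5) (Fin 5) k}
    (hH : deformedSyzygies H (X o : MvPolynomial σ k) (X i) (X j) (X l) *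
      (deformedRow L (X o : MvPolynomial σ k) (X i) (X j) (X l)).transpose = 0)
    (hN : koszulSyzygies (X i : MvPolynomial σ k) (X j) (X l) *
        deformedComparison N (X o : MvPolynomial σ k) (X j) (X l) =
      deformedCoeffs L (X o : MvPolynomial σ k) (X i) (X j) (X l) *
        deformedSyzygies H (X o : MvPolynomial σ k) (X i) (X j) (X l)) :
    ∃ g : MvPolynomial σ k, g.IsHomogeneous 1 ∧
      deformedComparison N (X o : MvPolynomial σ k) (X j) (X l) *
        (deformedRow L (X o : MvPolynomial σ k) (X i) (X j) (X l)).transpose =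
      (-X l ^ 2 + X o * g : MvPolynomial σ k) • (koszulRow (X i : MvPolynomial σ k) (X j) (X l)).transpose := by
  set D := deformedRow L (X o : MvPolynomial σ k) (X i) (X j) (X l) with hD
  set W : Matrix (Fin 3) (Fin 1) (MvPolynomial σ k) :=
    N.map (algebraMap k (MvPolynomial σ k)) * D.transpose + apolarComparison (X j : MvPolynomial σ k) (X l) *
      (koszulRow (X i : MvPolynomial σ k) (X j) (X l) * L.map (algebraMap k (MvPolynomial σ k))).transpose with hW
  have hexp : deformedComparison N (X o : MvPolynomial σ k) (X j) (X l) * D.transpose =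
      (-X l ^ 2 : MvPolynomial σ k) • (koszulRow (X i : MvPolynomial σ k) (X j) (X l)).transpose +
        (X o : MvPolynomial σ k) • W := by
    rw [← apolarComparison_mul, deformedComparison, hW, Matrix.add_mul, smul_add, Matrix.smul_mul]
    conv_lhs => enter [1]; rw [hD, deformedRow, Matrix.transpose_add, Matrix.mul_add,
      Matrix.transpose_smul, Matrix.mul_smul]
    abel
  -- Again the defect W is a Koszul cycle, now of degree 2; it is therefore the column of variables
  -- times a linear form, which is the correction g.
  have hKW : koszulSyzygies (X i : MvPolynomial σ k) (X j) (X l) * W = 0 := by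
    have h : koszulSyzygies (X i : MvPolynomial σ k) (X j) (X l) *
        (deformedComparison N (X o : MvPolynomial σ k) (X j) (X l) * D.transpose) = 0 := by
      rw [← Matrix.mul_assoc, hN, Matrix.mul_assoc, hH, Matrix.mul_zero]
    rw [hexp, Matrix.mul_add, Matrix.mul_smul, koszulSyzygies_mul, smul_zero, zero_add,
      Matrix.mul_smul] at h
    ext1 r s
    have := congrFun (congrFun h r) s
    simp only [Matrix.smul_apply, smul_eq_mul, Matrix.zero_apply] at this
    exact (mul_eq_zero.1 this).resolve_left (X_ne_zero o)
  have hWhom : ∀ r s, (W r s).IsHomogeneous (1 + 1) := by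
    intro r s
    refine IsHomogeneous.add ?_ ?_
    · exact isHomogeneous_matrix_mul (isHomogeneous_map_algebraMap N)
        (fun r s => isHomogeneous_deformedRow L s r) r s
    · refine isHomogeneous_matrix_mul (fun r s => ?_) (fun r s => isHomogeneous_matrix_mul
        isHomogeneous_koszulRow (isHomogeneous_map_algebraMap L) s r) r s
      simpa [deformedComparison] using isHomogeneous_deformedComparison (o := j) (j := j) (l := l)
        (0 : Matrix (Fin 3) (Fin 5) k) r s
  obtain ⟨w, hw⟩ := exists_koszulRow_transpose_mulVec hij
    (v := fun r => W r 0) (funext fun r => congrFun (congrFun hKW r) 0)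
  have hw' := mulVec_homogeneousComponent (fun r s => isHomogeneous_koszulRow s r)
    (fun r => hWhom r 0) hw
  refine ⟨homogeneousComponent 1 (w 0), homogeneousComponent_isHomogeneous _ _, ?_⟩
  have hWg : W = homogeneousComponent 1 (w 0) •
      (koszulRow (X i : MvPolynomial σ k) (X j) (X l)).transpose := by
    ext1 r s
    rw [Subsingleton.elim s 0, ← congrFun hw' r, Matrix.smul_apply, smul_eq_mul]
    rw [mul_comm]
    exact Finset.sum_singleton _ _
  rw [hexp, add_smul, mul_smul, ← hWg]

lemma submatrix_mul_eq {m n p m' n' p' R : Type*} [Fintype n] [Fintype n'] [CommRing R]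
    {M : Matrix m n R} {N : Matrix n p R} {P : Matrix m p R} (h : M * N = P) (e₁ : m' ≃ m)
    (e₂ : n' ≃ n) (e₃ : p' ≃ p) :
    M.submatrix e₁ e₂ * N.submatrix e₂ e₃ = P.submatrix e₁ e₃ := by
  rw [Matrix.submatrix_mul_equiv, h]

lemma inclHyperplane_X (i : Fin 4) : inclHyperplane k (X i) = X i.castSucc :=
  rename_X _ _

/-- The identity of `exists_lastMap` plays two roles: it makes the last square commute, and read row
by row it writes each xᵢ f with i = 1, 2, 3 as a combination of the quadrics. -/
theorem exists_isLastComparison (h2 : (2 : k) ≠ 0) (h3 : (3 : k) ≠ 0)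
    {L : Matrix (Fin 3) (Fin 5) k} {H : Matrix (Fin 5) (Fin 5) k}
    (hH : deformedRow L (X 0 : MvPolynomial (Fin 4) k) (X 1) (X 2) (X 3) *
      deformedSyzygies H (X 0 : MvPolynomial (Fin 4) k) (X 1) (X 2) (X 3) = 0) :
    ∃ g : MvPolynomial (Fin 4) k, g.IsHomogeneous 1 ∧
      (∀ i : Fin 3, X i.succ * (-X 3 ^ 2 + X 0 * g) ∈ Ideal.span (Set.range
        (deformedRow L (X 0 : MvPolynomial (Fin 4) k) (X 1) (X 2) (X 3) 0))) ∧
      IsLastComparison (Ideal.span (insert (X 4) (Set.range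
        (deformedRow L (X 0 : MvPolynomial (Fin 5) k) (X 1) (X 2) (X 3) 0)))) (idealP k)
        (inclHyperplane k (-X 3 ^ 2 + X 0 * g)) := by
  obtain ⟨N, hN⟩ := exists_deformedComparison (by decide) (by decide) (by decide) hH
  have hH' := deformedSyzygies_mul_transpose (deformed_isSyzygy_skew h2 h3 (by decide) (by decide)
    (by decide) (by decide) (by decide) (by decide) hH) hH
  obtain ⟨g, hg, hgN⟩ := exists_lastMap (by decide) hH' hN
  refine ⟨g, hg, fun i => ?_, ?_⟩
  · have h := congrFun (congrFun hgN i) 0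
    have h' : (koszulRow (X 1 : MvPolynomial (Fin 4) k) (X 2) (X 3)).transpose i 0 = X i.succ := by
      fin_cases i <;> rfl
    rw [Matrix.smul_apply, smul_eq_mul, h', mul_comm, Matrix.mul_apply] at h
    rw [← h]
    exact Ideal.sum_mem _ fun j _ => Ideal.mul_mem_left _ _ (Ideal.subset_span ⟨j, rfl⟩)
  set f := (-X 3 ^ 2 + X 0 * g : MvPolynomial (Fin 4) k) with hf
  have hfhom : (inclHyperplane k f).IsHomogeneous 2 := by
    refine IsHomogeneous.rename_isHomogeneous (IsHomogeneous.add ?_ ?_)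
    · exact (isHomogeneous_X_pow 3 2).neg
    · exact (isHomogeneous_X k 0).mul hg
  have h0 : inclHyperplane k (X 0) = X 0 := inclHyperplane_X 0
  have h1 : inclHyperplane k (X 1) = X 1 := inclHyperplane_X 1
  have h2' : inclHyperplane k (X 2) = X 2 := inclHyperplane_X 2
  have h3' : inclHyperplane k (X 3) = X 3 := inclHyperplane_X 3
  have kH := congrArg (fun M => M.map (inclHyperplane k)) hH
  have kN := congrArg (fun M => M.map (inclHyperplane k)) hN
  have kg := congrArg (fun M => M.map (inclHyperplane k)) hgN
  simp only [map_mul_matrix, map_smul_matrix, Matrix.transpose_map, map_koszulRow,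
    map_koszulSyzygies, map_deformedRow, map_deformedSyzygies, map_deformedCoeffs,
    map_deformedComparison, h0, h1, h2', h3'] at kH kN kg
  rw [Matrix.map_zero _ (map_zero _)] at kH
  have hF := isSelfDualResolution_deformed h2 h3 kH
  have hK := isSelfDualResolution_koszul (k := k)
  have hspan : Ideal.span (insert (X 4) (Set.range
      (koszulRow (X 1 : MvPolynomial (Fin 5) k) (X 2) (X 3) 0))) = idealP k := by
    rw [idealP]
    congr 1
    ext F
    simp only [koszulRow, Set.mem_insert_iff, Set.mem_range, Fin.exists_fin_succ, Set.mem_singleton_iff]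
    simp [eq_comm, or_comm, or_assoc]
  have hspanF : Ideal.span (insert (X 4) (Set.range
      (deformedRow L (X 0 : MvPolynomial (Fin 5) k) (X 1) (X 2) (X 3) 0))) = _ := rfl
  let e : ∀ n, Fin (n + 1) ≃ Fin n ⊕ Fin 1 := fun n => finSumFinEquiv.symm
  let e' : ∀ n, Fin (n + n) ≃ Fin n ⊕ Fin n := fun n => finSumFinEquiv.symm
  let β₁ := deformedCoeffs L (X 0 : MvPolynomial (Fin 5) k) (X 1) (X 2) (X 3)
  let β₂ := deformedComparison N (X 0 : MvPolynomial (Fin 5) k) (X 2) (X 3)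
  let β₃ : Matrix (Fin 1) (Fin 1) (MvPolynomial (Fin 5) k) := inclHyperplane k f • 1
  have hβ₁ := isHomogeneous_deformedCoeffs (o := 0) (i := 1) (j := 2) (l := (3 : Fin 5)) L
  have hβ₂ := isHomogeneous_deformedComparison (o := 0) (j := 2) (l := (3 : Fin 5)) N
  -- Both resolutions are tensor products with the Koszul complex of x₄, so the comparison in three
  -- variables is tensored with the identity of that complex; hence the block diagonal matrices.
  refine ⟨hF.cone (b₁ := [2, 2, 2, 2, 2, 1]) (b₂ := [3, 3, 3, 3, 3, 3, 3, 3, 3, 3])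
      (b₃ := [4, 4, 4, 4, 4, 5]) (b₄ := [6]) hspanF (e 5) (e' 5) (e 5) (Equiv.refl _)
      (by decide) (by decide) (by decide) (by decide),
    hK.cone (b₁ := [1, 1, 1, 1]) (b₂ := [2, 2, 2, 2, 2, 2])
      (b₃ := [3, 3, 3, 3]) (b₄ := [4]) hspan (e 3) (e' 3) (e 3) (Equiv.refl _)
      (by decide) (by decide) (by decide) (by decide),
    (Matrix.fromBlocks β₁ 0 0 1).submatrix (e 3) (e 5),
    (Matrix.fromBlocks β₂ 0 0 β₁).submatrix (e' 3) (e' 5),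
    (Matrix.fromBlocks β₂ 0 0 β₃).submatrix (e 3) (e 5),
    β₃.submatrix (Equiv.refl _) (Equiv.refl _), ?_, ?_, ?_, ?_, ?_, ?_, ?_, ?_, ?_⟩
  · exact (IsGradedBlock.fromBlocks (a := fun _ => 1) (a' := fun _ => 1) (b := fun _ => 2)
      (b' := fun _ => 1) (.of_isHomogeneous hβ₁ rfl) .zero .zero
      (by simpa using IsGradedBlock.smul_one (u := 1) (isHomogeneous_one _ _) rfl)).submatrix
      (by decide) (by decide)
  · exact (IsGradedBlock.fromBlocks (a := fun _ => 2) (a' := fun _ => 2) (b := fun _ => 3)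
      (b' := fun _ => 3) (.of_isHomogeneous hβ₂ rfl) .zero .zero
      (.of_isHomogeneous hβ₁ rfl)).submatrix (by decide) (by decide)
  · exact (IsGradedBlock.fromBlocks (a := fun _ => 3) (a' := fun _ => 3) (b := fun _ => 4)
      (b' := fun _ => 5) (.of_isHomogeneous hβ₂ rfl) .zero .zero
      (.smul_one hfhom rfl)).submatrix (by decide) (by decide)
  · exact (IsGradedBlock.smul_one (a := 4) hfhom rfl).submatrix (by decide) (by decide)
  · refine submatrix_mul_eq (P := cone₁ _ _) ?_ (Equiv.refl _) (e 3) (e 5)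
    rw [cone₁, cone₁, Matrix.fromCols_mul_fromBlocks, koszulRow_mul_deformedCoeffs]
    simp
  · refine (submatrix_mul_eq ?_ (e 3) (e' 3) (e' 5)).trans
      (submatrix_mul_eq rfl (e 3) (e 5) (e' 5)).symm
    rw [cone₂, cone₂, Matrix.fromBlocks_multiply, Matrix.fromBlocks_multiply, kN]
    simp [β₁, koszulRow_mul_deformedCoeffs]
  · refine (submatrix_mul_eq ?_ (e' 3) (e 3) (e 5)).trans
      (submatrix_mul_eq rfl (e' 3) (e' 5) (e 5)).symm
    rw [cone₃, cone₃, Matrix.fromBlocks_multiply, Matrix.fromBlocks_multiply, kN, kg]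
    simp [β₁, β₂, β₃]
  · refine (submatrix_mul_eq ?_ (e 3) (Equiv.refl _) (Equiv.refl _)).trans
      (submatrix_mul_eq rfl (e 3) (e 5) (Equiv.refl _)).symm
    rw [cone₄, cone₄, Matrix.fromRows_mul, Matrix.fromBlocks_mul_fromRows, kg]
    simp [β₃, smul_comm (X 4 : MvPolynomial (Fin 5) k)]
  · simp [β₃]

end Comparison

end

/-! ### Orthonormal coordinates attached to a branch element. -/

section OrthonormalData

variable {k A : Type*} [Field k] [CommRing A] [Algebra k A]

/-- Every functional is represented by multiplication with respect to a nondegenerate one. -/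
lemma exists_mul_eq_of_nondegenerate [Module.Finite k A] {φ : A →ₗ[k] k}
    (hφ : ∀ x, (∀ y, φ (x * y) = 0) → x = 0) (θ : A →ₗ[k] k) : ∃ z, ∀ x, θ x = φ (z * x) := by
  let T : A →ₗ[k] Module.Dual k A := (LinearMap.mul k A).compr₂ φ
  have hT : Function.Injective T := by
    rw [injective_iff_map_eq_zero]
    exact fun x hx => hφ x fun y => LinearMap.congr_fun hx y
  obtain ⟨z, hz⟩ := (LinearMap.injective_iff_surjective_of_finrank_eq_finrank
    (Subspace.dual_finrank_eq (K := k) (V := A)).symm).1 hT θ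
  exact ⟨z, fun x => by rw [← hz]; rfl⟩

/-- A nonzero functional vanishing on m is φ(z ·) for some z, and then φ(z m A) = 0 forces z m = 0.
-/
lemma exists_ne_zero_mul_eq_zero [Module.Finite k A] {φ : A →ₗ[k] k}
    (hφ : ∀ x, (∀ y, φ (x * y) = 0) → x = 0) {m : Ideal A} (hm : m ≠ ⊤) :
    ∃ z ≠ 0, ∀ x ∈ m, z * x = 0 := by
  have hm' : m.restrictScalars k < ⊤ := by
    rw [lt_top_iff_ne_top]
    exact fun h => hm (by ext x; exact ⟨fun _ => trivial, fun _ => by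
      change x ∈ m.restrictScalars k; rw [h]; trivial⟩)
  obtain ⟨θ, hθ, hle⟩ := Submodule.exists_le_ker_of_lt_top _ hm'
  obtain ⟨z, hz⟩ := exists_mul_eq_of_nondegenerate hφ θ
  refine ⟨z, ?_, fun x hx => hφ _ fun y => ?_⟩
  · rintro rfl
    exact hθ (LinearMap.ext fun x => by rw [hz]; simp)
  · rw [mul_assoc, ← hz]
    exact hle (m.mul_mem_right y hx)

/-- The functional φ(z ·) vanishes on the common kernel of φ and φ(y ·), hence is a combination of
them; nondegeneracy turns this into an identity in A. -/
lemma exists_eq_smul_add_smul {φ : A →ₗ[k] k}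
    (hφ : ∀ x, (∀ y, φ (x * y) = 0) → x = 0) {y z : A}
    (h : ∀ w, φ w = 0 → φ (y * w) = 0 → φ (z * w) = 0) : ∃ a b : k, z = a • 1 + b • y := by
  let L : Fin 2 → A →ₗ[k] k := ![φ, φ ∘ₗ LinearMap.mulLeft k y]
  have h1 : φ ∘ₗ LinearMap.mulLeft k z ∈ Submodule.span k (Set.range L) := by
    refine mem_span_of_iInf_ker_le_ker fun w hw => ?_
    rw [Submodule.mem_iInf] at hw
    exact h w (hw 0) (hw 1)
  obtain ⟨c, hc⟩ := (Submodule.mem_span_range_iff_exists_fun k).1 h1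
  refine ⟨c 0, c 1, sub_eq_zero.1 (hφ _ fun x => ?_)⟩
  have := LinearMap.congr_fun hc x
  simp [L] at this
  rw [sub_mul, add_mul, map_sub, map_add, smul_mul_assoc, smul_mul_assoc, one_mul, map_smul,
    map_smul, smul_eq_mul, smul_eq_mul, this, sub_self]

lemma exists_scalar_sub_mem [IsAlgClosed k] [Module.Finite k A] (m : Ideal A) [m.IsMaximal]
    (x : A) : ∃ c : k, x - algebraMap k A c ∈ m := by
  let := Ideal.Quotient.field m
  obtain ⟨c, hc⟩ := (IsAlgClosed.algebraMap_bijective_of_isIntegral (k := k) (K := A ⧸ m)).2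
    (Ideal.Quotient.mk m x)
  exact ⟨c, Ideal.Quotient.eq.1 hc.symm⟩

/-- The structure of an algebra with an element `y` such that `y A` is spanned by `y` and `y²`. -/
lemma exists_sub_mem_ann {y : A} (hy : ∀ x, y * x ∈ Submodule.span k {y, y * y}) (x : A) :
    ∃ c d : k, y * (x - c • 1 - d • y) = 0 := by
  obtain ⟨c, d, h⟩ := Submodule.mem_span_pair.1 (hy x)
  refine ⟨c, d, ?_⟩
  rw [mul_sub, mul_sub, mul_smul_comm, mul_smul_comm, ← h, mul_one]
  abel

lemma smul_add_smul_eq_zero {y : A} (hy : y * y ∉ Submodule.span k {y}) {c d : k}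
    (h : c • y + d • (y * y) = 0) : c = 0 ∧ d = 0 := by
  have hd : d = 0 := by
    by_contra hd
    refine hy (Submodule.mem_span_singleton.2 ⟨-(d⁻¹ * c), ?_⟩)
    have : d⁻¹ • (c • y + d • (y * y)) = 0 := by rw [h, smul_zero]
    rw [smul_add, smul_smul, smul_smul, inv_mul_cancel₀ hd, one_smul] at this
    rw [neg_smul, neg_eq_of_add_eq_zero_right this]
  rw [hd, zero_smul, add_zero] at h
  refine ⟨(smul_eq_zero.1 h).resolve_right ?_, hd⟩
  rintro rfl
  simp at hy

lemma finrank_ann [Module.Finite k A] {y : A} (hy : y * y ∉ Submodule.span k {y})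
    (hy' : ∀ x, y * x ∈ Submodule.span k {y, y * y}) :
    Module.finrank k (LinearMap.ker (LinearMap.mulLeft k y)) + 2 = Module.finrank k A := by
  have h : LinearMap.range (LinearMap.mulLeft k y) = Submodule.span k (Set.range ![y, y * y]) := by
    rw [Matrix.range_cons, Matrix.range_cons, Matrix.range_empty, Set.union_empty,
      Set.singleton_union]
    refine le_antisymm ?_ ?_
    · rintro _ ⟨x, rfl⟩
      exact hy' x
    · rw [Submodule.span_le]
      rintro _ (rfl | rfl)
      · exact ⟨1, by simp⟩
      · exact ⟨y, by simp⟩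
  have hind : LinearIndependent k ![y, y * y] := by
    rw [LinearIndependent.pair_iff]
    exact fun c d h => smul_add_smul_eq_zero hy h
  rw [← LinearMap.finrank_range_add_finrank_ker (LinearMap.mulLeft k y), h,
    finrank_span_eq_card hind, Fintype.card_fin, add_comm]

/-- A unit `w` such that the functional `φ (w · )` vanishes on `1` and `y` but not on `y²`. -/
lemma exists_unit_functional [IsAlgClosed k] [Module.Finite k A] (h4 : 4 ≤ Module.finrank k A)
    {φ : A →ₗ[k] k} (hφ : ∀ x, (∀ y, φ (x * y) = 0) → x = 0) {y : A}
    (hy : y * y ∉ Submodule.span k {y}) (hy' : ∀ x, y * x ∈ Submodule.span k {y, y * y}) :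
    ∃ w : Aˣ, φ w = 0 ∧ φ (w * y) = 0 ∧ φ (w * (y * y)) ≠ 0 := by
  classical
  have hN := finrank_ann hy hy'
  set N := LinearMap.ker (LinearMap.mulLeft k y) with hNdef
  let W : Submodule k A := LinearMap.ker φ ⊓ LinearMap.ker (φ ∘ₗ LinearMap.mulLeft k y)
  have : IsArtinianRing A := IsArtinianRing.of_finite k A
  have hfin : {m : Ideal A | m.IsMaximal}.Finite := IsArtinianRing.setOfPred_isMaximal_finite A
  let f : Ideal A → Subspace k W := fun m => (m.restrictScalars k).comap W.subtype
  let p : Subspace k W := LinearMap.ker ((φ ∘ₗ LinearMap.mulLeft k (y * y)) ∘ₗ W.subtype)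
  -- In the space W where φ(w) and φ(yw) vanish, neither a maximal ideal nor the condition φ(y²w) =
  -- 0 may contain everything; a general w then works.
  have htop : (⊤ : Subspace k W) ∉ insert p (hfin.toFinset.image f) := by
    rw [Finset.mem_insert, Finset.mem_image]
    rintro (hp | ⟨m, hm, hp⟩)
    -- Otherwise y² = a + b y; multiplying by a nonzero element killed by y gives a = 0, so y² ∈ ky.
    · obtain ⟨a, b, hab⟩ := exists_eq_smul_add_smul hφ (y := y) (z := y * y) (fun w h1 h2 => by
        have : (⟨w, h1, h2⟩ : W) ∈ p := by rw [← hp]; trivial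
        exact this)
      obtain ⟨v, hv⟩ := exists_linearIndependent_of_le_finrank (show 2 ≤ Module.finrank k N by omega)
      have h0 : y * (v 0 : A) = 0 := (v 0).2
      have h1 : a • (v 0 : A) = 0 := by
        have : y * y * (v 0 : A) = 0 := by rw [mul_assoc, h0, mul_zero]
        rwa [hab, add_mul, smul_mul_assoc, smul_mul_assoc, h0, smul_zero, add_zero, one_mul]
          at this
      have ha : a = 0 := (smul_eq_zero.1 h1).resolve_right fun h => hv.ne_zero 0 (Subtype.ext h)
      rw [ha, zero_smul, zero_add] at hab
      exact hy (Submodule.mem_span_singleton.2 ⟨b, hab.symm⟩)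
    · have hm' : m.IsMaximal := by simpa using hm
      obtain ⟨z, hz0, hz⟩ := exists_ne_zero_mul_eq_zero hφ hm'.ne_top
      obtain ⟨a, b, hab⟩ := exists_eq_smul_add_smul hφ (y := y) (z := z) (fun w h1 h2 => by
        have : (⟨w, h1, h2⟩ : W) ∈ f m := by rw [hp]; trivial
        rw [hz w this, map_zero])
      -- If W ⊆ m, the annihilator z of m is a + b y. For a = 0 it is a multiple of y, which forces
      -- y² ∈ ky. For a ≠ 0 the annihilator of y meets m trivially, although it has dimension at
      -- least 2 and m has codimension 1.
      by_cases ha : a = 0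
      · rw [ha, zero_smul, zero_add] at hab
        obtain ⟨c, hc⟩ := exists_scalar_sub_mem (k := k) m y
        have h := hz _ hc
        rw [hab, smul_mul_assoc, smul_eq_zero, mul_sub, sub_eq_zero, mul_comm y (algebraMap k A c),
          ← Algebra.smul_def] at h
        refine hy (Submodule.mem_span_singleton.2 ⟨c, (h.resolve_left ?_).symm⟩)
        rintro rfl
        exact hz0 (by rw [hab, zero_smul])
      · have hNm : ∀ n, y * n = 0 → n ∈ m → n = 0 := by
          intro n hn hnm
          have := hz n hnm
          rw [hab, add_mul, smul_mul_assoc, smul_mul_assoc, hn, smul_zero, add_zero, one_mul] at this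
          exact (smul_eq_zero.1 this).resolve_left ha
        obtain ⟨v, hv⟩ := exists_linearIndependent_of_le_finrank
          (show 2 ≤ Module.finrank k N by omega)
        have hvN : ∀ i, y * (v i : A) = 0 := fun i => (v i).2
        choose c hc using fun i => exists_scalar_sub_mem (k := k) m (v i : A)
        have h0 : c 1 • (v 0 : A) - c 0 • (v 1 : A) = 0 := by
          refine hNm _ (by simp [mul_sub, hvN]) ?_
          have : c 1 • (v 0 : A) - c 0 • (v 1 : A) = algebraMap k A (c 1) * (v 0 -
              algebraMap k A (c 0)) - algebraMap k A (c 0) * (v 1 - algebraMap k A (c 1)) := by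
            rw [Algebra.smul_def, Algebra.smul_def]; ring
          rw [this]
          exact sub_mem (m.mul_mem_left _ (hc 0)) (m.mul_mem_left _ (hc 1))
        have h1 := Fintype.linearIndependent_iff.1 hv ![c 1, -c 0] (by
          rw [Fin.sum_univ_two]
          refine Subtype.ext ?_
          simpa [sub_eq_add_neg] using h0)
        have h2 : c 0 = 0 := by simpa using h1 1
        have h3 := hc 0
        rw [h2, map_zero, sub_zero] at h3
        exact hv.ne_zero 0 (Subtype.ext (hNm _ (hvN 0) h3))
  have := Subspace.biUnion_ne_univ_of_top_notMem htop
  rw [Set.ne_univ_iff_exists_notMem] at this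
  obtain ⟨⟨w, hw1, hw2⟩, hw⟩ := this
  simp only [Finset.mem_insert, Finset.mem_image, Set.Finite.mem_toFinset, Set.mem_ofPred_eq,
    Set.mem_iUnion, not_exists, SetLike.mem_coe] at hw
  have hu : IsUnit w := by
    by_contra hu
    obtain ⟨m, hm, hwm⟩ := exists_max_ideal_of_mem_nonunits hu
    exact hw (f m) (Or.inr ⟨m, hm, rfl⟩) hwm
  obtain ⟨w, rfl⟩ := hu
  refine ⟨w, hw1, ?_, fun h => hw p (Or.inl rfl) ?_⟩
  · rw [mul_comm]; exact hw2
  · rw [mul_comm] at h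
    exact h

/-- An orthonormal basis of the elements annihilated by `y` and by the functional. -/
lemma exists_orthonormal [IsAlgClosed k] (h2 : (2 : k) ≠ 0) [Module.Finite k A]
    (h6 : Module.finrank k A = 6) {ψ : A →ₗ[k] k} (hψ : ∀ x, (∀ y, ψ (x * y) = 0) → x = 0) {y : A}
    (hy : y * y ∉ Submodule.span k {y}) (hy' : ∀ x, y * x ∈ Submodule.span k {y, y * y})
    (h1 : ψ 1 = 0) (hψy : ψ y = 0) (hψy2 : ψ (y * y) ≠ 0) :
    ∃ n : Fin 3 → A, (∀ i, y * n i = 0) ∧ (∀ i, ψ (n i) = 0) ∧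
      (∀ i j, ψ (n i * n j) = if i = j then 1 else 0) ∧
      ∀ x, y * x = 0 → ψ x = 0 → x ∈ Submodule.span k (Set.range n) := by
  have hN := finrank_ann hy hy'
  set N := LinearMap.ker (LinearMap.mulLeft k y) with hNdef
  obtain ⟨c, d, hcd⟩ := exists_sub_mem_ann hy' (y * y)
  -- An element killed by y on which ψ does not vanish. It cuts the four-dimensional annihilator of
  -- y down to the three-dimensional U.
  set n' := y * y - c • 1 - d • y with hn'
  have hψn' : ψ n' ≠ 0 := by
    rw [hn', map_sub, map_sub, map_smul, map_smul, h1, hψy]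
    simpa using hψy2
  have hn'N : ∀ x, y * x = 0 → n' * x = -(c • x) := by
    intro x hx
    rw [hn', sub_mul, sub_mul, mul_assoc, hx, mul_zero, smul_mul_assoc, smul_mul_assoc, hx,
      smul_zero, sub_zero, zero_sub, one_mul]
  let U : Submodule k N := LinearMap.ker (ψ ∘ₗ N.subtype)
  have hU : Module.finrank k U = 3 := by
    have hne : ψ ∘ₗ N.subtype ≠ 0 := fun h =>
      hψn' (LinearMap.congr_fun h (⟨n', hcd⟩ : N))
    have := LinearMap.finrank_range_add_finrank_ker (ψ ∘ₗ N.subtype)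
    rw [LinearMap.range_eq_top.2 (LinearMap.surjective hne), finrank_top, Module.finrank_self] at this
    change Module.finrank k (LinearMap.ker (ψ ∘ₗ N.subtype)) = 3
    omega
  have hUN : ∀ u : U, y * ((u : N) : A) = 0 := fun u => (u : N).2
  have hUψ : ∀ u : U, ψ ((u : N) : A) = 0 := fun u => u.2
  let B : LinearMap.BilinForm k U :=
    ((LinearMap.mul k A).compr₂ ψ).compl₁₂ (N.subtype ∘ₗ U.subtype) (N.subtype ∘ₗ U.subtype)
  have hB : ∀ u v : U, B u v = ψ (((u : N) : A) * ((v : N) : A)) := fun u v => rfl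
  have hsymm : LinearMap.IsSymm B := ⟨fun u v => by
    simp only [hB, mul_comm, RingHom.id_apply]⟩
  -- A is spanned by U, n', 1 and y, and every u ∈ U is ψ-orthogonal to the last three; a u
  -- orthogonal to U is thus orthogonal to A.
  have hsep : B.SeparatingLeft := by
    intro u hu
    refine Subtype.ext (Subtype.ext (hψ _ fun x => ?_))
    obtain ⟨c', d', hx⟩ := exists_sub_mem_ann hy' x
    set m := x - c' • 1 - d' • y with hm
    let e := ψ m / ψ n'
    have hmU : ψ (m - e • n') = 0 := by
      rw [map_sub, map_smul, smul_eq_mul, div_mul_cancel₀ _ hψn', sub_self]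
    have hmN : y * (m - e • n') = 0 := by rw [mul_sub, hx, mul_smul_comm, hcd, smul_zero, sub_zero]
    have hxeq : x = (m - e • n') + e • n' + c' • 1 + d' • y := by rw [hm]; abel
    have key := hu ⟨⟨m - e • n', hmN⟩, hmU⟩
    rw [hB] at key
    rw [hxeq, mul_add, mul_add, mul_add, map_add, map_add, map_add, key, mul_smul_comm,
      mul_smul_comm, mul_smul_comm, mul_comm _ n', hn'N _ (hUN u), mul_comm _ y, hUN]
    simp [hUψ]
  have : Invertible (2 : k) := invertibleOfNonzero h2
  have hex := @LinearMap.BilinForm.exists_orthogonal_basis U k _ _ _ _ this B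
  obtain ⟨v, hv⟩ := hex hsymm
  have hne := hv.not_isOrtho_basis_self_of_separatingLeft hsep
  -- Square roots over an algebraically closed field normalize an orthogonal basis.
  choose r hr using fun i => IsAlgClosed.exists_pow_nat_eq (B (v i) (v i)) (n := 2) (by norm_num)
  have hr0 : ∀ i, r i ≠ 0 := by
    intro i h
    apply hne i
    rw [← hr, h]
    ring
  let e := finCongr hU
  refine ⟨fun i => (r (e.symm i))⁻¹ • ((v (e.symm i) : N) : A), fun i => ?_, fun i => ?_,
    fun i j => ?_, fun x hx hx' => ?_⟩
  · rw [mul_smul_comm, hUN, smul_zero]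
  · rw [map_smul, hUψ, smul_zero]
  · rw [smul_mul_assoc, mul_smul_comm, map_smul, map_smul, ← hB]
    split_ifs with hij
    · rw [hij, ← hr, smul_eq_mul, smul_eq_mul]
      field_simp [hr0]
    · rw [show B (v (e.symm i)) (v (e.symm j)) = 0 from hv (by simpa using hij)]
      simp
  · have hmem : (⟨⟨x, hx⟩, hx'⟩ : U) ∈ Submodule.span k (Set.range v) := by
      rw [v.span_eq]; trivial
    obtain ⟨c, hc⟩ := (Submodule.mem_span_range_iff_exists_fun k).1 hmem
    have hc' := congrArg (fun u : U => ((u : N) : A)) hc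
    simp only [Submodule.coe_sum, Submodule.coe_smul] at hc'
    rw [← hc']
    refine Submodule.sum_mem _ fun i _ => ?_
    have : c i • ((v i : N) : A) = (c i * r i) • ((r i)⁻¹ • ((v i : N) : A)) := by
      rw [smul_smul, mul_assoc, mul_inv_cancel₀ (hr0 i), mul_one]
    rw [this]
    exact Submodule.smul_mem _ _ (Submodule.subset_span ⟨e i, by simp⟩)

end OrthonormalData

section

open MvPolynomial

/-! ### Normal forms over the polynomial ring in one coordinate. -/

section NormalForms

variable {k σ ι : Type*} [Field k] [Fintype ι]

/-- The polynomials which are congruent modulo `J` to a combination of the `m i` with coefficients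
in `k[xₒ]`. -/
noncomputable def normalForms (J : Ideal (MvPolynomial σ k)) (o : σ) (m : ι → MvPolynomial σ k) :
    Submodule k (MvPolynomial σ k) where
  carrier := {F | ∃ p : ι → Polynomial k, F - ∑ i, Polynomial.aeval (X o) (p i) * m i ∈ J}
  zero_mem' := ⟨0, by simp⟩
  add_mem' := by
    rintro F G ⟨p, hp⟩ ⟨q, hq⟩
    refine ⟨p + q, ?_⟩
    have := add_mem hp hq
    rw [← add_sub_add_comm, ← Finset.sum_add_distrib] at this
    simpa only [Pi.add_apply, map_add, add_mul] using this
  smul_mem' := by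
    rintro c F ⟨p, hp⟩
    refine ⟨c • p, ?_⟩
    have := J.mul_mem_left (C c) hp
    rw [mul_sub, Finset.mul_sum] at this
    simpa only [Pi.smul_apply, map_smul, smul_eq_C_mul, mul_assoc] using this

variable {J : Ideal (MvPolynomial σ k)} {o : σ} {m : ι → MvPolynomial σ k}

lemma le_normalForms : J.restrictScalars k ≤ normalForms J o m :=
  fun F hF => ⟨0, by simpa using hF⟩

lemma aeval_mul_mem_normalForms (q : Polynomial k) {F : MvPolynomial σ k}
    (hF : F ∈ normalForms J o m) : Polynomial.aeval (X o) q * F ∈ normalForms J o m := by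
  obtain ⟨p, hp⟩ := hF
  refine ⟨fun i => q * p i, ?_⟩
  have := J.mul_mem_left (Polynomial.aeval (X o) q) hp
  rw [mul_sub, Finset.mul_sum] at this
  simpa only [map_mul, mul_assoc] using this

lemma X_mul_mem_normalForms {F : MvPolynomial σ k} (hF : F ∈ normalForms J o m) :
    X o * F ∈ normalForms J o m := by
  simpa using aeval_mul_mem_normalForms Polynomial.X hF

lemma mem_normalForms (i : ι) : m i ∈ normalForms J o m := by
  classical
  refine ⟨Pi.single i 1, ?_⟩
  rw [Finset.sum_eq_single i]
  · simp
  · intro j _ hj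
    simp [Pi.single_eq_of_ne hj]
  · simp

lemma normalForms_eq_top (h1 : (1 : MvPolynomial σ k) ∈ normalForms J o m)
    (h : ∀ s i, X s * m i ∈ normalForms J o m) : normalForms J o m = ⊤ := by
  rw [eq_top_iff]
  rintro F -
  induction F using MvPolynomial.induction_on with
  | C c =>
    have := (normalForms J o m).smul_mem c h1
    rwa [smul_eq_C_mul, mul_one] at this
  | add p q hp hq => exact add_mem hp hq
  | mul_X F s hF =>
    obtain ⟨p, hp⟩ := hF
    have h2 : F * X s = (F - ∑ i, Polynomial.aeval (X o) (p i) * m i) * X s +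
        ∑ i, Polynomial.aeval (X o) (p i) * (X s * m i) := by
      rw [sub_mul, Finset.sum_mul, eq_comm, sub_add_eq_add_sub, sub_eq_iff_eq_add]
      congr 1
      exact Finset.sum_congr rfl fun i _ => by ring
    rw [h2]
    exact add_mem (le_normalForms (J.mul_mem_right _ hp))
      (Submodule.sum_mem _ fun i _ => aeval_mul_mem_normalForms _ (h s i))

variable {A : Type*} [CommRing A] [Algebra k A] {N : ℕ} {J : Ideal (MvPolynomial (Fin (N + 1)) k)}
  {b : Fin (N + 1) → A} {m : ι → MvPolynomial (Fin (N + 1)) k} {e : ι → A} {d : ι → ℕ}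

lemma coneEval_aeval_X (hb : b 0 = 1) (p : Polynomial k) :
    coneEval b (Polynomial.aeval (X 0 : MvPolynomial (Fin (N + 1)) k) p) =
      p.map (algebraMap k A) := by
  have : (coneEval b).comp (Polynomial.aeval (X 0)) =
      Polynomial.mapAlgHom (Algebra.ofId k A) := by
    refine Polynomial.algHom_ext ?_
    simp [coneEval, hb]
  exact DFunLike.congr_fun this p

/-- Each coefficient of the resulting polynomial over A is a linear relation among the eᵢ. -/
lemma eq_zero_of_coneEval_normalForm (hb : b 0 = 1)
    (he : ∀ i, coneEval b (m i) = Polynomial.C (e i) * Polynomial.X ^ d i)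
    (hind : LinearIndependent k e) {p : ι → Polynomial k}
    (h : coneEval b (∑ i, Polynomial.aeval (X 0) (p i) * m i) = 0) : p = 0 := by
  have key : ∀ t, ∑ i, (p i * Polynomial.X ^ d i).coeff t • e i = 0 := by
    intro t
    have := congrArg (fun q => Polynomial.coeff q t) h
    simp only [map_sum, map_mul, coneEval_aeval_X hb, he, Polynomial.finsetSum_coeff,
      Polynomial.coeff_zero] at this
    rw [← this]
    refine Finset.sum_congr rfl fun i _ => ?_
    rw [mul_left_comm, Polynomial.coeff_C_mul, Algebra.smul_def, mul_comm (e i)]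
    rw [← Polynomial.map_X (algebraMap k A), ← Polynomial.map_pow, ← Polynomial.map_mul,
      Polynomial.coeff_map]
  ext1 i
  have : p i * Polynomial.X ^ d i = 0 := by
    ext t
    exact Fintype.linearIndependent_iff.1 hind _ (key t) i
  exact (mul_eq_zero.1 this).resolve_right (pow_ne_zero _ Polynomial.X_ne_zero)

/-- An ideal of forms vanishing at a point is determined by independent normal forms. -/
lemma vanishingForms_eq_of_normalForms (hb : b 0 = 1) (hJ : J ≤ vanishingForms b)
    (htop : normalForms J 0 m = ⊤)
    (he : ∀ i, coneEval b (m i) = Polynomial.C (e i) * Polynomial.X ^ d i)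
    (hind : LinearIndependent k e) : vanishingForms b = J := by
  refine le_antisymm (fun F hF => ?_) hJ
  obtain ⟨p, hp⟩ : F ∈ normalForms J 0 m := by rw [htop]; trivial
  have h0 : coneEval b (∑ i, Polynomial.aeval (X 0) (p i) * m i) = 0 := by
    have h1 := sub_mem hF (hJ hp)
    rwa [sub_sub_cancel] at h1
  rw [eq_zero_of_coneEval_normalForm hb he hind h0] at hp
  simpa using hp

lemma aeval_eq_zero_of_mem_vanishingForms {F : MvPolynomial (Fin (N + 1)) k}
    (hF : F ∈ vanishingForms b) : aeval b F = 0 := by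
  rw [← sum_homogeneousComponent F, map_sum]
  exact Finset.sum_eq_zero fun t _ => (mem_vanishingForms b).1 hF t

lemma aeval_mem_span_of_normalForms (hb : b 0 = 1) (hJ : J ≤ vanishingForms b)
    (htop : normalForms J 0 m = ⊤) (he : ∀ i, aeval b (m i) = e i)
    (F : MvPolynomial (Fin (N + 1)) k) : aeval b F ∈ Submodule.span k (Set.range e) := by
  obtain ⟨p, hp⟩ : F ∈ normalForms J 0 m := by rw [htop]; trivial
  have h1 := aeval_eq_zero_of_mem_vanishingForms (hJ hp)
  rw [map_sub, sub_eq_zero, map_sum] at h1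
  rw [h1]
  refine Submodule.sum_mem _ fun i _ => ?_
  rw [map_mul, he, ← Polynomial.aeval_algHom_apply, aeval_X, hb,
    show (1 : A) = algebraMap k A 1 by simp, Polynomial.aeval_algebraMap_apply, ← Algebra.smul_def]
  exact Submodule.smul_mem _ _ (Submodule.subset_span ⟨i, rfl⟩)

end NormalForms

/-! ### Reduction of quadrics and cubics modulo the deformed quadrics. -/

section DeformedNormalForms

variable {k R : Type*} [Field k] [CommRing R] [Algebra k R] {L : Matrix (Fin 3) (Fin 5) k}
  {J : Ideal R} {G : Submodule k R} {t x y z : R}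

lemma deformedRow_apply (j : Fin 5) : deformedRow L t x y z 0 j =
    apolarRow x y z 0 j + (L 0 j • (t * x) + L 1 j • (t * y) + L 2 j • (t * z)) := by
  rw [deformedRow, Matrix.add_apply, Matrix.smul_apply, Matrix.mul_apply, Fin.sum_univ_three]
  simp [koszulRow, Algebra.smul_def]
  ring

lemma quadrics_mem (hJ : ∀ j, deformedRow L t x y z 0 j ∈ J) (hJG : J.restrictScalars k ≤ G)
    (ht : ∀ g ∈ G, t * g ∈ G) (hx : x ∈ G) (hy : y ∈ G) (hz : z ∈ G) (hxx : x ^ 2 ∈ G) :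
    x * y ∈ G ∧ x * z ∈ G ∧ y * z ∈ G ∧ y ^ 2 ∈ G ∧ z ^ 2 ∈ G := by
  have h : ∀ j, apolarRow x y z 0 j ∈ G := by
    intro j
    have h1 := hJG (hJ j)
    rw [deformedRow_apply] at h1
    refine (add_mem_cancel_right ?_).1 h1
    exact add_mem (add_mem (G.smul_mem _ (ht x hx)) (G.smul_mem _ (ht y hy)))
      (G.smul_mem _ (ht z hz))
  exact ⟨h 0, h 1, h 2, (G.sub_mem_iff_right hxx).1 (h 3), (G.sub_mem_iff_right hxx).1 (h 4)⟩

/-- Modulo `J` an apolar quadric is t times a linear form. The reductions follow from x³ = x(x² -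
y²) + y(xy), x²y = x(xy) and x²z = x(xz). -/
lemma cubics_mem (hJ : ∀ j, deformedRow L t x y z 0 j ∈ J) (hJG : J.restrictScalars k ≤ G)
    (ht : ∀ g ∈ G, t * g ∈ G) (hx : x ∈ G) (hy : y ∈ G) (hz : z ∈ G) (hxx : x ^ 2 ∈ G) :
    x * x ^ 2 ∈ G ∧ y * x ^ 2 ∈ G ∧ z * x ^ 2 ∈ G := by
  obtain ⟨hxy, hxz, hyz, hyy, hzz⟩ := quadrics_mem hJ hJG ht hx hy hz hxx
  have h : ∀ r j, r * x ∈ G → r * y ∈ G → r * z ∈ G → r * apolarRow x y z 0 j ∈ G := by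
    intro r j h1 h2 h3
    have h4 := hJG (J.mul_mem_left r (hJ j))
    rw [deformedRow_apply, mul_add] at h4
    refine (add_mem_cancel_right ?_).1 h4
    rw [mul_add, mul_add, mul_smul_comm, mul_smul_comm, mul_smul_comm, mul_left_comm,
      mul_left_comm r t, mul_left_comm r t]
    exact add_mem (add_mem (G.smul_mem _ (ht _ h1)) (G.smul_mem _ (ht _ h2)))
      (G.smul_mem _ (ht _ h3))
  have hx' : ∀ j, x * apolarRow x y z 0 j ∈ G := fun j => h x j (by rwa [← pow_two]) hxy hxz
  have hy' : ∀ j, y * apolarRow x y z 0 j ∈ G := fun j =>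
    h y j (by rwa [mul_comm]) (by rwa [← pow_two]) hyz
  refine ⟨?_, ?_, ?_⟩
  · have := add_mem (hx' 3) (hy' 0)
    have e : x * apolarRow x y z 0 3 + y * apolarRow x y z 0 0 = x * x ^ 2 := by
      simp [apolarRow]; ring
    rwa [e] at this
  · have e : x * apolarRow x y z 0 0 = y * x ^ 2 := by simp [apolarRow]; ring
    rw [← e]; exact hx' 0
  · have e : x * apolarRow x y z 0 1 = z * x ^ 2 := by simp [apolarRow]; ring
    rw [← e]; exact hx' 1

end DeformedNormalForms

end

section

open MvPolynomial

/-! ### Explicit ideals of the points built from an orthonormal basis. -/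

section PointIdeals

variable {k A : Type*} [Field k] [CommRing A] [Algebra k A] {L : Matrix (Fin 3) (Fin 5) k}
  {n : Fin 3 → A}

/-- The point of the affine chart `x₀ = 1` of `ℙ³` with coordinates `n`. -/
def planePoint (n : Fin 3 → A) : Fin 4 → A := ![1, n 0, n 1, n 2]

/-- The point of the affine chart `x₀ = 1` of `ℙ⁴` with coordinates `n` and `y`. -/
def spacePoint (n : Fin 3 → A) (y : A) : Fin 5 → A := ![1, n 0, n 1, n 2, y]

/-- The quadrics of a deformed apolar ideal in `k[x₀, …, x₃]`. -/
noncomputable def planeQuadrics (L : Matrix (Fin 3) (Fin 5) k) : Fin 5 → MvPolynomial (Fin 4) k :=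
  deformedRow L (X 0 : MvPolynomial (Fin 4) k) (X 1) (X 2) (X 3) 0

/-- The quadrics of a deformed apolar ideal in `k[x₀, …, x₄]`. -/
noncomputable def spaceQuadrics (L : Matrix (Fin 3) (Fin 5) k) : Fin 5 → MvPolynomial (Fin 5) k :=
  deformedRow L (X 0 : MvPolynomial (Fin 5) k) (X 1) (X 2) (X 3) 0

lemma isHomogeneous_planeQuadrics (j : Fin 5) : (planeQuadrics L j).IsHomogeneous 2 :=
  isHomogeneous_deformedRow L 0 j

lemma isHomogeneous_spaceQuadrics (j : Fin 5) : (spaceQuadrics L j).IsHomogeneous 2 :=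
  isHomogeneous_deformedRow L 0 j

lemma inclHyperplane_planeQuadrics (j : Fin 5) :
    inclHyperplane k (planeQuadrics L j) = spaceQuadrics L j := by
  have := congrFun (congrFun (map_deformedRow (inclHyperplane k) L (X 0) (X 1) (X 2) (X 3)) 0) j
  simp only [inclHyperplane_X] at this
  exact this

lemma planeQuadrics_mem (hrow : deformedRow L 1 (n 0) (n 1) (n 2) = 0) (j : Fin 5) :
    planeQuadrics L j ∈ vanishingForms (k := k) (planePoint n) := by
  rw [mem_vanishingForms_of_isHomogeneous _ (isHomogeneous_planeQuadrics j)]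
  have := congrFun (congrFun (map_deformedRow (aeval (R := k) (planePoint n)) L
    (X 0) (X 1) (X 2) (X 3)) 0) j
  simp only [aeval_X] at this
  exact this.trans (congrFun (congrFun hrow 0) j)

lemma spaceQuadrics_mem (hrow : deformedRow L 1 (n 0) (n 1) (n 2) = 0) (y : A) (j : Fin 5) :
    spaceQuadrics L j ∈ vanishingForms (k := k) (spacePoint n y) := by
  rw [mem_vanishingForms_of_isHomogeneous _ (isHomogeneous_spaceQuadrics j)]
  have := congrFun (congrFun (map_deformedRow (aeval (R := k) (spacePoint n y)) L
    (X 0) (X 1) (X 2) (X 3)) 0) j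
  simp only [aeval_X] at this
  exact this.trans (congrFun (congrFun hrow 0) j)

lemma normalForms_planeQuadrics : normalForms (Ideal.span (Set.range (planeQuadrics L))) 0
    ![1, X 1, X 2, X 3, X 1 ^ 2] = ⊤ := by
  set m : Fin 5 → MvPolynomial (Fin 4) k := ![1, X 1, X 2, X 3, X 1 ^ 2] with hm
  set J := Ideal.span (Set.range (planeQuadrics L)) with hJ
  have hq : ∀ j, deformedRow L (X 0 : MvPolynomial (Fin 4) k) (X 1) (X 2) (X 3) 0 j ∈ J :=
    fun j => Ideal.subset_span ⟨j, rfl⟩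
  have ht : ∀ g ∈ normalForms J 0 m, X 0 * g ∈ normalForms J 0 m :=
    fun g hg => X_mul_mem_normalForms hg
  have h0 : 1 ∈ normalForms J 0 m := mem_normalForms (m := m) 0
  have h1 : X 1 ∈ normalForms J 0 m := mem_normalForms (m := m) 1
  have h2 : X 2 ∈ normalForms J 0 m := mem_normalForms (m := m) 2
  have h3 : X 3 ∈ normalForms J 0 m := mem_normalForms (m := m) 3
  have h4 : X 1 ^ 2 ∈ normalForms J 0 m := mem_normalForms (m := m) 4
  obtain ⟨hxy, hxz, hyz, hyy, hzz⟩ := quadrics_mem hq le_normalForms ht h1 h2 h3 h4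
  obtain ⟨hc1, hc2, hc3⟩ := cubics_mem hq le_normalForms ht h1 h2 h3 h4
  refine normalForms_eq_top h0 fun s i => ?_
  fin_cases s
  · exact ht _ (mem_normalForms i)
  · fin_cases i
    exacts [by simpa [hm] using h1, by simpa [hm, pow_two] using h4, hxy, hxz, hc1]
  · fin_cases i
    exacts [by simpa [hm] using h2, by simpa [hm, mul_comm] using hxy,
      by simpa [hm, pow_two] using hyy, hyz, hc2]
  · fin_cases i
    exacts [by simpa [hm] using h3, by simpa [hm, mul_comm] using hxz,
      by simpa [hm, mul_comm] using hyz, by simpa [hm, pow_two] using hzz, hc3]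

lemma vanishingForms_plane (hrow : deformedRow L 1 (n 0) (n 1) (n 2) = 0)
    (hind : LinearIndependent k ![1, n 0, n 1, n 2, n 0 ^ 2]) :
    vanishingForms (k := k) (planePoint n) = Ideal.span (Set.range (planeQuadrics L)) := by
  refine vanishingForms_eq_of_normalForms rfl ?_ normalForms_planeQuadrics
    (d := ![0, 1, 1, 1, 2]) (fun i => ?_) hind
  · rw [Ideal.span_le]
    rintro _ ⟨j, rfl⟩
    exact planeQuadrics_mem hrow j
  · fin_cases i <;> simp [coneEval, planePoint, mul_pow]

/-- The index map i allows the same reductions both for the five monomials of X̃ and for the six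
monomials of X. -/
lemma X_mul_mem_normalForms_space {ι : Type*} [Fintype ι] {J : Ideal (MvPolynomial (Fin 5) k)}
    {m : ι → MvPolynomial (Fin 5) k} (hq : ∀ j, spaceQuadrics L j ∈ J) {i : Fin 5 → ι}
    (hm : ∀ j, m (i j) = (![1, X 1, X 2, X 3, X 1 ^ 2] : Fin 5 → MvPolynomial (Fin 5) k) j)
    (s : Fin 4) (j : Fin 5) : X s.castSucc * m (i j) ∈ normalForms J 0 m := by
  have ht : ∀ g ∈ normalForms J 0 m, X 0 * g ∈ normalForms J 0 m :=
    fun g hg => X_mul_mem_normalForms hg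
  have h : ∀ j, (![1, X 1, X 2, X 3, X 1 ^ 2] : Fin 5 → MvPolynomial (Fin 5) k) j ∈
      normalForms J 0 m := fun j => by rw [← hm]; exact mem_normalForms (i j)
  have h1 : X 1 ∈ normalForms J 0 m := h 1
  have h2 : X 2 ∈ normalForms J 0 m := h 2
  have h3 : X 3 ∈ normalForms J 0 m := h 3
  have h4 : X 1 ^ 2 ∈ normalForms J 0 m := h 4
  obtain ⟨hxy, hxz, hyz, hyy, hzz⟩ := quadrics_mem hq le_normalForms ht h1 h2 h3 h4
  obtain ⟨hc1, hc2, hc3⟩ := cubics_mem hq le_normalForms ht h1 h2 h3 h4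
  rw [hm]
  fin_cases s
  · exact ht _ (h j)
  · fin_cases j
    exacts [by simpa using h1, by simpa [pow_two] using h4, hxy, hxz, hc1]
  · fin_cases j
    exacts [by simpa using h2, by simpa [mul_comm] using hxy,
      by simpa [pow_two] using hyy, hyz, hc2]
  · fin_cases j
    exacts [by simpa using h3, by simpa [mul_comm] using hxz,
      by simpa [mul_comm] using hyz, by simpa [pow_two] using hzz, hc3]

lemma normalForms_space : normalForms (Ideal.span (insert (X 4) (Set.range (spaceQuadrics L)))) 0
    ![1, X 1, X 2, X 3, X 1 ^ 2] = ⊤ := by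
  refine normalForms_eq_top (mem_normalForms (m := (![1, X 1, X 2, X 3, X 1 ^ 2] :
    Fin 5 → MvPolynomial (Fin 5) k)) 0) fun s i => ?_
  induction s using Fin.lastCases with
  | last => exact le_normalForms (Ideal.mul_mem_right _ _ (Ideal.subset_span (Or.inl rfl)))
  | cast s =>
    exact X_mul_mem_normalForms_space (ι := Fin 5) (L := L)
      (fun j => Ideal.subset_span (Or.inr ⟨j, rfl⟩)) (i := id) (fun _ => rfl) s i

lemma coneEval_space_apply (y : A) (i : Fin 5) : coneEval (spacePoint n y)
      ((![1, X 1, X 2, X 3, X 1 ^ 2] : Fin 5 → MvPolynomial (Fin 5) k) i) =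
    Polynomial.C (![1, n 0, n 1, n 2, n 0 ^ 2] i) *
      Polynomial.X ^ (![0, 1, 1, 1, 2] : Fin 5 → ℕ) i := by
  fin_cases i <;> simp [coneEval, spacePoint, mul_pow]

lemma span_le_vanishingForms_space (hrow : deformedRow L 1 (n 0) (n 1) (n 2) = 0) :
    Ideal.span (insert (X 4) (Set.range (spaceQuadrics L))) ≤
      vanishingForms (k := k) (spacePoint n 0) := by
  rw [Ideal.span_le]
  rintro _ (rfl | ⟨j, rfl⟩)
  · change X 4 ∈ vanishingForms (k := k) (spacePoint n 0)
    rw [mem_vanishingForms_of_isHomogeneous _ (isHomogeneous_X k 4), aeval_X]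
    rfl
  · exact spaceQuadrics_mem hrow 0 j

lemma vanishingForms_space (hrow : deformedRow L 1 (n 0) (n 1) (n 2) = 0)
    (hind : LinearIndependent k ![1, n 0, n 1, n 2, n 0 ^ 2]) :
    vanishingForms (k := k) (spacePoint n 0) =
      Ideal.span (insert (X 4) (Set.range (spaceQuadrics L))) :=
  vanishingForms_eq_of_normalForms rfl (span_le_vanishingForms_space hrow) normalForms_space
    (coneEval_space_apply 0) hind

lemma comap_inclHyperplane_vanishingForms (y : A) :
    (vanishingForms (spacePoint n y)).comap (inclHyperplane k) =
      vanishingForms (planePoint n) := by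
  have : (coneEval (k := k) (spacePoint n y)).comp (inclHyperplane k) =
      coneEval (planePoint n) := by
    refine MvPolynomial.algHom_ext fun i => ?_
    rw [AlgHom.comp_apply, inclHyperplane_X, coneEval, coneEval, aeval_X, aeval_X]
    fin_cases i <;> rfl
  ext F
  rw [Ideal.mem_comap, vanishingForms, vanishingForms, RingHom.mem_ker, RingHom.mem_ker, ← this,
    AlgHom.comp_apply]

/-- The ideal of the Italian construction consists of the forms vanishing at a point with values
in the algebra. -/
lemma italianIdeal_eq_vanishingForms {y : A} (hrow : deformedRow L 1 (n 0) (n 1) (n 2) = 0)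
    (hind : LinearIndependent k ![1, n 0, n 1, n 2, n 0 ^ 2, y]) (hy : ∀ i, y * n i = 0)
    {g₀ : MvPolynomial (Fin 4) k} (hg₀ : g₀.IsHomogeneous 1) {β γ : k} (hγ : γ ≠ 0)
    (hf : aeval (planePoint n) (-X 3 ^ 2 + X 0 * g₀) + γ • (y * y - β • y) = 0) :
    italianIdeal (Ideal.span (insert (X 4) (Set.range (spaceQuadrics L)))) (-X 3 ^ 2 + X 0 * g₀)
      (C γ * (X 4 - C β * X 0)) = vanishingForms (spacePoint n y) := by
  have hind5 : LinearIndependent k ![1, n 0, n 1, n 2, n 0 ^ 2] := by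
    have := hind.comp (Fin.castSucc : Fin 5 → Fin 6) (Fin.castSucc_injective 5)
    convert this using 1
    ext i; fin_cases i <;> rfl
  -- The ideal of X̃ and its restriction to the hyperplane are both vanishing ideals, so the
  -- intersection is computed on points.
  have hcomap : (Ideal.span (insert (X 4) (Set.range (spaceQuadrics L)))).comap
      (inclHyperplane k) = Ideal.span (Set.range (planeQuadrics L)) := by
    rw [← vanishingForms_space hrow hind5, comap_inclHyperplane_vanishingForms,
      vanishingForms_plane hrow hind5]
  have hmap : (Ideal.span (Set.range (planeQuadrics L))).map (inclHyperplane k) =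
      Ideal.span (Set.range (spaceQuadrics L)) := by
    rw [Ideal.map_span, ← Set.range_comp]
    congr 2
    ext1 j
    exact inclHyperplane_planeQuadrics j
  set f : MvPolynomial (Fin 4) k := -X 3 ^ 2 + X 0 * g₀ with hfdef
  have hfhom : (inclHyperplane k f).IsHomogeneous 2 :=
    IsHomogeneous.rename_isHomogeneous ((isHomogeneous_X_pow 3 2).neg.add
      ((isHomogeneous_X k 0).mul hg₀))
  have hlin : (C γ * (X 4 - C β * X 0) : MvPolynomial (Fin 5) k).IsHomogeneous 1 := by
    have h0 : (C β * X 0 : MvPolynomial (Fin 5) k).IsHomogeneous 1 := by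
      simpa using (isHomogeneous_C (Fin 5) β).mul (isHomogeneous_X k 0)
    simpa using (isHomogeneous_C (Fin 5) γ).mul ((isHomogeneous_X k 4).sub h0)
  rw [italianIdeal, hcomap, hmap]
  set J := Ideal.span (Set.range (spaceQuadrics L)) ⊔ Ideal.span {X 1 * X 4, X 2 * X 4, X 3 * X 4,
    inclHyperplane k f + X 4 * (C γ * (X 4 - C β * X 0))} with hJ
  set m : Fin 6 → MvPolynomial (Fin 5) k := ![1, X 1, X 2, X 3, X 1 ^ 2, X 4] with hm
  have hq : ∀ j, spaceQuadrics L j ∈ J := fun j =>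
    Ideal.mem_sup_left (Ideal.subset_span ⟨j, rfl⟩)
  have hJ1 : X 1 * X 4 ∈ J := Ideal.mem_sup_right (Ideal.subset_span (by simp))
  have hJ2 : X 2 * X 4 ∈ J := Ideal.mem_sup_right (Ideal.subset_span (by simp))
  have hJ3 : X 3 * X 4 ∈ J := Ideal.mem_sup_right (Ideal.subset_span (by simp))
  have hJ4 : inclHyperplane k f + X 4 * (C γ * (X 4 - C β * X 0)) ∈ J :=
    Ideal.mem_sup_right (Ideal.subset_span (by simp))
  refine (vanishingForms_eq_of_normalForms (m := m) (d := ![0, 1, 1, 1, 2, 1]) rfl ?_ ?_ ?_ hind).symm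
  · rw [hJ, sup_le_iff, Ideal.span_le, Ideal.span_le]
    refine ⟨?_, ?_⟩
    · rintro _ ⟨j, rfl⟩
      exact spaceQuadrics_mem hrow y j
    · have hXX : ∀ i j : Fin 5, spacePoint n y i * spacePoint n y j = 0 →
          X i * X j ∈ vanishingForms (k := k) (spacePoint n y) := by
        intro i j hij
        rwa [mem_vanishingForms_of_isHomogeneous _ ((isHomogeneous_X k i).mul (isHomogeneous_X k j)),
          map_mul, aeval_X, aeval_X]
      rintro _ (rfl | rfl | rfl | rfl)
      · exact hXX 1 4 ((mul_comm _ _).trans (hy 0))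
      · exact hXX 2 4 ((mul_comm _ _).trans (hy 1))
      · exact hXX 3 4 ((mul_comm _ _).trans (hy 2))
      · have hhom := hfhom.add ((isHomogeneous_X k (4 : Fin 5)).mul hlin)
        change _ ∈ vanishingForms (k := k) (spacePoint n y)
        rw [mem_vanishingForms_of_isHomogeneous _ hhom, ← hf, map_add]
        congr 1
        · rw [inclHyperplane, aeval_rename]
          congr 1
          congr 1
          ext i
          fin_cases i <;> rfl
        · simp [spacePoint, Algebra.smul_def]
          ring
  · have ht : ∀ g ∈ normalForms J 0 m, X 0 * g ∈ normalForms J 0 m :=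
      fun g hg => X_mul_mem_normalForms hg
    have hle : J.restrictScalars k ≤ normalForms J 0 m := le_normalForms
    have h4 : X 4 ∈ normalForms J 0 m := mem_normalForms (m := m) 5
    have hprod : ∀ (s : Fin 4) (j : Fin 5), X s.castSucc * m j.castSucc ∈ normalForms J 0 m :=
      fun s j => X_mul_mem_normalForms_space hq (i := Fin.castSucc)
        (fun j => by fin_cases j <;> rfl) s j
    have hX : ∀ s : Fin 4, X s.castSucc ∈ normalForms J 0 m := fun s => by
      simpa [hm] using hprod s 0
    have hf' : inclHyperplane k f ∈ normalForms J 0 m := by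
      rw [hfdef, map_add, map_neg, map_pow, map_mul, inclHyperplane_X, inclHyperplane_X, pow_two]
      refine add_mem (neg_mem (hprod 3 3)) (ht _ ?_)
      obtain ⟨c, rfl⟩ := exists_linear_coeffs hg₀
      rw [map_sum]
      refine Submodule.sum_mem _ fun i _ => ?_
      rw [C_mul', map_smul, inclHyperplane_X]
      exact (normalForms J 0 m).smul_mem _ (hX i)
    -- As γ ≠ 0, the last generator can be solved for x₄².
    have h44 : X 4 * X 4 ∈ normalForms J 0 m := by
      have h1 : γ • (X 4 * X 4) = (inclHyperplane k f + X 4 * (C γ * (X 4 - C β * X 0))) -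
          inclHyperplane k f + (γ * β) • (X 0 * X 4) := by
        rw [smul_eq_C_mul, smul_eq_C_mul, C_mul]; ring
      have h2 : γ • (X 4 * X 4) ∈ normalForms J 0 m := by
        rw [h1]
        exact add_mem (sub_mem (hle hJ4) hf') ((normalForms J 0 m).smul_mem _ (ht _ h4))
      have := (normalForms J 0 m).smul_mem γ⁻¹ h2
      rwa [smul_smul, inv_mul_cancel₀ hγ, one_smul] at this
    refine normalForms_eq_top (mem_normalForms (m := m) 0) fun s i => ?_
    induction s using Fin.lastCases with
    | last =>
      fin_cases i
      · simpa [hm] using h4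
      · exact hle (by simpa [hm, mul_comm] using hJ1)
      · exact hle (by simpa [hm, mul_comm] using hJ2)
      · exact hle (by simpa [hm, mul_comm] using hJ3)
      · refine hle ?_
        have := J.mul_mem_left (X 1) hJ1
        rwa [← mul_assoc, ← pow_two, mul_comm] at this
      · exact h44
    | cast s =>
      induction i using Fin.lastCases with
      | last =>
        fin_cases s
        exacts [ht _ h4, hle hJ1, hle hJ2, hle hJ3]
      | cast j => exact hprod s j
  · intro i
    fin_cases i <;> simp [hm, coneEval, spacePoint, mul_pow]

end PointIdeals

end

section

open MvPolynomial

/-! ### Gorenstein cones from homogenized dual bases. -/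

section GorensteinPoints

universe u

variable {k : Type u} [Field k] {A : Type*} [CommRing A] [Algebra k A] {N : ℕ} {ι : Type*}
  [Fintype ι] [DecidableEq ι] {b : Fin (N + 1) → A} {m E : ι → MvPolynomial (Fin (N + 1)) k}
  {e : ι → A} {d : ι → ℕ}

/-- The homogeneous coordinate ring of a scheme defined by an algebra with a nondegenerate
functional is Gorenstein if the dual basis can be homogenized. -/
lemma isGorensteinRing_vanishingForms (hb : b 0 = 1)
    (htop : normalForms (vanishingForms b) 0 m = ⊤)
    (hm : ∀ i, (m i).IsHomogeneous (d i)) (he : ∀ i, aeval b (m i) = e i)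
    (hind : LinearIndependent k e) (ψ : A →ₗ[k] k) (top : ι)
    (hψ : ∀ i, ψ (e i) = if i = top then 1 else 0)
    (hE : ∀ i j, (m j * E i).IsHomogeneous (d j + (d top - d i))) (hd : ∀ i, d i ≤ d top)
    (hdual : ∀ i j, ψ (e j * aeval b (E i)) = if i = j then 1 else 0) :
    IsGorensteinRing (MvPolynomial (Fin (N + 1)) k ⧸ vanishingForms b) := by
  set I := vanishingForms (k := k) b with hI
  -- The coordinate ring is regarded as a k[x₀]-algebra; the mᵢ are a free basis, and Φ will be the
  -- coordinate along the top element.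
  let θ : Polynomial k →ₐ[k] MvPolynomial (Fin (N + 1)) k ⧸ I :=
    (Ideal.Quotient.mkₐ k I).comp (Polynomial.aeval (X 0))
  let : Algebra (Polynomial k) (MvPolynomial (Fin (N + 1)) k ⧸ I) := θ.toRingHom.toAlgebra
  have hsmul : ∀ (p : Polynomial k) F, p • Ideal.Quotient.mk I F =
      Ideal.Quotient.mk I (Polynomial.aeval (X 0) p * F) := fun p F => by
    rw [Algebra.smul_def, map_mul]; rfl
  have hcone : ∀ i, coneEval b (m i) = Polynomial.C (e i) * Polynomial.X ^ d i := fun i => by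
    rw [coneEval_of_isHomogeneous b (hm i), he]
  let T : (ι → Polynomial k) →ₗ[Polynomial k] MvPolynomial (Fin (N + 1)) k ⧸ I :=
    Fintype.linearCombination (Polynomial k) fun i => Ideal.Quotient.mk I (m i)
  have hT : ∀ p, T p = Ideal.Quotient.mk I (∑ i, Polynomial.aeval (X 0) (p i) * m i) := fun p => by
    simp only [T, Fintype.linearCombination_apply, hsmul, map_sum]
  have hTinj : Function.Injective T := by
    rw [injective_iff_map_eq_zero]
    intro p hp
    rw [hT, Ideal.Quotient.eq_zero_iff_mem] at hp
    exact eq_zero_of_coneEval_normalForm hb hcone hind hp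
  have hTsurj : Function.Surjective T := by
    intro r
    obtain ⟨F, rfl⟩ := Ideal.Quotient.mk_surjective r
    obtain ⟨p, hp⟩ : F ∈ normalForms I 0 m := by rw [htop]; trivial
    exact ⟨p, by rw [hT, eq_comm, Ideal.Quotient.eq]; exact hp⟩
  let eqv := LinearEquiv.ofBijective T ⟨hTinj, hTsurj⟩
  let Φ : (MvPolynomial (Fin (N + 1)) k ⧸ I) →ₗ[Polynomial k] Polynomial k :=
    LinearMap.proj top ∘ₗ eqv.symm.toLinearMap
  have hΦT : ∀ p, Φ (T p) = p top := fun p => by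
    change eqv.symm (eqv p) top = p top
    rw [LinearEquiv.symm_apply_apply]
  -- Φ is the homogenization of ψ: multiplying by the power `d top` of the variable restores the
  -- degree lost by taking the top coordinate.
  have hcoeff : ∀ F t, (Φ (Ideal.Quotient.mk I F) * Polynomial.X ^ d top).coeff t =
      ψ ((coneEval b F).coeff t) := by
    intro F t
    obtain ⟨p, hp⟩ := hTsurj (Ideal.Quotient.mk I F)
    rw [← hp, hΦT]
    rw [hT, eq_comm, Ideal.Quotient.eq] at hp
    have h1 : coneEval b F = coneEval b (∑ i, Polynomial.aeval (X 0) (p i) * m i) := by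
      rw [← sub_eq_zero, ← map_sub]; exact hp
    rw [h1, map_sum, Polynomial.finsetSum_coeff, map_sum]
    have h2 : ∀ i, ψ ((coneEval b (Polynomial.aeval (X 0) (p i) * m i)).coeff t) =
        (p i * Polynomial.X ^ d i).coeff t * (if i = top then 1 else 0) := by
      intro i
      rw [map_mul, coneEval_aeval_X hb, hcone, mul_left_comm, ← Polynomial.map_X (algebraMap k A),
        ← Polynomial.map_pow, ← Polynomial.map_mul, Polynomial.coeff_C_mul, Polynomial.coeff_map,
        mul_comm, ← Algebra.smul_def, map_smul, hψ, smul_eq_mul]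
    simp only [h2, mul_ite, mul_one, mul_zero, Finset.sum_ite_eq', Finset.mem_univ, if_true]
  have hpair : ∀ i j, Φ (Ideal.Quotient.mk I (m j * E i)) = if i = j then 1 else 0 := by
    intro i j
    refine mul_right_cancel₀ (pow_ne_zero (d top) (Polynomial.X_ne_zero (R := k))) ?_
    ext t
    rw [hcoeff, coneEval_of_isHomogeneous b (hE i j), Polynomial.coeff_C_mul,
      map_mul (aeval b), he, Polynomial.coeff_X_pow]
    by_cases hij : i = j
    · subst hij
      rw [Nat.add_sub_cancel' (hd i)]
      rw [if_pos (rfl : i = i), one_mul, Polynomial.coeff_X_pow]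
      split_ifs
      · rw [mul_one, hdual, if_pos rfl]
      · rw [mul_zero, map_zero]
    · split_ifs with h1 <;> simp [hdual, hij]
  refine isGorensteinRing_of_dual_bases Φ (fun i => Ideal.Quotient.mk I (m i))
    (fun i => Ideal.Quotient.mk I (E i)) fun r => ?_
  obtain ⟨p, rfl⟩ := hTsurj r
  have h3 : ∀ i, Φ (T p * Ideal.Quotient.mk I (E i)) = p i := by
    intro i
    have : T p * Ideal.Quotient.mk I (E i) = ∑ j, p j • Ideal.Quotient.mk I (m j * E i) := by
      simp only [T, Fintype.linearCombination_apply, Finset.sum_mul, smul_mul_assoc, map_mul]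
    rw [this, map_sum]
    simp only [map_smul, hpair, smul_eq_mul, mul_ite, mul_one, mul_zero, Finset.sum_ite_eq,
      Finset.mem_univ, if_true]
  simp only [h3]
  rfl

end GorensteinPoints

/-! ### The degree five scheme is arithmetically Gorenstein. -/

section SpacePoint

universe u

variable {k : Type u} [Field k] {A : Type*} [CommRing A] [Algebra k A]
  {L : Matrix (Fin 3) (Fin 5) k} {n : Fin 3 → A}

lemma isHomogeneous_space_monomials (i : Fin 5) :
    ((![1, X 1, X 2, X 3, X 1 ^ 2] : Fin 5 → MvPolynomial (Fin 5) k) i).IsHomogeneous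
      ((![0, 1, 1, 1, 2] : Fin 5 → ℕ) i) := by
  fin_cases i
  exacts [isHomogeneous_one _ _, isHomogeneous_X _ _, isHomogeneous_X _ _, isHomogeneous_X _ _,
    isHomogeneous_X_pow _ _]

lemma aeval_space_monomials (y : A) (i : Fin 5) : aeval (spacePoint n y)
      ((![1, X 1, X 2, X 3, X 1 ^ 2] : Fin 5 → MvPolynomial (Fin 5) k) i) =
    (![1, n 0, n 1, n 2, n 0 ^ 2] : Fin 5 → A) i := by
  fin_cases i <;> simp [spacePoint]

lemma isGorensteinRing_space (hrow : deformedRow L 1 (n 0) (n 1) (n 2) = 0)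
    (hind : LinearIndependent k ![1, n 0, n 1, n 2, n 0 ^ 2]) {ψ : A →ₗ[k] k} (h1 : ψ 1 = 0)
    (hn : ∀ i, ψ (n i) = 0) (hnn : ∀ i j, ψ (n i * n j) = if i = j then 1 else 0) :
    IsGorensteinRing (MvPolynomial (Fin 5) k ⧸ vanishingForms (k := k) (spacePoint n 0)) := by
  -- The constants κ and c correct the obvious dual elements of 1, n₀, n₁, n₂, n₀² for the products
  -- of order three and four; powers of x₀ then homogenize them to E.
  let κ : Fin 3 → k := fun i => ψ (n 0 ^ 2 * n i)
  let c : k := ψ (n 0 ^ 2 * n 0 ^ 2) - ∑ i, κ i * κ i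
  have hX := isHomogeneous_X k (σ := Fin 5)
  have hC : ∀ (a : k) {F : MvPolynomial (Fin 5) k} {t : ℕ}, F.IsHomogeneous t →
      (C a * F).IsHomogeneous t := fun a F t hF => by
    simpa using (isHomogeneous_C (Fin 5) a).mul hF
  let E : Fin 5 → MvPolynomial (Fin 5) k := ![X 1 ^ 2 - C (κ 0) * (X 0 * X 1) -
    C (κ 1) * (X 0 * X 2) - C (κ 2) * (X 0 * X 3) - C c * X 0 ^ 2, X 1 - C (κ 0) * X 0,
    X 2 - C (κ 1) * X 0, X 3 - C (κ 2) * X 0, 1]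
  have hEhom : ∀ i, (E i).IsHomogeneous ((![0, 1, 1, 1, 2] : Fin 5 → ℕ) 4 -
      (![0, 1, 1, 1, 2] : Fin 5 → ℕ) i) := by
    intro i
    fin_cases i
    · exact ((((isHomogeneous_X_pow 1 2).sub (hC _ ((hX 0).mul (hX 1)))).sub
        (hC _ ((hX 0).mul (hX 2)))).sub (hC _ ((hX 0).mul (hX 3)))).sub
        (hC _ (isHomogeneous_X_pow 0 2))
    · exact (hX 1).sub (hC _ (hX 0))
    · exact (hX 2).sub (hC _ (hX 0))
    · exact (hX 3).sub (hC _ (hX 0))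
    · exact isHomogeneous_one _ _
  have hEval : ∀ i, aeval (spacePoint n 0) (E i) =
      (![n 0 ^ 2 - κ 0 • n 0 - κ 1 • n 1 - κ 2 • n 2 - c • 1, n 0 - κ 0 • 1, n 1 - κ 1 • 1,
        n 2 - κ 2 • 1, 1] : Fin 5 → A) i := by
    intro i
    fin_cases i <;> simp [E, spacePoint, Algebra.smul_def]
  refine isGorensteinRing_vanishingForms (b := spacePoint n 0) rfl
    (by rw [vanishingForms_space hrow hind]; exact normalForms_space) isHomogeneous_space_monomials
    (aeval_space_monomials 0) hind ψ 4 (E := E) ?_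
    (fun i j => (isHomogeneous_space_monomials j).mul (hEhom i)) (by decide) ?_
  · intro i
    fin_cases i <;> simp [h1, hn, pow_two, hnn]
  · intro i j
    rw [hEval]
    have e00 : ψ (n 0 ^ 2) = 1 := by rw [pow_two, hnn, if_pos rfl]
    have hκ : ∀ i, ψ (n 0 ^ 2 * n i) = κ i := fun i => rfl
    have hκ' : ∀ i, ψ (n i * n 0 ^ 2) = κ i := fun i => by rw [mul_comm]
    have hc : ψ (n 0 ^ 2 * n 0 ^ 2) = c + (κ 0 * κ 0 + κ 1 * κ 1 + κ 2 * κ 2) := by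
      simp only [c, Fin.sum_univ_three]; ring
    fin_cases i <;> fin_cases j <;>
      simp only [Fin.zero_eta, Fin.mk_one, Fin.reduceFinMk, Matrix.cons_val, mul_sub, mul_smul_comm,
        mul_one, one_mul, map_sub, map_smul, h1, hn, hnn, hκ, hκ', hc, e00, smul_eq_mul, if_true] <;>
      simp <;> try ring

lemma mem_hilbAG_space (hrow : deformedRow L 1 (n 0) (n 1) (n 2) = 0)
    (hind : LinearIndependent k ![1, n 0, n 1, n 2, n 0 ^ 2]) {ψ : A →ₗ[k] k} (h1 : ψ 1 = 0)
    (hn : ∀ i, ψ (n i) = 0) (hnn : ∀ i j, ψ (n i * n j) = if i = j then 1 else 0) :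
    vanishingForms (k := k) (spacePoint n 0) ∈ hilbAG k 4 5 := by
  have hmem : ∀ i, spacePoint n 0 i ∈ Submodule.span k (Set.range (spacePoint n 0)) :=
    fun i => Submodule.subset_span ⟨i, rfl⟩
  have hone : (1 : A) ∈ Submodule.span k (Set.range (spacePoint n 0)) := hmem 0
  refine ⟨isProjectiveSubscheme_vanishingForms _ hone, ?_,
    isGorensteinRing_space hrow hind h1 hn hnn⟩
  -- From degree 2 on, the powers of the span of the coordinates are constant, of dimension five.
  have hW : ∀ t, 2 ≤ t → Submodule.span k (Set.range (spacePoint n 0)) ^ t =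
      Submodule.span k (Set.range ![1, n 0, n 1, n 2, n 0 ^ 2]) := by
    intro t ht
    refine le_antisymm (fun x hx => ?_) ?_
    · obtain ⟨F, -, rfl⟩ := (mem_span_pow_iff _).1 hx
      exact aeval_mem_span_of_normalForms rfl (span_le_vanishingForms_space hrow) normalForms_space
        (aeval_space_monomials 0) F
    · refine le_trans ?_ (span_pow_mono (spacePoint n 0) hone ht)
      have hle := span_pow_mono (spacePoint n 0) hone one_le_two
      simp only [pow_one] at hle
      rw [Submodule.span_le]
      rintro _ ⟨i, rfl⟩
      fin_cases i
      · exact hle (hmem 0)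
      · exact hle (hmem 1)
      · exact hle (hmem 2)
      · exact hle (hmem 3)
      · exact Submodule.pow_mem_pow _ (hmem 1) 2
  have := hilbertFunction_eventually (spacePoint n 0) rfl hW
  rwa [finrank_span_eq_card hind, Fintype.card_fin] at this

lemma vanishingForms_space_le_idealP (hrow : deformedRow L 1 (n 0) (n 1) (n 2) = 0)
    (hind : LinearIndependent k ![1, n 0, n 1, n 2, n 0 ^ 2]) :
    vanishingForms (k := k) (spacePoint n 0) ≤ idealP k := by
  have hX : ∀ i : Fin 5, i ≠ 0 → X i ∈ idealP k := fun i hi =>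
    Ideal.subset_span (by fin_cases i <;> simp at hi ⊢)
  rw [vanishingForms_space hrow hind, Ideal.span_le]
  rintro _ (rfl | ⟨j, rfl⟩)
  · exact hX 4 (by decide)
  · change deformedRow L (X 0 : MvPolynomial (Fin 5) k) (X 1) (X 2) (X 3) 0 j ∈ idealP k
    rw [← koszulRow_mul_deformedCoeffs, Matrix.mul_apply]
    refine Ideal.sum_mem _ fun i _ => Ideal.mul_mem_right _ _ ?_
    fin_cases i
    exacts [hX 1 (by decide), hX 2 (by decide), hX 3 (by decide)]

end SpacePoint

end

section

open MvPolynomial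

/-! ### From a branch element to an Italian presentation. -/

section Sufficiency

universe u

variable {k : Type u} [Field k] {A : Type*} [CommRing A] [Algebra k A]

/-- Multiplying the homogeneous coordinates by a unit multiplies the value of a form of degree t by
the t-th power of that unit. This permits replacing φ by φ(w ·). -/
lemma vanishingForms_mul_unit {N : ℕ} (a : Fin (N + 1) → A) (w : Aˣ) :
    vanishingForms (k := k) (fun i => a i * w) = vanishingForms a := by
  ext F
  rw [mem_vanishingForms, mem_vanishingForms]
  refine forall_congr' fun t => ?_
  rw [aeval_smul_of_isHomogeneous (homogeneousComponent_isHomogeneous t F),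
    ← Units.val_pow_eq_pow_val, Units.mul_left_eq_zero]

lemma exists_coeffs_of_mem_span {σ ι : Type*} [Fintype ι] {q : ι → MvPolynomial σ k} {t : ℕ}
    (hq : ∀ i, (q i).IsHomogeneous t) {F : MvPolynomial σ k} (hF : F.IsHomogeneous t)
    (h : F ∈ Ideal.span (Set.range q)) : ∃ c : ι → k, F = ∑ i, q i * C (c i) := by
  obtain ⟨G, hG⟩ := Ideal.mem_span_range_iff_exists_fun.1 h
  refine ⟨fun i => coeff 0 (G i), ?_⟩
  rw [← (homogeneousComponent_of_mem hF).trans (if_pos rfl), ← hG, map_sum]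
  refine Finset.sum_congr rfl fun i _ => ?_
  rw [mul_comm (G i), ← homogeneousComponent_zero]
  exact homogeneousComponent_mul_of_isHomogeneous (hq i) (G i) 0

lemma deformedRow_mul_apolarSyzygies {R : Type*} [CommRing R] [Algebra k R]
    (L : Matrix (Fin 3) (Fin 5) k) (t x y z : R) :
    deformedRow L t x y z * apolarSyzygies x y z =
      t • (koszulRow x y z * L.map (algebraMap k R) * apolarSyzygies x y z) := by
  rw [deformedRow, Matrix.add_mul, apolarRow_mul, zero_add, Matrix.smul_mul]

/-- The apolar syzygies send the deformed quadrics to x₀ V with V quadratic. Since x₀ = 1 at the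
point, V vanishes there, so it is a combination of the deformed quadrics with constant coefficients;
these form H. -/
lemma exists_deformedSyzygies {L : Matrix (Fin 3) (Fin 5) k} {n : Fin 3 → A}
    (hrow : deformedRow L 1 (n 0) (n 1) (n 2) = 0)
    (hind : LinearIndependent k ![1, n 0, n 1, n 2, n 0 ^ 2]) :
    ∃ H : Matrix (Fin 5) (Fin 5) k,
      deformedRow L (X 0 : MvPolynomial (Fin 4) k) (X 1) (X 2) (X 3) *
        deformedSyzygies H (X 0 : MvPolynomial (Fin 4) k) (X 1) (X 2) (X 3) = 0 := by
  obtain ⟨V, hDM, hVhom⟩ : ∃ V : Matrix (Fin 1) (Fin 5) (MvPolynomial (Fin 4) k),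
      deformedRow L (X 0 : MvPolynomial (Fin 4) k) (X 1) (X 2) (X 3) *
        apolarSyzygies (X 1 : MvPolynomial (Fin 4) k) (X 2) (X 3) = (X 0 : MvPolynomial (Fin 4) k) • V ∧
      ∀ r j, (V r j).IsHomogeneous 2 := by
    refine ⟨_, deformedRow_mul_apolarSyzygies L _ _ _ _, isHomogeneous_matrix_mul (isHomogeneous_matrix_mul isHomogeneous_koszulRow
      (isHomogeneous_map_algebraMap L)) isHomogeneous_apolarSyzygies⟩
  have hVmem : ∀ j, V 0 j ∈ Ideal.span (Set.range (planeQuadrics L)) := by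
    intro j
    rw [← vanishingForms_plane hrow hind, mem_vanishingForms_of_isHomogeneous _ (hVhom 0 j)]
    have h := congrArg (aeval (R := k) (planePoint n)) (congrFun (congrFun hDM 0) j)
    rw [Matrix.smul_apply, smul_eq_mul, map_mul, aeval_X, Matrix.mul_apply, map_sum] at h
    have h0 : planePoint n 0 = 1 := rfl
    rw [h0, one_mul] at h
    rw [← h]
    refine Finset.sum_eq_zero fun i _ => ?_
    have h1 : aeval (planePoint n) (planeQuadrics L i) = 0 :=
      (mem_vanishingForms_of_isHomogeneous _ (isHomogeneous_planeQuadrics i)).1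
        (planeQuadrics_mem hrow i)
    rw [map_mul]
    exact mul_eq_zero_of_left h1 _
  choose H hH using fun j =>
    exists_coeffs_of_mem_span (isHomogeneous_planeQuadrics (L := L)) (hVhom 0 j) (hVmem j)
  have hV : V = deformedRow L (X 0 : MvPolynomial (Fin 4) k) (X 1) (X 2) (X 3) *
      (Matrix.of fun i j => H j i).map (algebraMap k (MvPolynomial (Fin 4) k)) := by
    ext1 r j
    rw [Subsingleton.elim r 0, hH, Matrix.mul_apply]
    rfl
  refine ⟨Matrix.of fun i j => H j i, ?_⟩
  rw [deformedSyzygies, Matrix.mul_sub, hDM, Matrix.mul_smul, ← hV, sub_self]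

lemma exists_deformation {n : Fin 3 → A}
    (h : ∀ j, apolarRow (n 0) (n 1) (n 2) 0 j ∈ Submodule.span k (Set.range n)) :
    ∃ L : Matrix (Fin 3) (Fin 5) k, deformedRow L 1 (n 0) (n 1) (n 2) = 0 := by
  choose c hc using fun j => (Submodule.mem_span_range_iff_exists_fun k).1 (h j)
  refine ⟨Matrix.of fun i j => -c j i, ?_⟩
  ext1 r j
  rw [Subsingleton.elim r 0, deformedRow_apply, ← hc, Fin.sum_univ_three]
  simp
  abel

/-- A relation is tested by multiplying by y, then by applying ψ, then by applying ψ(· nⱼ). -/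
lemma linearIndependent_of_orthonormal {ψ : A →ₗ[k] k} {y : A}
    (hy : y * y ∉ Submodule.span k {y}) {n : Fin 3 → A}
    (hyn : ∀ i, y * n i = 0) (hψn : ∀ i, ψ (n i) = 0)
    (hnn : ∀ i j, ψ (n i * n j) = if i = j then 1 else 0) :
    LinearIndependent k ![1, n 0, n 1, n 2, n 0 ^ 2, y] := by
  rw [Fintype.linearIndependent_iff]
  intro g hg
  replace hg : g 0 • 1 + g 1 • n 0 + g 2 • n 1 + g 3 • n 2 + g 4 • n 0 ^ 2 + g 5 • y = 0 := by
    simpa [Fin.sum_univ_six] using hg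
  obtain ⟨h0, h5⟩ : g 0 = 0 ∧ g 5 = 0 := by
    refine smul_add_smul_eq_zero hy ?_
    have := congrArg (y * ·) hg
    simpa [mul_add, hyn, pow_two, ← mul_assoc] using this
  rw [h0, h5, zero_smul, zero_smul, zero_add, add_zero] at hg
  have h4 : g 4 = 0 := by
    have := congrArg ψ hg
    simpa [hψn, pow_two, hnn] using this
  rw [h4, zero_smul, add_zero] at hg
  have h (j : Fin 3) := congrArg (fun x => ψ (x * n j)) hg
  have e1 : g 1 = 0 := by simpa [add_mul, hnn] using h 0
  have e2 : g 2 = 0 := by simpa [add_mul, hnn] using h 1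
  have e3 : g 3 = 0 := by simpa [add_mul, hnn] using h 2
  intro i
  fin_cases i
  exacts [h0, e1, e2, e3, h4, h5]

/-- Both z and s = y² - βy kill the annihilator of y, which together with 1 and y spans A. So two
values of ψ determine z as a combination of s and y, and multiplication by y removes the y-term,
because yz and ys lie in ky while y² does not. -/
lemma exists_add_smul_eq_zero {ψ : A →ₗ[k] k} (hψ : ∀ x, (∀ y, ψ (x * y) = 0) → x = 0) {y : A}
    (hy : y * y ∉ Submodule.span k {y}) (hy' : ∀ x, y * x ∈ Submodule.span k {y, y * y})
    (hψy : ψ y = 0) (hψyy : ψ (y * y) ≠ 0) {n : Fin 3 → A}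
    (hyn : ∀ i, y * n i = 0) (hnn : ψ (n 0 ^ 2) = 1)
    (hspan : ∀ x, y * x = 0 → ψ x = 0 → x ∈ Submodule.span k (Set.range n)) {b c β : k}
    (hβ : y * (y * y - c • 1 - β • y) = 0) {z : A} (hz : ∀ i, n i * z = 0) (hyz : y * z = b • y)
    (hψz : ψ z ≠ 0) : ∃ γ : k, γ ≠ 0 ∧ z + γ • (y * y - β • y) = 0 := by
  set s := y * y - β • y with hs
  have hys : y * s = c • y := by
    rw [← sub_eq_zero, ← hβ, hs]
    simp only [mul_sub, mul_smul_comm, mul_one]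
    abel
  have hψs : ψ s ≠ 0 := by simpa [hs, hψy] using hψyy
  have hns : ∀ x, y * x = 0 → s * x = 0 := fun x hx => by
    rw [hs, sub_mul, mul_assoc, hx, smul_mul_assoc, hx, mul_zero, smul_zero, sub_zero]
  have hzmem : ∀ x ∈ Submodule.span k (Set.range n), z * x = 0 := by
    intro x hx
    induction hx using Submodule.span_induction with
    | mem x hx => obtain ⟨i, rfl⟩ := hx; rw [mul_comm, hz]
    | zero => exact mul_zero z
    | add x y _ _ hx hy => rw [mul_add, hx, hy, add_zero]
    | smul r x _ hx => rw [mul_smul_comm, hx, smul_zero]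
  have hzn : ∀ x, y * x = 0 → z * x = 0 := by
    intro x hx
    have h := hzmem (x - ψ x • n 0 ^ 2)
      (hspan _ (by rw [mul_sub, hx, mul_smul_comm, pow_two, ← mul_assoc, hyn]; simp)
        (by simp [hnn]))
    have h' : z * n 0 ^ 2 = 0 := by rw [pow_two, ← mul_assoc, mul_comm z, hz, zero_mul]
    rwa [mul_sub, mul_smul_comm, h', smul_zero, sub_zero] at h
  let e := ψ z / ψ s
  let d := (ψ (y * z) - e * ψ (y * s)) / ψ (y * y)
  have hez : e * ψ s = ψ z := div_mul_cancel₀ _ hψs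
  have hdz : d * ψ (y * y) = ψ (y * z) - e * ψ (y * s) := div_mul_cancel₀ _ hψyy
  have hzero : z - e • s - d • y = 0 := by
    refine hψ _ fun x => ?_
    obtain ⟨p, q, hm⟩ := exists_sub_mem_ann hy' x
    obtain ⟨m, hm', rfl⟩ : ∃ m, y * m = 0 ∧ x = m + p • 1 + q • y := ⟨_, hm, by abel⟩
    have hm0 : (z - e • s - d • y) * m = 0 := by
      rw [sub_mul, sub_mul, hzn m hm', smul_mul_assoc, hns m hm', smul_mul_assoc, hm']; simp
    have hm1 : ψ (z - e • s - d • y) = 0 := by simp [hez, hψy]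
    have hm2 : ψ ((z - e • s - d • y) * y) = 0 := by
      rw [mul_comm, mul_sub, mul_sub, mul_smul_comm, mul_smul_comm, map_sub, map_sub, map_smul,
        map_smul, smul_eq_mul, smul_eq_mul, hdz]
      ring
    rw [mul_add, mul_add, hm0, mul_smul_comm, mul_smul_comm, mul_one, map_add, map_add, map_zero,
      map_smul, map_smul, hm1, hm2]
    simp
  have hd : d = 0 := by
    have h := congrArg (y * ·) hzero
    simp only [mul_sub, mul_smul_comm, hyz, hys, mul_zero] at h
    have h' : (b - e * c) • y + (-d) • (y * y) = 0 := by
      rw [← h, sub_smul, mul_smul, neg_smul]; abel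
    exact neg_eq_zero.1 (smul_add_smul_eq_zero hy h').2
  refine ⟨-e, neg_ne_zero.2 (div_ne_zero hψz hψs), ?_⟩
  rwa [hd, zero_smul, sub_zero, sub_eq_add_neg, ← neg_smul] at hzero

/-- The products of distinct nᵢ and the differences of their squares are killed by y and by ψ, hence
are combinations of the nᵢ: these are the deformed quadrics. The value of f at the point kills every
nᵢ, since xᵢ f lies in the ideal of the quadrics, so it is a nonzero multiple of y² - βy; this
multiple gives g = γ(x₄ - βx₀). -/
theorem isItalian_of_element [IsAlgClosed k] (h2 : (2 : k) ≠ 0) (h3 : (3 : k) ≠ 0)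
    [Module.Finite k A] (h6 : Module.finrank k A = 6) {a : Fin 5 → A} (ha : LinearIndependent k a)
    {φ : A →ₗ[k] k} (hker : LinearMap.ker φ = Submodule.span k (Set.range a))
    (hφ : ∀ x, (∀ y, φ (x * y) = 0) → x = 0) {y : A} (hy : y * y ∉ Submodule.span k {y})
    (hy' : ∀ x, y * x ∈ Submodule.span k {y, y * y}) : IsItalian (vanishingForms (k := k) a) := by
  obtain ⟨w, hw1, hwy, hwyy⟩ := exists_unit_functional (by omega) hφ hy hy'
  let ψ : A →ₗ[k] k := φ ∘ₗ LinearMap.mulLeft k (w : A)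
  have hψapp : ∀ x, ψ x = φ (w * x) := fun x => rfl
  have hψ : ∀ x, (∀ y, ψ (x * y) = 0) → x = 0 := by
    intro x hx
    refine (Units.mul_right_eq_zero w).1 (hφ _ fun z => ?_)
    rw [mul_assoc]; exact hx z
  have hψ1 : ψ 1 = 0 := by rw [hψapp, mul_one, hw1]
  obtain ⟨n, hyn, hψn, hnn, hspan⟩ := exists_orthonormal h2 h6 hψ hy hy' hψ1 hwy hwyy
  have hψy : ψ y = 0 := hwy
  have hψyy : ψ (y * y) ≠ 0 := hwyy
  have hind6 : LinearIndependent k ![1, n 0, n 1, n 2, n 0 ^ 2, y] :=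
    linearIndependent_of_orthonormal hy hyn hψn hnn
  have hind5 : LinearIndependent k ![1, n 0, n 1, n 2, n 0 ^ 2] := by
    convert hind6.comp (Fin.castSucc : Fin 5 → Fin 6) (Fin.castSucc_injective 5) using 1
    ext i; fin_cases i <;> rfl
  have hindb : LinearIndependent k (spacePoint n y) := by
    convert hind6.comp (![0, 1, 2, 3, 5] : Fin 5 → Fin 6) (by decide) using 1
    ext i; fin_cases i <;> rfl
  obtain ⟨L, hrow⟩ : ∃ L : Matrix (Fin 3) (Fin 5) k, deformedRow L 1 (n 0) (n 1) (n 2) = 0 := by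
    refine exists_deformation fun j => hspan _ ?_ ?_
    · fin_cases j <;> simp [apolarRow, pow_two, mul_sub, ← mul_assoc, hyn]
    · fin_cases j <;> simp [apolarRow, pow_two, hnn]
  obtain ⟨H, hH⟩ := exists_deformedSyzygies hrow hind5
  obtain ⟨g₀, hg₀, hg₀n, hlast⟩ := exists_isLastComparison h2 h3 hH
  obtain ⟨c, β, hcβ⟩ := exists_sub_mem_ann hy' (y * y)
  obtain ⟨γ, hγ, hf⟩ : ∃ γ : k, γ ≠ 0 ∧
      aeval (planePoint n) (-X 3 ^ 2 + X 0 * g₀) + γ • (y * y - β • y) = 0 := by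
    obtain ⟨d, hd⟩ := exists_linear_coeffs hg₀
    have hz : aeval (planePoint n) (-X 3 ^ 2 + X 0 * g₀) =
        -(n 2 * n 2) + (d 0 • 1 + d 1 • n 0 + d 2 • n 1 + d 3 • n 2) := by
      rw [hd]
      simp [planePoint, Fin.sum_univ_four, Algebra.smul_def, pow_two]
    refine exists_add_smul_eq_zero (b := d 0) hψ hy hy' hψy hψyy hyn
      (by rw [pow_two, hnn, if_pos rfl]) hspan hcβ (fun i => ?_) ?_ ?_
    · have hi := hg₀n i
      change _ ∈ Ideal.span (Set.range (planeQuadrics L)) at hi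
      rw [← vanishingForms_plane hrow hind5, mem_vanishingForms_of_isHomogeneous _
        ((isHomogeneous_X k i.succ).mul (((isHomogeneous_X_pow 3 2).neg).add
          ((isHomogeneous_X k 0).mul hg₀))), map_mul, aeval_X] at hi
      rw [← hi]
      fin_cases i <;> rfl
    · rw [hz]
      simp [mul_add, hyn, ← mul_assoc]
    · rw [hz]
      simp [hnn, hψn, hψ1]
  have hrank : Module.finrank k (LinearMap.ker ψ) = 5 := by
    have := LinearMap.finrank_range_add_finrank_ker ψ
    rw [LinearMap.range_eq_top.2 (LinearMap.surjective fun h => hψyy (by rw [h]; rfl)), finrank_top,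
      Module.finrank_self] at this
    omega
  have hspanb : Submodule.span k (Set.range (spacePoint n y)) = LinearMap.ker ψ := by
    refine Submodule.eq_of_le_of_finrank_eq ?_ (by
      rw [finrank_span_eq_card hindb, hrank, Fintype.card_fin])
    rw [Submodule.span_le]
    rintro _ ⟨i, rfl⟩
    fin_cases i
    exacts [hψ1, hψn 0, hψn 1, hψn 2, hψy]
  -- The functional ψ = φ(w ·) has kernel w⁻¹V, so the coordinates are rescaled by w⁻¹ before
  -- comparing spans.
  let a' : Fin 5 → A := fun i => a i * (w⁻¹ : Aˣ)
  have ha' : LinearIndependent k a' := by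
    refine ha.map' (LinearMap.mulRight k ((w⁻¹ : Aˣ) : A)) (LinearMap.ker_eq_bot'.2 fun x hx => ?_)
    exact (Units.mul_left_eq_zero w⁻¹).1 hx
  have hspana : Submodule.span k (Set.range a') = LinearMap.ker ψ := by
    refine Submodule.eq_of_le_of_finrank_eq ?_ (by
      rw [finrank_span_eq_card ha', hrank, Fintype.card_fin])
    rw [Submodule.span_le]
    rintro _ ⟨i, rfl⟩
    change φ (w * (a i * (w⁻¹ : Aˣ))) = 0
    rw [mul_left_comm, Units.mul_inv, mul_one]
    change a i ∈ LinearMap.ker φ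
    rw [hker]
    exact Submodule.subset_span ⟨i, rfl⟩
  have hIt := vanishingForms_space hrow hind5
  refine ⟨Ideal.span (insert (X 4) (Set.range (spaceQuadrics L))), -X 3 ^ 2 + X 0 * g₀,
    C γ * (X 4 - C β * X 0), ?_, Ideal.subset_span (Or.inl rfl), ?_, hlast, ?_, ?_, ?_⟩
  · rw [← hIt]
    exact mem_hilbAG_space hrow hind5 hψ1 hψn hnn
  · rw [← hIt]
    exact vanishingForms_space_le_idealP hrow hind5
  · have h0 : (C β * X 0 : MvPolynomial (Fin 5) k).IsHomogeneous 1 := by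
      simpa using (isHomogeneous_C (Fin 5) β).mul (isHomogeneous_X k 0)
    simpa using (isHomogeneous_C (Fin 5) γ).mul ((isHomogeneous_X k 4).sub h0)
  · rintro ⟨G, hG⟩
    have e1 := congrArg (aeval (Pi.single 4 1 : Fin 5 → k)) hG
    have e2 := congrArg (aeval (0 : Fin 5 → k)) hG
    change aeval _ (inclHyperplane k G) = _ at e1 e2
    rw [aeval_inclHyperplane] at e1 e2
    have e3 : (fun i : Fin 4 => (Pi.single 4 1 : Fin 5 → k) i.castSucc) =
        fun i : Fin 4 => (0 : Fin 5 → k) i.castSucc := by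
      ext i; fin_cases i <;> simp
    rw [e3, e2] at e1
    simp at e1
    exact hγ e1.symm
  · rw [italianIdeal_eq_vanishingForms hrow hind6 hyn hg₀ hγ hf, ← vanishingForms_mul_unit a w⁻¹]
    exact projectivelyEquivalent_of_span_eq hindb ha' (hspanb.trans hspana.symm)

end Sufficiency

end

/-! ### Branch elements in algebras that are not local. -/

section SplitAlgebras

variable {k A : Type*} [Field k] [CommRing A] [Algebra k A]

/-- The condition that some `y` generates a two-dimensional ideal spanned by `y` and `y²`. -/
def HasBranchElement (k A : Type*) [Field k] [CommRing A] [Algebra k A] : Prop :=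
  ∃ y : A, y * y ∉ Submodule.span k {y} ∧ ∀ x, y * x ∈ Submodule.span k {y, y * y}

lemma eq_zero_of_smul_add_smul_eq_zero {V : Type*} [AddCommGroup V] [Module k V] {e w : V}
    (he : e ≠ 0) (hw : w ∉ Submodule.span k {e}) {s t : k} (h : s • w + t • e = 0) :
    s = 0 ∧ t = 0 := by
  have hs : s = 0 := by
    by_contra hs
    refine hw (Submodule.mem_span_singleton.2 ⟨-(s⁻¹ * t), ?_⟩)
    have : s⁻¹ • (s • w + t • e) = 0 := by rw [h, smul_zero]
    rw [smul_add, smul_smul, smul_smul, inv_mul_cancel₀ hs, one_smul] at this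
    rw [neg_smul, eq_comm]
    exact eq_neg_of_add_eq_zero_left this
  rw [hs, zero_smul, zero_add] at h
  exact ⟨hs, (smul_eq_zero.1 h).resolve_right he⟩

lemma range_mulLeft_le_of_mul_eq {e y : A} (h : e * y = y) :
    LinearMap.range (LinearMap.mulLeft k y) ≤ LinearMap.range (LinearMap.mulLeft k e) := by
  rintro _ ⟨x, rfl⟩
  exact ⟨y * x, by simp only [LinearMap.mulLeft_apply]; rw [← mul_assoc, h]⟩

lemma hasBranchElement_of_finrank_le_two [Module.Finite k A] {y : A}
    (hy : y * y ∉ Submodule.span k {y})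
    (h : Module.finrank k (LinearMap.range (LinearMap.mulLeft k y)) ≤ 2) :
    HasBranchElement k A := by
  have hind : LinearIndependent k ![y, y * y] := by
    rw [LinearIndependent.pair_iff]
    exact fun c d h => smul_add_smul_eq_zero hy h
  have hr : Set.range ![y, y * y] = {y, y * y} := by
    rw [Matrix.range_cons, Matrix.range_cons, Matrix.range_empty, Set.union_empty,
      Set.singleton_union]
  have heq : Submodule.span k {y, y * y} = LinearMap.range (LinearMap.mulLeft k y) := by
    refine Submodule.eq_of_le_of_finrank_le ?_ ?_
    · rw [Submodule.span_le]
      rintro _ (rfl | rfl)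
      · exact ⟨1, by simp⟩
      · exact ⟨y, by simp⟩
    · rwa [← hr, finrank_span_eq_card hind, Fintype.card_fin]
  exact ⟨y, hy, fun x => heq ▸ ⟨x, rfl⟩⟩

/-- A maximal ideal containing e has a nonzero annihilator z, and A acts on z through the residue
field k. -/
lemma exists_mul_eq_smul [IsAlgClosed k] [Module.Finite k A] {φ : A →ₗ[k] k}
    (hφ : ∀ x, (∀ y, φ (x * y) = 0) → x = 0) {e : A} (he : ¬ IsUnit e) :
    ∃ z : A, z ≠ 0 ∧ z * e = 0 ∧ ∀ x, ∃ c : k, z * x = c • z := by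
  obtain ⟨m, hm, hem⟩ := exists_max_ideal_of_mem_nonunits he
  obtain ⟨z, hz0, hz⟩ := exists_ne_zero_mul_eq_zero hφ hm.ne_top
  refine ⟨z, hz0, hz e hem, fun x => ?_⟩
  obtain ⟨c, hc⟩ := exists_scalar_sub_mem (k := k) m x
  have h := hz _ hc
  rw [mul_sub, sub_eq_zero] at h
  exact ⟨c, by rw [h, mul_comm, Algebra.smul_def]⟩

/-- If eA = ke, the sum of e and a multiple of a socle element z with ez = 0 generates ⟨e, z⟩.
Otherwise some w in eA is independent of e, and one of w, w + e, w + 2e has a square outside its own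
line. -/
lemma hasBranchElement_of_idempotent_le_two [IsAlgClosed k] (h2 : (2 : k) ≠ 0) [Module.Finite k A]
    (h6 : Module.finrank k A = 6) {φ : A →ₗ[k] k} (hφ : ∀ x, (∀ y, φ (x * y) = 0) → x = 0) {e : A}
    (he : e * e = e) (he0 : e ≠ 0)
    (h : Module.finrank k (LinearMap.range (LinearMap.mulLeft k e)) ≤ 2) :
    HasBranchElement k A := by
  by_cases hspan : ∀ x, e * x ∈ Submodule.span k {e}
  · have hu : ¬ IsUnit e := by
      intro hu
      have h1 : e = 1 := hu.mul_left_cancel (by rw [he, mul_one])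
      have : LinearMap.range (LinearMap.mulLeft k e) = ⊤ := by
        rw [h1, LinearMap.range_eq_top]
        exact fun x => ⟨x, one_mul x⟩
      rw [this, finrank_top] at h
      omega
    obtain ⟨z, hz0, hze, hz⟩ := exists_mul_eq_smul hφ hu
    have hzmem : z ∉ Submodule.span k {e} := by
      intro hmem
      obtain ⟨c, rfl⟩ := Submodule.mem_span_singleton.1 hmem
      rw [smul_mul_assoc, he] at hze
      exact hz0 hze
    obtain ⟨b, hb⟩ := hz z
    -- The square of e + r z is e + r²b z, which is independent of e + r z exactly when r²b ≠ r.
    obtain ⟨r, hr0, hr1⟩ : ∃ r : k, r ≠ 0 ∧ r * b ≠ 1 := by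
      by_cases hb1 : b = 1
      · exact ⟨2, h2, fun h => one_ne_zero (α := k) (by rw [hb1] at h; linear_combination h)⟩
      · exact ⟨1, one_ne_zero, by rwa [one_mul]⟩
    have hyy : (e + r • z) * (e + r • z) = e + (r * (r * b)) • z := by
      rw [add_mul, mul_add, mul_add, he, mul_smul_comm, mul_comm e z, hze, smul_mul_assoc, hze,
        smul_mul_smul_comm, hb, smul_smul, smul_zero, add_zero, zero_add, mul_assoc]
    have hdet : r * (r * b) - r ≠ 0 := fun h => hr1 (mul_left_cancel₀ hr0 (by linear_combination h))
    refine ⟨e + r • z, ?_, fun x => ?_⟩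
    · rw [hyy, Submodule.mem_span_singleton]
      rintro ⟨c, hc⟩
      have h0 : (c * r - r * (r * b)) • z + (c - 1) • e = 0 := by
        rw [sub_smul, sub_smul, one_smul, mul_smul]
        rw [smul_add] at hc
        linear_combination (exp := 1) hc
      obtain ⟨h1, h3⟩ := eq_zero_of_smul_add_smul_eq_zero he0 hzmem h0
      exact hdet (by linear_combination r * h3 - h1)
    · rw [hyy]
      obtain ⟨c, hc⟩ := Submodule.mem_span_singleton.1 (hspan x)
      obtain ⟨d, hd⟩ := hz x
      have hmz : z ∈ Submodule.span k {e + r • z, e + (r * (r * b)) • z} := by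
        refine Submodule.mem_span_pair.2
          ⟨-(r * (r * b) - r)⁻¹, (r * (r * b) - r)⁻¹, ?_⟩
        rw [neg_smul, neg_add_eq_sub, ← smul_sub, add_sub_add_left_eq_sub, ← sub_smul,
          smul_smul, inv_mul_cancel₀ hdet, one_smul]
      have hme : e ∈ Submodule.span k {e + r • z, e + (r * (r * b)) • z} := by
        have := Submodule.sub_mem _ (Submodule.subset_span (R := k)
          (show e + r • z ∈ ({e + r • z, e + (r * (r * b)) • z} : Set A) from Or.inl rfl))
          (Submodule.smul_mem _ r hmz)
        rwa [add_sub_cancel_right] at this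
      rw [add_mul, smul_mul_assoc, ← hc, hd]
      exact add_mem (Submodule.smul_mem _ _ hme)
        (Submodule.smul_mem _ _ (Submodule.smul_mem _ _ hmz))
  · push Not at hspan
    obtain ⟨x, hx⟩ := hspan
    by_contra hno
    have hsq : ∀ y, e * y = y → ∃ c : k, y * y = c • y := by
      intro y hy
      by_contra hcon
      refine hno (hasBranchElement_of_finrank_le_two (y := y) ?_
        ((Submodule.finrank_mono (range_mulLeft_le_of_mul_eq hy)).trans h))
      rw [Submodule.mem_span_singleton]
      rintro ⟨c, hc⟩
      exact hcon ⟨c, hc.symm⟩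
    set w := e * x with hw
    have hew : e * w = w := by rw [hw, ← mul_assoc, he]
    obtain ⟨a, ha⟩ := hsq w hew
    obtain ⟨b, hb⟩ := hsq (w + e) (by rw [mul_add, hew, he])
    obtain ⟨c, hc⟩ := hsq (w + (2 : k) • e) (by rw [mul_add, hew, mul_smul_comm, he])
    have e1 : (a + 2 - b) • w + (1 - b) • e = 0 := by
      have h1 : (w + e) * (w + e) = w * w + (2 : k) • w + e := by
        rw [add_mul, mul_add, mul_add, mul_comm w e, hew, he, two_smul]; abel
      rw [h1, ha, ← sub_eq_zero] at hb
      rw [← hb, smul_add, sub_smul, add_smul, sub_smul, one_smul]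
      abel
    have e2 : (a + 4 - c) • w + (4 - c * 2) • e = 0 := by
      have h1 : (w + (2 : k) • e) * (w + (2 : k) • e) = w * w + (4 : k) • w + (4 : k) • e := by
        rw [add_mul, mul_add, mul_add, mul_smul_comm, smul_mul_assoc, smul_mul_smul_comm,
          mul_comm w e, hew, he, show (4 : k) = 2 + 2 by norm_num, show (2 : k) * 2 = 2 + 2 by
          norm_num, add_smul (2 : k) 2 w]
        abel
      rw [h1, ha, ← sub_eq_zero] at hc
      rw [← hc, smul_add, smul_smul, sub_smul, add_smul, sub_smul]
      abel
    obtain ⟨f1, f2⟩ := eq_zero_of_smul_add_smul_eq_zero he0 hx e1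
    obtain ⟨f3, f4⟩ := eq_zero_of_smul_add_smul_eq_zero he0 hx e2
    have hc2 : c = 2 := mul_right_cancel₀ h2 (by linear_combination -f4)
    exact one_ne_zero (α := k) (by linear_combination f3 - f1 + f2 + hc2)

/-- In dimension 3 without a branch element, the elements F of eA in a maximal ideal avoiding e
multiply to zero. Then φ is injective on F, so dim F ≤ 1 and dim eA ≤ 2, a contradiction. -/
lemma hasBranchElement_of_idempotent [IsAlgClosed k] (h2 : (2 : k) ≠ 0) [Module.Finite k A]
    (h6 : Module.finrank k A = 6) {φ : A →ₗ[k] k} (hφ : ∀ x, (∀ y, φ (x * y) = 0) → x = 0) {e : A}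
    (he : e * e = e) (he0 : e ≠ 0)
    (h : Module.finrank k (LinearMap.range (LinearMap.mulLeft k e)) ≤ 3) :
    HasBranchElement k A := by
  by_contra hno
  set E := LinearMap.range (LinearMap.mulLeft k e) with hE
  have h3 : Module.finrank k E = 3 := by
    by_contra h3
    exact hno (hasBranchElement_of_idempotent_le_two h2 h6 hφ he he0 (by rw [← hE]; omega))
  -- Without a branch element such a y satisfies y² = c y; if c y ≠ 0, then y/c is an idempotent
  -- whose ideal has dimension at most two, already treated.
  have hsing : ∀ y, e * y = y →
      Module.finrank k (LinearMap.range (LinearMap.mulLeft k y)) ≤ 2 → y * y = 0 := by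
    intro y hy hle
    have hmem : y * y ∈ Submodule.span k {y} := by
      by_contra hmem
      exact hno (hasBranchElement_of_finrank_le_two hmem hle)
    obtain ⟨c, hc⟩ := Submodule.mem_span_singleton.1 hmem
    by_contra hyy
    have hc0 : c ≠ 0 := by
      rintro rfl
      exact hyy (by rw [← hc, zero_smul])
    refine hno (hasBranchElement_of_idempotent_le_two h2 h6 hφ (e := c⁻¹ • y) ?_ ?_
      ((Submodule.finrank_mono ?_).trans hle))
    · rw [smul_mul_smul_comm, ← hc, smul_smul, mul_assoc, inv_mul_cancel₀ hc0, mul_one]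
    · rw [smul_ne_zero_iff]
      exact ⟨inv_ne_zero hc0, fun h => hyy (by rw [h, zero_mul])⟩
    · rintro _ ⟨x, rfl⟩
      exact ⟨c⁻¹ • x, by simp⟩
  obtain ⟨m, hm, hem⟩ := exists_max_ideal_of_mem_nonunits (a := 1 - e) (by
    intro hu
    refine he0 (hu.mul_right_cancel ?_)
    rw [mul_sub, he, mul_one, sub_self, zero_mul])
  have hem' : e ∉ m := fun h => hm.ne_top ((Ideal.eq_top_iff_one m).2 (by
    simpa using m.add_mem hem h))
  have hEmem : ∀ y, y ∈ E ↔ e * y = y := by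
    intro y
    refine ⟨?_, fun hy => ⟨y, hy⟩⟩
    rintro ⟨x, rfl⟩
    rw [LinearMap.mulLeft_apply, ← mul_assoc, he]
  let F : Submodule k A := E ⊓ m.restrictScalars k
  have hsq : ∀ y ∈ F, y * y = 0 := by
    intro y hy
    refine hsing y ((hEmem y).1 hy.1) ?_
    have hlt : LinearMap.range (LinearMap.mulLeft k y) < E := by
      refine lt_of_le_of_ne (range_mulLeft_le_of_mul_eq ((hEmem y).1 hy.1)) fun heq => ?_
      obtain ⟨x, hx⟩ : e ∈ LinearMap.range (LinearMap.mulLeft k y) := by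
        rw [heq]; exact (hEmem e).2 he
      exact hem' (hx ▸ m.mul_mem_right x hy.2)
    have := Submodule.finrank_lt_finrank_of_lt hlt
    omega
  have hmul : ∀ y ∈ F, ∀ z ∈ F, y * z = 0 := by
    intro y hy z hz
    have h := hsq _ (F.add_mem hy hz)
    rw [add_mul, mul_add, mul_add, hsq y hy, hsq z hz, zero_add, add_zero, mul_comm z y,
      ← two_smul k] at h
    exact (smul_eq_zero.1 h).resolve_left h2
  have hdec : ∀ x, ∃ c : k, e * x - c • e ∈ F := by
    intro x
    obtain ⟨c, hc⟩ := exists_scalar_sub_mem (k := k) m x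
    have heq : e * x - c • e = e * (x - algebraMap k A c) := by
      rw [mul_sub, Algebra.smul_def, mul_comm e (algebraMap k A c)]
    exact ⟨c, ⟨_, heq.symm⟩, heq ▸ m.mul_mem_left e hc⟩
  have hinj : ∀ y ∈ F, φ y = 0 → y = 0 := by
    intro y hy hφy
    refine hφ y fun x => ?_
    obtain ⟨c, hc⟩ := hdec x
    have h1 := hmul y hy _ hc
    rw [mul_sub, mul_smul_comm, mul_comm y e, (hEmem y).1 hy.1, mul_left_comm, ← mul_assoc,
      (hEmem y).1 hy.1, sub_eq_zero] at h1
    rw [h1, map_smul, hφy, smul_zero]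
  have hF1 : Module.finrank k F ≤ 1 := by
    have := LinearMap.finrank_le_finrank_of_injective (f := φ ∘ₗ F.subtype) (by
      rw [injective_iff_map_eq_zero]
      exact fun y hy => Subtype.ext (hinj y y.2 hy))
    rwa [Module.finrank_self] at this
  have hEle : E ≤ Submodule.span k {e} ⊔ F := by
    rintro y hy
    obtain ⟨c, hc⟩ := hdec y
    rw [(hEmem y).1 hy] at hc
    exact Submodule.mem_sup.2 ⟨c • e, Submodule.smul_mem _ _ (Submodule.mem_span_singleton_self e),
      _, hc, by abel⟩
  have h4 := (Submodule.finrank_mono hEle).trans (Submodule.finrank_add_le_finrank_add_finrank _ _)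
  rw [h3, finrank_span_singleton he0] at h4
  omega

/-- Stabilization of the ideals (xⁿ) yields a nontrivial idempotent e, and one of eA, (1 - e)A has
dimension at most 3. -/
lemma hasBranchElement_of_not_unit_or_nilpotent [IsAlgClosed k] (h2 : (2 : k) ≠ 0)
    [Module.Finite k A] (h6 : Module.finrank k A = 6) {φ : A →ₗ[k] k}
    (hφ : ∀ x, (∀ y, φ (x * y) = 0) → x = 0) {x : A} (hu : ¬ IsUnit x) (hn : ¬ IsNilpotent x) :
    HasBranchElement k A := by
  have : IsArtinianRing A := IsArtinianRing.of_finite k A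
  obtain ⟨n, b, hb⟩ := IsArtinian.exists_pow_succ_smul_dvd x (1 : A)
  simp only [smul_eq_mul, mul_one] at hb
  have hpow : ∀ j, x ^ n = x ^ (n + j) * b ^ j := by
    intro j
    induction j with
    | zero => simp
    | succ j ih =>
      calc x ^ n = x ^ n.succ * b := hb.symm
        _ = x ^ n * (x * b) := by rw [pow_succ]; ring
        _ = x ^ (n + j) * b ^ j * (x * b) := by rw [← ih]
        _ = _ := by ring
  set e := x ^ n * b ^ n with he
  have hxe : x ^ n * e = x ^ n := by rw [he, ← mul_assoc, ← pow_add]; exact (hpow n).symm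
  have hee : e * e = e := by
    calc e * e = x ^ n * e * b ^ n := by rw [he]; ring
      _ = e := by rw [hxe]
  have he0 : e ≠ 0 := fun h => hn ⟨n, by rw [← hxe, h, mul_zero]⟩
  have he1 : 1 - e ≠ 0 := by
    intro h
    rcases Nat.eq_zero_or_pos n with rfl | hpos
    · rw [pow_zero, Nat.succ_eq_add_one, zero_add, pow_one] at hb
      exact hu (IsUnit.of_mul_eq_one _ hb)
    · refine hu (isUnit_of_dvd_one ?_)
      rw [sub_eq_zero.1 h]
      exact (dvd_pow_self x hpos.ne').mul_right _
  have hle : LinearMap.range (LinearMap.mulLeft k (1 - e)) ≤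
      LinearMap.ker (LinearMap.mulLeft k e) := by
    rintro _ ⟨z, rfl⟩
    rw [LinearMap.mem_ker, LinearMap.mulLeft_apply, LinearMap.mulLeft_apply, ← mul_assoc, mul_sub,
      mul_one, hee, sub_self, zero_mul]
  have h1 := Submodule.finrank_mono hle
  have h3 := LinearMap.finrank_range_add_finrank_ker (LinearMap.mulLeft k e)
  by_cases h : Module.finrank k (LinearMap.range (LinearMap.mulLeft k e)) ≤ 3
  · exact hasBranchElement_of_idempotent h2 h6 hφ hee he0 h
  · refine hasBranchElement_of_idempotent h2 h6 hφ (e := 1 - e) ?_ he1 (by omega)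
    rw [mul_sub, sub_mul, sub_mul, hee]
    ring

end SplitAlgebras

section

open MvPolynomial

/-! ### Presentations of local algebras by generators. -/

section GeneratingLocalAlgebras

variable {k A : Type*} [Field k] [CommRing A] [Algebra k A]

/-- Generators of a nilpotent maximal ideal modulo its square generate the algebra. -/
lemma adjoin_eq_top_of_le_sup_sq {m : Ideal A} (hm : IsNilpotent m)
    (hres : ∀ x : A, ∃ c : k, x - algebraMap k A c ∈ m) {s : Set A} (hs : s ⊆ m)
    (hgen : ∀ x ∈ m, ∃ l ∈ Submodule.span k s, x - l ∈ m ^ 2) : Algebra.adjoin k s = ⊤ := by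
  have hsm : ∀ l ∈ Submodule.span k s, l ∈ m ∧ l ∈ Algebra.adjoin k s := by
    intro l hl
    refine ⟨?_, Algebra.span_le_adjoin k s hl⟩
    have : Submodule.span k s ≤ m.restrictScalars k := Submodule.span_le.2 hs
    exact this hl
  have hpow : ∀ n, ∀ x ∈ m ^ n, ∃ b ∈ Algebra.adjoin k s, b ∈ m ^ n ∧ x - b ∈ m ^ (n + 1) := by
    intro n
    induction n with
    | zero =>
      intro x _
      obtain ⟨c, hc⟩ := hres x
      exact ⟨_, Subalgebra.algebraMap_mem _ c, by simp, by simpa using hc⟩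
    | succ n ih =>
      intro x hx
      rw [pow_succ] at hx
      induction hx using Submodule.mul_induction_on' with
      | mem_mul_mem a ha b hb =>
        obtain ⟨a', ha', ham, haa⟩ := ih a ha
        obtain ⟨l, hl, hbl⟩ := hgen b hb
        obtain ⟨hlm, hl'⟩ := hsm l hl
        refine ⟨a' * l, mul_mem ha' hl', ?_, ?_⟩
        · rw [pow_succ]
          exact Ideal.mul_mem_mul ham hlm
        · have h1 : (a - a') * b ∈ m ^ (n + 1 + 1) := by
            rw [pow_succ m (n + 1)]
            exact Ideal.mul_mem_mul haa hb
          have h2 : a' * (b - l) ∈ m ^ (n + 1 + 1) := by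
            rw [add_assoc, pow_add]
            exact Ideal.mul_mem_mul ham hbl
          have := add_mem h1 h2
          rwa [show (a - a') * b + a' * (b - l) = a * b - a' * l by ring] at this
      | add x _ y _ hx hy =>
        obtain ⟨b, hb, hbm, hxb⟩ := hx
        obtain ⟨c, hc, hcm, hyc⟩ := hy
        refine ⟨b + c, add_mem hb hc, add_mem hbm hcm, ?_⟩
        rw [add_sub_add_comm]
        exact add_mem hxb hyc
  have happrox : ∀ n, ∀ x, ∃ b ∈ Algebra.adjoin k s, x - b ∈ m ^ n := by
    intro n
    induction n with
    | zero => exact fun x => ⟨0, zero_mem _, by simp⟩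
    | succ n ih =>
      intro x
      obtain ⟨b, hb, hxb⟩ := ih x
      obtain ⟨c, hc, -, hxc⟩ := hpow n _ hxb
      exact ⟨b + c, add_mem hb hc, by rwa [← sub_sub]⟩
  obtain ⟨N, hN⟩ := hm
  rw [eq_top_iff]
  intro x _
  obtain ⟨b, hb, hxb⟩ := happrox N x
  rw [hN, Ideal.zero_eq_bot, Ideal.mem_bot, sub_eq_zero] at hxb
  exact hxb ▸ hb

lemma surjective_aeval_of_adjoin {x : Fin 2 → A} (h : Algebra.adjoin k (Set.range x) = ⊤) :
    Function.Surjective (aeval x : MvPolynomial (Fin 2) k →ₐ[k] A) := by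
  rw [← AlgHom.range_eq_top, ← Algebra.adjoin_range_eq_range_aeval, h]

lemma nonempty_algEquiv_of_surjective {B : Type*} [CommRing B] [Algebra k B] [Module.Finite k B]
    [Module.Finite k A] {f : B →ₐ[k] A} (hf : Function.Surjective f)
    (h : Module.finrank k B ≤ Module.finrank k A) : Nonempty (A ≃ₐ[k] B) := by
  have heq : Module.finrank k B = Module.finrank k A :=
    le_antisymm h (LinearMap.finrank_le_finrank_of_surjective (f := f.toLinearMap) hf)
  have hinj := (LinearMap.injective_iff_surjective_of_finrank_eq_finrank
    (f := f.toLinearMap) heq).2 hf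
  exact ⟨(AlgEquiv.ofBijective f ⟨hinj, hf⟩).symm⟩

lemma finite_and_finrank_le_six {B : Type*} [CommRing B] [Algebra k B] {x : Fin 2 → B}
    (hgen : Function.Surjective (aeval x : MvPolynomial (Fin 2) k →ₐ[k] B)) {e : k}
    (h3 : x 0 ^ 3 = 0) (h2 : x 1 ^ 2 = e • x 0 ^ 2) :
    Module.Finite k B ∧ Module.finrank k B ≤ 6 := by
  let v : Fin 6 → B := ![1, x 0, x 1, x 0 ^ 2, x 0 * x 1, x 0 ^ 2 * x 1]
  have hv : Submodule.span k (Set.range v) = ⊤ := by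
    rw [eq_top_iff]
    intro z _
    obtain ⟨c, hc⟩ := exists_normal_form hgen h3 h2 z
    rw [Submodule.mem_span_range_iff_exists_fun]
    exact ⟨c, by rw [hc, Fin.sum_univ_six]; rfl⟩
  refine ⟨⟨by rw [← hv]; exact Submodule.fg_span (Set.finite_range v)⟩, ?_⟩
  have := finrank_range_le_card (R := k) v
  rwa [Set.finrank, hv, finrank_top, Fintype.card_fin] at this

lemma nonempty_algEquiv_A1sp [Module.Finite k A] (h6 : Module.finrank k A = 6) {x : Fin 2 → A}
    (hgen : Algebra.adjoin k (Set.range x) = ⊤) (h3 : x 0 ^ 3 = 0) (h2 : x 1 ^ 2 = 0) :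
    Nonempty (A ≃ₐ[k] A1sp k) := by
  obtain ⟨hfin, hle⟩ := finite_and_finrank_le_six (surjective_aeval_mk _)
    (A1sp_relations (k := k)).1 A1sp_relations.2
  let f : A1sp k →ₐ[k] A := Ideal.Quotient.liftₐ _ (aeval x) (by
    intro F hF
    rw [← RingHom.mem_ker]
    refine (Ideal.span_le.2 ?_ : _ ≤ RingHom.ker (aeval x)) hF
    rintro _ (rfl | rfl) <;> simp [RingHom.mem_ker, h2, h3])
  refine nonempty_algEquiv_of_surjective (f := f) (fun z => ?_) (hle.trans h6.ge)
  obtain ⟨F, rfl⟩ := surjective_aeval_of_adjoin hgen z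
  exact ⟨Ideal.Quotient.mk _ F, rfl⟩

lemma nonempty_algEquiv_A2sp [Module.Finite k A] (h6 : Module.finrank k A = 6) {x : Fin 2 → A}
    (hgen : Algebra.adjoin k (Set.range x) = ⊤) (h3 : x 0 ^ 3 = 0) (h2 : x 1 ^ 2 = x 0 ^ 2) :
    Nonempty (A ≃ₐ[k] A2sp k) := by
  obtain ⟨hfin, hle⟩ := finite_and_finrank_le_six (surjective_aeval_mk _)
    (A2sp_relations (k := k)).1 A2sp_relations.2
  let f : A2sp k →ₐ[k] A := Ideal.Quotient.liftₐ _ (aeval x) (by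
    intro F hF
    rw [← RingHom.mem_ker]
    refine (Ideal.span_le.2 ?_ : _ ≤ RingHom.ker (aeval x)) hF
    rintro _ (rfl | rfl) <;> simp [RingHom.mem_ker, h2, h3])
  refine nonempty_algEquiv_of_surjective (f := f) (fun z => ?_) (hle.trans h6.ge)
  obtain ⟨F, rfl⟩ := surjective_aeval_of_adjoin hgen z
  exact ⟨Ideal.Quotient.mk _ F, rfl⟩

lemma pow_finrank_eq_zero_of_isNilpotent [Module.Finite k A] {u : A} (hu : IsNilpotent u) :
    u ^ Module.finrank k A = 0 := by
  obtain ⟨n, hn⟩ := hu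
  have h : (1 : A) ∈ LinearMap.ker (LinearMap.mulLeft k u ^ Module.finrank k A) :=
    Module.End.ker_pow_le_ker_pow_finrank _ n (by simp [LinearMap.pow_mulLeft, hn])
  simpa [LinearMap.pow_mulLeft] using h

lemma nonempty_algEquiv_A16 [Module.Finite k A] (h6 : Module.finrank k A = 6) {u : A}
    (hgen : Algebra.adjoin k {u} = ⊤) (hu : IsNilpotent u) : Nonempty (A ≃ₐ[k] A16 k) := by
  have hu6 : u ^ 6 = 0 := h6 ▸ pow_finrank_eq_zero_of_isNilpotent hu
  have hmonic : (Polynomial.X ^ 6 : Polynomial k).Monic := Polynomial.monic_X_pow 6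
  have : Module.Finite k (A16 k) := hmonic.finite_quotient
  have hfin : Module.finrank k (A16 k) = 6 := by
    rw [finrank_quotient_span_eq_natDegree, Polynomial.natDegree_X_pow]
  let f : A16 k →ₐ[k] A := Ideal.Quotient.liftₐ _ (Polynomial.aeval u) (by
    intro F hF
    obtain ⟨G, rfl⟩ := Ideal.mem_span_singleton'.1 hF
    simp [hu6])
  refine nonempty_algEquiv_of_surjective (f := f) (fun z => ?_) (hfin.trans h6.symm).le
  have hz : z ∈ Algebra.adjoin k {u} := by rw [hgen]; trivial
  rw [Algebra.adjoin_singleton_eq_range_aeval] at hz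
  obtain ⟨F, rfl⟩ := hz
  exact ⟨Ideal.Quotient.mk _ F, rfl⟩

end GeneratingLocalAlgebras

end

/-! ### Classification of the local algebras without a branch element. -/

section LocalAlgebras

variable {k A : Type*} [Field k] [CommRing A] [Algebra k A]

/-- Since y kills m², the products y m lie in the socle line, which y² spans; so yA = ⟨y, y²⟩. -/
lemma hasBranchElement_of_sq_ne_zero {m : Ideal A}
    (hres : ∀ x : A, ∃ c : k, x - algebraMap k A c ∈ m) {s : A}
    (hs : ∀ z, (∀ x ∈ m, z * x = 0) → ∃ c : k, z = c • s) {y : A} (hym : y ∈ m)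
    (hy : ∀ x ∈ m ^ 2, y * x = 0) (hyy : y * y ≠ 0) : HasBranchElement k A := by
  have hmul : ∀ x ∈ m, ∃ c : k, y * x = c • (y * y) := by
    have h (x : A) (hx : x ∈ m) : ∃ c : k, y * x = c • s := hs _ fun z hz => by
      rw [mul_assoc]
      exact hy _ (by rw [pow_two]; exact Ideal.mul_mem_mul hx hz)
    intro x hx
    obtain ⟨c, hc⟩ := h x hx
    obtain ⟨d, hd⟩ := h y hym
    have hd0 : d ≠ 0 := by
      rintro rfl
      exact hyy (by rw [hd, zero_smul])
    exact ⟨c / d, by rw [hc, hd, smul_smul, div_mul_cancel₀ _ hd0]⟩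
  refine ⟨y, fun hmem => ?_, fun x => ?_⟩
  · obtain ⟨c, hc⟩ := Submodule.mem_span_singleton.1 hmem
    have hyyy : y * y * y = 0 := by
      rw [mul_assoc]; exact hy _ (by rw [pow_two]; exact Ideal.mul_mem_mul hym hym)
    rw [← hc, smul_mul_assoc, smul_eq_zero] at hyyy
    rcases hyyy with rfl | h
    · exact hyy (by rw [← hc, zero_smul])
    · exact hyy h
  · obtain ⟨c, hc⟩ := hres x
    obtain ⟨d, hd⟩ := hmul _ hc
    rw [mul_sub, sub_eq_iff_eq_add, mul_comm y (algebraMap k A c), ← Algebra.smul_def] at hd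
    exact Submodule.mem_span_pair.2 ⟨c, d, by rw [hd, add_comm]⟩

/-! ### Hilbert function (1, 2, 2, 1). -/

section CubicAlgebras

variable {m : Ideal A} {s u v : A}

lemma generates_of_change (hgen : ∀ x ∈ m, ∃ a b : k, x - (a • u + b • v) ∈ m ^ 2) {u' v' : A}
    {α β γ δ : k} (hu : u - (α • u' + β • v') ∈ m ^ 2) (hv : v - (γ • u' + δ • v') ∈ m ^ 2) :
    ∀ x ∈ m, ∃ a b : k, x - (a • u' + b • v') ∈ m ^ 2 := by
  intro x hx
  obtain ⟨a, b, h⟩ := hgen x hx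
  refine ⟨a * α + b * γ, a * β + b * δ, ?_⟩
  have := add_mem h (add_mem ((m ^ 2).smul_of_tower_mem a hu) ((m ^ 2).smul_of_tower_mem b hv))
  convert this using 1
  module

lemma adjoin_range_eq_top (hm : IsNilpotent m)
    (hres : ∀ x : A, ∃ c : k, x - algebraMap k A c ∈ m) (hu : u ∈ m) (hv : v ∈ m)
    (hgen : ∀ x ∈ m, ∃ a b : k, x - (a • u + b • v) ∈ m ^ 2) :
    Algebra.adjoin k (Set.range ![u, v]) = ⊤ := by
  refine adjoin_eq_top_of_le_sup_sq hm hres ?_ fun x hx => ?_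
  · rintro _ ⟨i, rfl⟩
    fin_cases i
    exacts [hu, hv]
  · obtain ⟨a, b, h⟩ := hgen x hx
    exact ⟨_, add_mem (Submodule.smul_mem _ a (Submodule.subset_span ⟨0, rfl⟩))
      (Submodule.smul_mem _ b (Submodule.subset_span ⟨1, rfl⟩)), h⟩

lemma exists_eq_of_mem_sq (hsoc : ∀ x ∈ m, ∀ q ∈ m ^ 2, ∃ c : k, x * q = c • s)
    (hu : u ∈ m) (hv : v ∈ m) (hgen : ∀ x ∈ m, ∃ a b : k, x - (a • u + b • v) ∈ m ^ 2) :
    ∀ q ∈ m ^ 2, ∃ a b c d : k, q = a • (u * u) + b • (u * v) + c • (v * v) + d • s := by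
  intro q hq
  rw [pow_two] at hq
  induction hq using Submodule.mul_induction_on' with
  | mem_mul_mem x hx y hy =>
    obtain ⟨a, b, h⟩ := hgen x hx
    obtain ⟨a', b', h'⟩ := hgen y hy
    obtain ⟨c, hc⟩ := hsoc y hy _ h
    obtain ⟨c', hc'⟩ := hsoc (a • u + b • v)
      (add_mem (m.smul_of_tower_mem a hu) (m.smul_of_tower_mem b hv)) _ h'
    refine ⟨a * a', a * b' + b * a', b * b', c + c', ?_⟩
    rw [add_smul c c' s, ← hc, ← hc']
    simp only [Algebra.smul_def, map_add, map_mul]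
    ring
  | add x _ y _ hx hy =>
    obtain ⟨a, b, c, d, rfl⟩ := hx
    obtain ⟨a', b', c', d', rfl⟩ := hy
    exact ⟨a + a', b + b', c + c', d + d', by module⟩

lemma exists_eq_smul_of_mul_eq_zero (hsq : ∀ x ∈ m ^ 2, ∀ y ∈ m ^ 2, x * y = 0)
    (hs : ∀ z, (∀ x ∈ m, z * x = 0) → ∃ c : k, z = c • s)
    (hgen : ∀ x ∈ m, ∃ a b : k, x - (a • u + b • v) ∈ m ^ 2) {z : A} (hz : z ∈ m ^ 2)
    (hzu : z * u = 0) (hzv : z * v = 0) : ∃ c : k, z = c • s := by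
  refine hs z fun x hx => ?_
  obtain ⟨a, b, h⟩ := hgen x hx
  have h := hsq z hz _ h
  rwa [mul_sub, mul_add, mul_smul_comm, mul_smul_comm, hzu, hzv, smul_zero, smul_zero, add_zero,
    sub_zero] at h

lemma not_forall_mem_sq_of_finrank (hdim : Module.finrank k ((m ^ 2).restrictScalars k) = 3)
    (p q : A) : ¬ ∀ x ∈ m ^ 2, ∃ a b : k, x = a • p + b • q := by
  intro h
  have hle : (m ^ 2).restrictScalars k ≤ Submodule.span k (Set.range ![p, q]) := by
    intro x hx
    obtain ⟨a, b, rfl⟩ := h x hx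
    exact add_mem (Submodule.smul_mem _ a (Submodule.subset_span ⟨0, rfl⟩))
      (Submodule.smul_mem _ b (Submodule.subset_span ⟨1, rfl⟩))
  have := FiniteDimensional.span_of_finite k (Set.finite_range ![p, q])
  have h1 := Submodule.finrank_mono hle
  have h2 := finrank_range_le_card (R := k) ![p, q]
  rw [Set.finrank, Fintype.card_fin] at h2
  omega

lemma mul_mem_sq {x y : A} (hx : x ∈ m) (hy : y ∈ m) : x * y ∈ m ^ 2 := by
  rw [pow_two]; exact Ideal.mul_mem_mul hx hy

/-- Two distinct factors: correct v by an element of m² to get uv' = 0, and scale so that u³ + v'³ =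
0. Then u + v' has cube zero and u ± v' have equal squares. -/
lemma nonempty_algEquiv_A2sp_of_generators [IsAlgClosed k] (h2 : (2 : k) ≠ 0)
    [Module.Finite k A] (h6 : Module.finrank k A = 6) (hm : IsNilpotent m)
    (hres : ∀ x : A, ∃ c : k, x - algebraMap k A c ∈ m)
    (hsm : ∀ x ∈ m, s * x = 0) (hs : ∀ z, (∀ x ∈ m, z * x = 0) → ∃ c : k, z = c • s)
    (hsq : ∀ x ∈ m ^ 2, ∀ y ∈ m ^ 2, x * y = 0)
    (hsoc : ∀ x ∈ m, ∀ q ∈ m ^ 2, ∃ c : k, x * q = c • s)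
    (hdim : ∀ p q : A, ¬ ∀ x ∈ m ^ 2, ∃ a b : k, x = a • p + b • q)
    (hu : u ∈ m) (hv : v ∈ m) (hgen : ∀ x ∈ m, ∃ a b : k, x - (a • u + b • v) ∈ m ^ 2)
    {r : k} (huv : u * v = r • s) : Nonempty (A ≃ₐ[k] A2sp k) := by
  have hspan := exists_eq_of_mem_sq hsoc hu hv hgen
  have huu := mul_mem_sq hu hu
  have hvv := mul_mem_sq hv hv
  have huuv : u * u * v = 0 := by
    rw [mul_assoc, huv, mul_smul_comm, mul_comm u s, hsm u hu, smul_zero]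
  have hvvu : v * v * u = 0 := by
    rw [mul_assoc, mul_comm v u, huv, mul_smul_comm, mul_comm v s, hsm v hv, smul_zero]
  obtain ⟨α, hα⟩ := hsoc u hu _ huu
  obtain ⟨β, hβ⟩ := hsoc v hv _ hvv
  -- If u³ = 0 then u² lies in the socle, and v² and s would span the three-dimensional m².
  have hα0 : α ≠ 0 := by
    rintro rfl
    rw [zero_smul, mul_comm] at hα
    obtain ⟨c, hc⟩ := exists_eq_smul_of_mul_eq_zero hsq hs hgen huu hα huuv
    refine hdim (v * v) s fun x hx => ?_
    obtain ⟨a, b, d, f, rfl⟩ := hspan x hx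
    exact ⟨d, a * c + b * r + f, by rw [hc, huv]; module⟩
  have hβ0 : β ≠ 0 := by
    rintro rfl
    rw [zero_smul, mul_comm] at hβ
    obtain ⟨c, hc⟩ := exists_eq_smul_of_mul_eq_zero hsq hs hgen hvv hvvu hβ
    refine hdim (u * u) s fun x hx => ?_
    obtain ⟨a, b, d, f, rfl⟩ := hspan x hx
    exact ⟨a, b * r + d * c + f, by rw [hc, huv]; module⟩
  obtain ⟨μ, hμ⟩ := IsAlgClosed.exists_pow_nat_eq (-α / β) (n := 3) (by norm_num)
  have hμβ : μ ^ 3 * β = -α := by rw [hμ, div_mul_cancel₀ _ hβ0]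
  have hμ0 : μ ≠ 0 := by
    rintro rfl
    rw [zero_pow three_ne_zero, zero_mul] at hμβ
    exact hα0 (neg_eq_zero.1 hμβ.symm)
  obtain ⟨w, hw, huw⟩ : ∃ w ∈ m ^ 2, u * w = r • s :=
    ⟨(r / α) • (u * u), (m ^ 2).smul_of_tower_mem _ huu, by
      rw [mul_smul_comm, hα, smul_smul, div_mul_cancel₀ _ hα0]⟩
  have hwm : w ∈ m := Ideal.pow_le_self two_ne_zero hw
  set v' := μ • (v - w) with hv'
  have hv'm : v' ∈ m := m.smul_of_tower_mem _ (sub_mem hv hwm)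
  have huv' : u * v' = 0 := by rw [hv', mul_smul_comm, mul_sub, huv, huw, sub_self, smul_zero]
  have hcube : u ^ 3 + v' ^ 3 = 0 := by
    have e1 : (v - w) ^ 3 = β • s := by
      rw [← hβ]
      linear_combination (-3) * hsq _ hvv _ hw + (3 * v - w) * hsq _ hw _ hw
    rw [hv', smul_pow, e1, smul_smul, hμβ, pow_succ', pow_two, hα, neg_smul, add_neg_cancel]
  refine nonempty_algEquiv_A2sp h6 (x := ![u + v', u - v']) (adjoin_range_eq_top hm hres
    (add_mem hu hv'm) (sub_mem hu hv'm) (generates_of_change hgen (α := 2⁻¹) (β := 2⁻¹)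
    (γ := μ⁻¹ * 2⁻¹) (δ := -(μ⁻¹ * 2⁻¹)) ?_ ?_)) ?_ ?_
  · convert (m ^ 2).zero_mem using 1
    match_scalars <;> field_simp <;> ring
  · convert hw using 1
    rw [hv']
    match_scalars <;> field_simp <;> ring
  · change (u + v') ^ 3 = 0
    linear_combination hcube + 3 * (u + v') * huv'
  · change (u - v') ^ 2 = (u + v') ^ 2
    linear_combination (-4) * huv'

/-- A double factor: uv² spans the socle, so subtracting a multiple of v² from u makes its square
zero (dividing by 2), and then subtracting a multiple of the new u' from v makes its cube zero
(dividing by 3). -/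
lemma nonempty_algEquiv_A1sp_of_generators (h2 : (2 : k) ≠ 0) (h3 : (3 : k) ≠ 0)
    [Module.Finite k A] (h6 : Module.finrank k A = 6) (hm : IsNilpotent m)
    (hres : ∀ x : A, ∃ c : k, x - algebraMap k A c ∈ m)
    (hsm : ∀ x ∈ m, s * x = 0) (hs : ∀ z, (∀ x ∈ m, z * x = 0) → ∃ c : k, z = c • s)
    (hsq : ∀ x ∈ m ^ 2, ∀ y ∈ m ^ 2, x * y = 0)
    (hsoc : ∀ x ∈ m, ∀ q ∈ m ^ 2, ∃ c : k, x * q = c • s)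
    (hdim : ∀ p q : A, ¬ ∀ x ∈ m ^ 2, ∃ a b : k, x = a • p + b • q)
    (hu : u ∈ m) (hv : v ∈ m) (hgen : ∀ x ∈ m, ∃ a b : k, x - (a • u + b • v) ∈ m ^ 2)
    {r : k} (huu : u * u = r • s) : Nonempty (A ≃ₐ[k] A1sp k) := by
  have hspan := exists_eq_of_mem_sq hsoc hu hv hgen
  have hvv := mul_mem_sq hv hv
  have huv := mul_mem_sq hu hv
  obtain ⟨c, hc⟩ := hsoc u hu _ hvv
  have hc0 : c ≠ 0 := by
    rintro rfl
    rw [zero_smul] at hc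
    obtain ⟨d, hd⟩ := exists_eq_smul_of_mul_eq_zero hsq hs hgen huv
      (by rw [mul_right_comm, huu, smul_mul_assoc, hsm v hv, smul_zero]) (by rw [mul_assoc, hc])
    refine hdim (v * v) s fun x hx => ?_
    obtain ⟨a, b, f, g, rfl⟩ := hspan x hx
    exact ⟨f, a * r + b * d + g, by rw [hd, huu]; module⟩
  obtain ⟨l, hl⟩ : ∃ l : k, u * u = l • (u * (v * v)) :=
    ⟨r / c, by rw [hc, smul_smul, div_mul_cancel₀ _ hc0, huu]⟩
  obtain ⟨μ, hμ⟩ : ∃ μ : k, v * (v * v) = μ • (u * (v * v)) := by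
    obtain ⟨μ, hμ⟩ := hsoc v hv _ hvv
    exact ⟨μ / c, by rw [hc, smul_smul, div_mul_cancel₀ _ hc0, hμ]⟩
  set w := (l / 2) • (v * v) with hw
  have hwm2 : w ∈ m ^ 2 := (m ^ 2).smul_of_tower_mem _ hvv
  have hwm : w ∈ m := Ideal.pow_le_self two_ne_zero hwm2
  set u' := u - w with hu'
  have hu'm : u' ∈ m := sub_mem hu hwm
  have hu'u' : u' ^ 2 = 0 := by
    have e1 : u * u = 2 * (u * w) := by
      rw [hl, hw, mul_smul_comm, show (2 : A) = algebraMap k A 2 from (map_ofNat _ 2).symm,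
        ← Algebra.smul_def, smul_smul, mul_div_cancel₀ _ h2]
    linear_combination e1 + hsq _ hwm2 _ hwm2
  have hvvu' : v * v * u' = u * (v * v) := by
    linear_combination (-1) * hsq _ hvv _ hwm2
  set v' := v - (μ / 3) • u' with hv'
  have hv'm : v' ∈ m := sub_mem hv (m.smul_of_tower_mem _ hu'm)
  have hv'3 : v' ^ 3 = 0 := by
    have e1 : v * (v * v) = 3 * ((v * v) * ((μ / 3) • u')) := by
      rw [mul_smul_comm, hvvu', hμ, show (3 : A) = algebraMap k A 3 from (map_ofNat _ 3).symm,
        ← Algebra.smul_def, smul_smul, mul_div_cancel₀ _ h3]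
    have e2 : ((μ / 3) • u') ^ 2 = 0 := by rw [smul_pow, hu'u', smul_zero]
    linear_combination e1 + (3 * v - (μ / 3) • u') * e2
  refine nonempty_algEquiv_A1sp h6 (x := ![v', u']) (adjoin_range_eq_top hm hres
    hv'm hu'm (generates_of_change hgen (α := 0) (β := 1) (γ := 1) (δ := μ / 3) ?_ ?_)) hv'3 hu'u'
  · convert hwm2 using 1
    rw [hu']
    module
  · convert (m ^ 2).zero_mem using 1
    rw [hv']
    module

/-- The local Gorenstein algebras of length six and Hilbert function `(1, 2, 2, 1)`. -/
lemma nonempty_algEquiv_of_generators [IsAlgClosed k] (h2 : (2 : k) ≠ 0) (h3 : (3 : k) ≠ 0)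
    [Module.Finite k A] (h6 : Module.finrank k A = 6) (hm : IsNilpotent m)
    (hres : ∀ x : A, ∃ c : k, x - algebraMap k A c ∈ m) (hs0 : s ≠ 0)
    (hsm : ∀ x ∈ m, s * x = 0) (hs : ∀ z, (∀ x ∈ m, z * x = 0) → ∃ c : k, z = c • s)
    (hsq : ∀ x ∈ m ^ 2, ∀ y ∈ m ^ 2, x * y = 0)
    (hdim : Module.finrank k ((m ^ 2).restrictScalars k) = 3) (hu : u ∈ m) (hv : v ∈ m)
    (hgen : ∀ x ∈ m, ∃ a b : k, x - (a • u + b • v) ∈ m ^ 2) :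
    Nonempty (A ≃ₐ[k] A1sp k) ∨ Nonempty (A ≃ₐ[k] A2sp k) := by
  have hdim' := not_forall_mem_sq_of_finrank hdim
  have hsoc : ∀ x ∈ m, ∀ q ∈ m ^ 2, ∃ c : k, x * q = c • s := by
    intro x hx q hq
    refine hs _ fun y hy => ?_
    rw [mul_right_comm]
    exact hsq _ (mul_mem_sq hx hy) _ hq
  -- Otherwise m · m², which lies in both ks and m², is zero, and m² would be contained in the socle
  -- line.
  have hs2 : s ∈ m ^ 2 := by
    by_contra hs2
    refine hdim' 0 s fun q hq => ?_
    obtain ⟨c, hc⟩ := hs q fun x hx => by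
      obtain ⟨c, hc⟩ := hsoc x hx q hq
      have hc0 : c = 0 := by
        by_contra hc0
        refine hs2 ?_
        have := (m ^ 2).smul_of_tower_mem c⁻¹ (hc ▸ (m ^ 2).mul_mem_left x hq)
        rwa [smul_smul, inv_mul_cancel₀ hc0, one_smul] at this
      rw [mul_comm, hc, hc0, zero_smul]
    exact ⟨0, c, by rw [hc]; simp⟩
  -- Four elements u², uv, v², s in a three-dimensional space give a quadratic relation modulo the
  -- socle.
  obtain ⟨a, b, c, d, hrel, hne⟩ : ∃ a b c d : k,
      a • (u * u) + b • (u * v) + c • (v * v) = d • s ∧ ¬ (a = 0 ∧ b = 0 ∧ c = 0) := by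
    let x : Fin 4 → (m ^ 2).restrictScalars k :=
      ![⟨u * u, mul_mem_sq hu hu⟩, ⟨u * v, mul_mem_sq hu hv⟩, ⟨v * v, mul_mem_sq hv hv⟩, ⟨s, hs2⟩]
    have hx : ¬ LinearIndependent k x := fun h => by
      have := h.fintype_card_le_finrank
      rw [hdim, Fintype.card_fin] at this
      omega
    rw [Fintype.not_linearIndependent_iff] at hx
    obtain ⟨g, hg, i, hi⟩ := hx
    have hg' := congrArg Subtype.val hg
    rw [Fin.sum_univ_four] at hg'
    change g 0 • (u * u) + g 1 • (u * v) + g 2 • (v * v) + g 3 • s = 0 at hg'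
    refine ⟨g 0, g 1, g 2, -g 3, by rw [neg_smul]; exact eq_neg_of_add_eq_zero_left hg', ?_⟩
    rintro ⟨h0, h1, h2⟩
    rw [h0, h1, h2, zero_smul, zero_smul, zero_smul, add_zero, add_zero, zero_add,
      smul_eq_zero] at hg'
    fin_cases i
    exacts [hi h0, hi h1, hi h2, hi (hg'.resolve_right hs0)]
  have hfac : (∃ u' v' : A, ∃ r : k, u' ∈ m ∧ v' ∈ m ∧
      (∀ x ∈ m, ∃ a b : k, x - (a • u' + b • v') ∈ m ^ 2) ∧ u' * v' = r • s) ∨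
      ∃ u' v' : A, ∃ r : k, u' ∈ m ∧ v' ∈ m ∧
      (∀ x ∈ m, ∃ a b : k, x - (a • u' + b • v') ∈ m ^ 2) ∧ u' * u' = r • s := by
    by_cases ha : a = 0
    · subst ha
      rw [zero_smul, zero_add] at hrel
      by_cases hb : b = 0
      · subst hb
        have hc : c ≠ 0 := by simpa using hne
        rw [zero_smul, zero_add] at hrel
        refine Or.inr ⟨v, u, c⁻¹ * d, hv, hu, generates_of_change hgen (α := 0) (β := 1) (γ := 1)
          (δ := 0) (by simp) (by simp), ?_⟩
        rw [mul_smul, ← hrel, smul_smul, inv_mul_cancel₀ hc, one_smul]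
      · refine Or.inl ⟨b • u + c • v, v, d, add_mem (m.smul_of_tower_mem b hu)
          (m.smul_of_tower_mem c hv), hv, generates_of_change hgen (α := b⁻¹) (β := -(b⁻¹ * c))
          (γ := 0) (δ := 1) ?_ (by simp), ?_⟩
        · convert (m ^ 2).zero_mem using 1
          match_scalars <;> field_simp <;> ring
        · rw [← hrel, add_mul, smul_mul_assoc, smul_mul_assoc]
    · obtain ⟨t, ht⟩ : ∃ t, a * t ^ 2 + b * t + c = 0 := by
        have : NeZero (2 : k) := ⟨h2⟩
        obtain ⟨t, ht⟩ := exists_quadratic_eq_zero ha (b := b) (c := c)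
          (IsAlgClosed.exists_eq_mul_self _)
        exact ⟨t, by rw [pow_two, ht]⟩
      have hfact : (u - t • v) * (a • u + (a * t + b) • v) = d • s := by
        rw [← hrel, show c = -(a * t ^ 2 + b * t) by linear_combination ht]
        simp only [Algebra.smul_def, map_add, map_mul, map_neg, map_pow]
        ring
      have h1m : u - t • v ∈ m := sub_mem hu (m.smul_of_tower_mem t hv)
      -- Here δ = 2at + b is a square root of the discriminant; it vanishes exactly when the factor
      -- u - tv is double.
      obtain ⟨δ, rfl⟩ : ∃ δ, b = δ - 2 * (a * t) := ⟨b + 2 * (a * t), by ring⟩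
      rw [show a * t + (δ - 2 * (a * t)) = δ - a * t by ring] at hfact
      by_cases hδ : δ = 0
      · refine Or.inr ⟨u - t • v, v, a⁻¹ * d, h1m, hv, generates_of_change hgen (α := 1) (β := t)
          (γ := 0) (δ := 1) (by simp) (by simp), ?_⟩
        rw [mul_smul, ← hfact, hδ, zero_sub, ← mul_smul_comm]
        congr 1
        match_scalars <;> field_simp
      · refine Or.inl ⟨_, _, d, h1m, add_mem (m.smul_of_tower_mem a hu) (m.smul_of_tower_mem _ hv),
          generates_of_change hgen (α := (δ - a * t) / δ) (β := t / δ) (γ := -a / δ)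
          (δ := 1 / δ) ?_ ?_, hfact⟩
        · convert (m ^ 2).zero_mem using 1
          match_scalars <;> field_simp <;> ring
        · convert (m ^ 2).zero_mem using 1
          match_scalars <;> field_simp <;> ring
  rcases hfac with ⟨u', v', r, hu', hv', hgen', h⟩ | ⟨u', v', r, hu', hv', hgen', h⟩
  · exact Or.inr (nonempty_algEquiv_A2sp_of_generators h2 h6 hm hres hsm hs hsq hsoc hdim' hu' hv'
      hgen' h)
  · exact Or.inl (nonempty_algEquiv_A1sp_of_generators h2 h3 h6 hm hres hsm hs hsq hsoc hdim' hu'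
      hv' hgen' h)

end CubicAlgebras

/-- Without a branch element A is local, and duality compares m² with its annihilator W: W ⊆ m² and
dim W + dim m² ≥ 6 leave only dim m² ≥ 4 and dim m² = 3. -/
theorem hasBranchElement_or_nonempty_algEquiv [IsAlgClosed k] (h2 : (2 : k) ≠ 0) (h3 : (3 : k) ≠ 0)
    [Module.Finite k A] (h6 : Module.finrank k A = 6) {φ : A →ₗ[k] k}
    (hφ : ∀ x, (∀ y, φ (x * y) = 0) → x = 0) :
    HasBranchElement k A ∨ Nonempty (A ≃ₐ[k] A16 k) ∨ Nonempty (A ≃ₐ[k] A1sp k) ∨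
      Nonempty (A ≃ₐ[k] A2sp k) := by
  by_contra hcon
  simp only [not_or] at hcon
  obtain ⟨hno, hno1, hno2, hno3⟩ := hcon
  have hloc : ∀ x : A, IsUnit x ∨ IsNilpotent x := by
    intro x
    by_contra h
    rw [not_or] at h
    exact hno (hasBranchElement_of_not_unit_or_nilpotent h2 h6 hφ h.1 h.2)
  have : Nontrivial A := Module.nontrivial_of_finrank_pos (R := k) (by omega)
  have : IsArtinianRing A := IsArtinianRing.of_finite k A
  obtain ⟨m, hm⟩ := Ideal.exists_maximal A
  have hunit : ∀ x ∉ m, IsUnit x := by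
    intro x hx
    by_contra hu
    obtain ⟨n, hn⟩ := (hloc x).resolve_left hu
    exact hx (hm.isPrime.mem_of_pow_mem n (hn ▸ m.zero_mem))
  have hnil : ∀ x ∈ m, IsNilpotent x := fun x hx =>
    (hloc x).resolve_left fun hu => hm.ne_top (Ideal.eq_top_of_isUnit_mem _ hx hu)
  have hmnil : IsNilpotent m := by
    obtain ⟨n, hn⟩ := IsArtinianRing.isNilpotent_nilradical (R := A)
    refine ⟨n, le_bot_iff.1 ?_⟩
    rw [← Ideal.zero_eq_bot, ← hn]
    exact Ideal.pow_right_mono (fun x hx => (mem_nilradical).2 (hnil x hx)) n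
  have hres : ∀ x : A, ∃ c : k, x - algebraMap k A c ∈ m := exists_scalar_sub_mem m
  obtain ⟨s, hs0, hs'⟩ := exists_ne_zero_mul_eq_zero hφ hm.ne_top
  have hφs : ∀ z, (∀ x ∈ m, z * x = 0) → φ z = 0 → z = 0 := by
    intro z hz hφz
    refine hφ z fun x => ?_
    obtain ⟨c, hc⟩ := hres x
    have h := hz _ hc
    rw [mul_sub, sub_eq_zero, mul_comm z (algebraMap k A c), ← Algebra.smul_def] at h
    rw [h, map_smul, hφz, smul_zero]
  have hs : ∀ z, (∀ x ∈ m, z * x = 0) → ∃ c : k, z = c • s := by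
    intro z hz
    have h0 : φ s ≠ 0 := fun h => hs0 (hφs s hs' h)
    refine ⟨φ z / φ s, sub_eq_zero.1 (hφs _ (fun x hx => ?_) ?_)⟩
    · rw [sub_mul, hz x hx, smul_mul_assoc, hs' x hx, smul_zero, sub_zero]
    · rw [map_sub, map_smul, smul_eq_mul, div_mul_cancel₀ _ h0, sub_self]
  set M := m.restrictScalars k with hM
  set Q := (m ^ 2).restrictScalars k with hQ
  have hQM : Q ≤ M := fun x hx => Ideal.pow_le_self two_ne_zero hx
  have hMrank : Module.finrank k M ≤ 5 := by
    have : M < ⊤ := lt_of_le_of_ne le_top fun h => hm.ne_top ((Ideal.eq_top_iff_one m).2 (by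
      change (1 : A) ∈ M
      rw [h]; trivial))
    have := Submodule.finrank_lt_finrank_of_lt this
    rw [finrank_top] at this
    omega
  have hMrank' : 5 ≤ Module.finrank k M := by
    have htop : (⊤ : Submodule k A) ≤ Submodule.span k {1} ⊔ M := by
      rintro x -
      obtain ⟨c, hc⟩ := hres x
      exact Submodule.mem_sup.2 ⟨_, Submodule.mem_span_singleton.2 ⟨c, rfl⟩, _, hc, by
        rw [Algebra.smul_def, mul_one]; ring⟩
    have := (Submodule.finrank_mono htop).trans (Submodule.finrank_add_le_finrank_add_finrank _ _)
    rw [finrank_top, finrank_span_singleton one_ne_zero] at this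
    omega
  -- If m² = 0, then m is the socle line and A has dimension at most 2.
  have hsq0 : ∃ x ∈ m ^ 2, x ≠ 0 := by
    by_contra! h
    have htop : (⊤ : Submodule k A) ≤ Submodule.span k {1} ⊔ Submodule.span k {s} := by
      rintro x -
      obtain ⟨c, hc⟩ := hres x
      obtain ⟨d, hd⟩ := hs _ fun y hy => h _ (by rw [pow_two]; exact Ideal.mul_mem_mul hc hy)
      refine Submodule.mem_sup.2 ⟨_, Submodule.mem_span_singleton.2 ⟨c, rfl⟩, _,
        Submodule.mem_span_singleton.2 ⟨d, rfl⟩, ?_⟩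
      rw [← hd, Algebra.smul_def, mul_one]
      ring
    have := (Submodule.finrank_mono htop).trans (Submodule.finrank_add_le_finrank_add_finrank _ _)
    rw [finrank_top, finrank_span_singleton one_ne_zero, finrank_span_singleton hs0] at this
    omega
  -- Pairing with m² through φ; the kernel W is the annihilator of m², since m² is an ideal and φ is
  -- nondegenerate.
  let T : A →ₗ[k] Module.Dual k Q := ((LinearMap.mul k A).compr₂ φ).compl₂ Q.subtype
  let W := LinearMap.ker T
  have hW : ∀ z, z ∈ W ↔ ∀ x ∈ m ^ 2, z * x = 0 := by
    intro z
    rw [LinearMap.mem_ker]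
    refine ⟨fun h x hx => hφ _ fun y => ?_, fun h => LinearMap.ext fun x => ?_⟩
    · rw [mul_assoc]
      exact LinearMap.congr_fun h (⟨x * y, (m ^ 2).mul_mem_right y hx⟩ : Q)
    · change φ (z * x) = 0
      rw [h _ x.2, map_zero]
  have hWm : ∀ z ∈ W, z ∈ m := by
    intro z hz
    by_contra hzm
    obtain ⟨x, hx, hx0⟩ := hsq0
    exact hx0 ((hunit z hzm).mul_right_eq_zero.1 ((hW z).1 hz x hx))
  have hWsq : ∀ z ∈ W, z * z = 0 := by
    intro z hz
    by_contra hzz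
    exact hno (hasBranchElement_of_sq_ne_zero hres hs (hWm z hz) ((hW z).1 hz) hzz)
  have hWW : ∀ z ∈ W, ∀ w ∈ W, z * w = 0 := by
    intro y hy z hz
    have h := hWsq _ (W.add_mem hy hz)
    rw [add_mul, mul_add, mul_add, hWsq y hy, hWsq z hz, zero_add, add_zero, mul_comm z y,
      ← two_smul k] at h
    exact (smul_eq_zero.1 h).resolve_left h2
  -- A functional vanishing on m² but not at z is φ(w ·) with w ∈ W, while wz = 0 because W² = 0.
  have hWQ : W ≤ Q := by
    intro z hz
    by_contra hzQ
    obtain ⟨θ, hθz, hθ⟩ := Submodule.exists_le_ker_of_notMem hzQ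
    obtain ⟨w, hw⟩ := exists_mul_eq_of_nondegenerate hφ θ
    have hwW : w ∈ W := (hW w).2 fun x hx => hφ _ fun y => by
      rw [mul_assoc, ← hw]
      exact hθ ((m ^ 2).mul_mem_right y hx)
    rw [hw, hWW w hwW z hz, map_zero] at hθz
    exact hθz rfl
  have hWrank : 6 ≤ Module.finrank k W + Module.finrank k Q := by
    have h1 := LinearMap.finrank_range_add_finrank_ker T
    have h3 := Submodule.finrank_le (LinearMap.range T)
    rw [Subspace.dual_finrank_eq] at h3
    change _ + Module.finrank k W = _ at h1
    omega
  have hle := Submodule.finrank_mono hWQ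
  have hquot := Submodule.finrank_quotient_add_finrank (Q.submoduleOf M)
  rw [(Submodule.submoduleOfEquivOfLe hQM).finrank_eq] at hquot
  -- As dim m = 5, this makes m/m² at most one-dimensional, so a single nilpotent generates A.
  by_cases h4 : 4 ≤ Module.finrank k Q
  · obtain ⟨⟨u, hu⟩, hu'⟩ : ∃ u : M, ∀ x : M, ∃ c : k, x - c • u ∈ Q.submoduleOf M := by
      obtain ⟨q, hq⟩ := finrank_le_one_iff.1 (show Module.finrank k (M ⧸ Q.submoduleOf M) ≤ 1 by
        omega)
      obtain ⟨u, rfl⟩ := Submodule.Quotient.mk_surjective _ q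
      refine ⟨u, fun x => ?_⟩
      obtain ⟨c, hc⟩ := hq (Submodule.Quotient.mk x)
      exact ⟨c, (Submodule.Quotient.eq _).1 hc.symm⟩
    refine hno1 (nonempty_algEquiv_A16 h6 (u := u) (adjoin_eq_top_of_le_sup_sq hmnil hres
      (Set.singleton_subset_iff.2 hu) fun x hx => ?_) (hnil u hu))
    obtain ⟨c, hc⟩ := hu' ⟨x, hx⟩
    exact ⟨c • u, Submodule.smul_mem _ _ (Submodule.mem_span_singleton_self u), hc⟩
  · have hWQ' : W = Q := Submodule.eq_of_le_of_finrank_le hWQ (by omega)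
    have hQ2 : ∃ u v : M, ∀ x : M, ∃ a b : k, x - (a • u + b • v) ∈ Q.submoduleOf M := by
      let b := Module.finBasisOfFinrankEq k (M ⧸ Q.submoduleOf M) (n := 2) (by omega)
      obtain ⟨u, hu⟩ := Submodule.Quotient.mk_surjective _ (b 0)
      obtain ⟨v, hv⟩ := Submodule.Quotient.mk_surjective _ (b 1)
      refine ⟨u, v, fun x => ?_⟩
      have h := b.sum_repr (Submodule.Quotient.mk x)
      rw [Fin.sum_univ_two, ← hu, ← hv] at h
      exact ⟨_, _, (Submodule.Quotient.eq _).1 h.symm⟩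
    obtain ⟨⟨u, hu⟩, ⟨v, hv⟩, huv⟩ := hQ2
    have := nonempty_algEquiv_of_generators h2 h3 h6 hmnil hres hs0 hs' hs
      (fun x hx y hy => (hW x).1 (by rw [hWQ']; exact hx) y hy)
      (show Module.finrank k Q = 3 by omega) hu hv (fun x hx => huv ⟨x, hx⟩)
    exact this.elim hno2 hno3

end LocalAlgebras

theorem proposition6p5p3 {k : Type*} [Field k] [IsAlgClosed k]
    (h2 : (2 : k) ≠ 0) (h3 : (3 : k) ≠ 0)
    (X : Ideal (MvPolynomial (Fin 5) k)) (hX : X ∈ hilbAGCodim k 4 6 0) :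
    IsItalian X ↔ X ∉ orbitO k (A16 k) ∪ orbitO k (A1sp k) ∪ orbitO k (A2sp k) := by
  constructor
  · rintro h ((hX' | hX') | hX')
    · exact notMem_orbitO_of_isItalian h ⟨A16_hasNilpotentResidues, A16_secondSocleSqZero⟩ hX'
    · exact notMem_orbitO_of_isItalian h A1sp_properties hX'
    · exact notMem_orbitO_of_isItalian h A2sp_properties hX'
  · intro hX'
    have : Infinite k := IsAlgClosed.instInfinite
    obtain ⟨l, hl, hreg⟩ := exists_linear_regular hX.1.1
    -- A is taken to be the coordinate ring of X in the chart l = 1 itself.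
    obtain ⟨a, hXa, -, -, ha, hfin, h6, φ, hker, hφ⟩ :=
      exists_algebraic_data hX hl hreg AlgEquiv.refl
    have hmem (B : Type _) [CommRing B] [Algebra k B]
        (e : Nonempty ((MvPolynomial (Fin 5) k ⧸ (X ⊔ Ideal.span {l - 1})) ≃ₐ[k] B)) :
        X ∈ orbitO k B := ⟨X, hX, ⟨l, hl, hreg, e⟩, ProjectivelyEquivalent.refl X⟩
    rcases hasBranchElement_or_nonempty_algEquiv h2 h3 h6 hφ with ⟨y, hy, hy'⟩ | e | e | e
    · rw [hXa]
      exact isItalian_of_element h2 h3 h6 ha hker hφ hy hy'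
    · exact absurd (Or.inl (Or.inl (hmem _ e))) hX'
    · exact absurd (Or.inl (Or.inr (hmem _ e))) hX'
    · exact absurd (Or.inr (hmem _ e)) hX'
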